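/- Let $X_{\tilde n}^{(k)}$ be one of the affine types $A_n^{(1)}$ ($n\ge1$), $B_n^{(1)}$ ($n\ge3$), $C_n^{(1)}$ ($n\ge2$), $D_n^{(1)}$ ($n\ge4$), $E_6^{(1)},E_7^{(1)},E_8^{(1)},F_4^{(1)},G_2^{(1)}$, $A_{2n}^{(2)}$ ($n\ge1$), $A_{2n-1}^{(2)}$ ($n\ge3$), $D_{n+1}^{(2)}$ ($n\ge2$), $E_6^{(2)}$, $D_4^{(3)}$, with vertex set $I=\{0,\dots,n\}$ of its Dynkin diagram, $I_0=I\setminus\{0\}$, where the vertex $0$ is chosen so that the minimal positive imaginary root $\delta$ has $\alpha_0$-coefficient $1$ and, in type $A_{2n}^{(2)}$, $\alpha_0$ is a longest simple root. Let $A=(a_{ij})_{i,j\in I}$ be the Cartan matrix, $d_i$ ($i\in I$) the coprime positive integers with $d_ia_{ij}=d_ja_{ji}$, $Q=\bigoplus_{i\in I}\mathbb Z\alpha_i\supseteq Q_0=\bigoplus_{i\in I_0}\mathbb Z\alpha_i$, and let $\Phi\subseteq Q$ be the affine root system, that is, the set of the images of the simple roots $\alpha_i$ ($i\in I$) under the affine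 Weyl group generated by $s_i:\alpha_j\mapsto\alpha_j-a_{ij}\alpha_i$ ($i\in I$), together with the nonzero integer multiples of $\delta$. Put $\tilde d_i=1$ if $k=1$ or the type is $A_{2n}^{(2)}$, $\tilde d_i=d_i$ otherwise, and $\tilde d_{ij}=\max\{\tilde d_i,\tilde d_j\}$ ($i,j\in I_0$). Let $L_+$ be the complex Lie algebra generated by $x_{i,r}^+$ ($i\in I_0$, $r\in\mathbb N=\{0,1,2,\dots\}$) with the following relations, where $i,j\in I_0$, $s,r,r_1,r_2,\dots\in\mathbb N$, and $\sigma\in\mathcal S_m$ acts on expressions by permuting $r_1,\dots,r_m$: - $x_{i,r}^+=0$ if $\tilde d_i\nmid r$; - $[x_{i,r+\tilde d_{ij}}^+,x_{j,s}^+]+[x_{j,s+\tilde d_{ij}}^+,x_{i,r}^+]=0$ if $a_{ij}<0$, $\tilde d_i\mid r$, $\tilde d_j\mid s$; - $\sum_{\sigma\in\mathcal S_2}\sigma.[x_{i,r_1+\tilde d_i}^+,x_{i,r_2}^+]=0$ unless the type is $A_{2n}^{(2)}$ and $d_i=1$; - $\sum_{\sigma\in\mathcal S_2}\sigma.[x_{i,r_1+2}^+,x_{i,r_2}^+]=0$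 and $\sum_{\sigma\in\mathcal S_3}\sigma.[[x_{i,r_1+1}^+,x_{i,r_2}^+],x_{i,r_3}^+]=0$ if the type is $A_{2n}^{(2)}$ and $d_i=1$; - $\sum_{\sigma\in\mathcal S_2}\sigma.[[x_{j,s}^+,x_{i,r_1+1}^+],x_{i,r_2}^+]=0$ if $k=2$, $a_{ij}=-2$ and the type is not $A_{2n}^{(2)}$; - $\sum_{\sigma\in\mathcal S_2}\sigma.\big([[x_{j,s}^+,x_{i,r_1+1}^+],x_{i,r_2}^+]+[[x_{j,s}^+,x_{i,r_2}^+],x_{i,r_1+1}^+]\big)=0$ if $a_{ij}=-2$ and the type is $A_{2n}^{(2)}$; - $\sum_{\sigma\in\mathcal S_2}\sigma.\big(2[[x_{j,s}^+,x_{i,r_1+2}^+],x_{i,r_2}^+]+[[x_{j,s}^+,x_{i,r_1+1}^+],x_{i,r_2+1}^+]\big)=0$ and $\sum_{\sigma\in\mathcal S_3}\sigma.[[[x_{j,s}^+,x_{i,r_1+1}^+],x_{i,r_2}^+],x_{i,r_3}^+]=0$ if $k=3$, $a_{ij}=-3$; - $\sum_{\sigma\in\mathcal S_{1-a_{ij}}}\sigma.[\dots[[x_{j,s}^+,x_{i,r_1}^+],x_{i,r_2}^+],\dots,x_{i,r_{1-a_{ij}}}^+]=0$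 if $i\ne j$. Let $L_-=(L_+)^{op}$ be the opposite Lie algebra, with $x_{i,r}^-\in L_-$ denoting $-x_{i,r}^+$, let $L_0$ be the abelian complex Lie algebra generated by $h_{i,r}$ ($i\in I_0$, $r\in\mathbb N$) with relations $h_{i,r}=0$ if $\tilde d_i\nmid r$, and let $L=L_-\oplus L_0\oplus L_+$. Give $L$ the $Q$-grading, compatible with the brackets of $L_-,L_0,L_+$, in which $x_{i,r}^\pm$ has degree $\pm\alpha_i+r\delta$ and $h_{i,r}$ has degree $r\delta$; let $L_\beta$ be the component of degree $\beta\in Q$. **Proposition 8.20.** For all $\alpha\in Q_0\setminus\{0\}$ and $r\in\mathbb N$, $$\dim_{\mathbb C}L_{\alpha+r\delta}\le\begin{cases}1&\text{if }\alpha+r\delta\in\Phi,\\0&\text{otherwise.}\end{cases}$$ -/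

import Mathlib

noncomputable section

/-! ## Affine Dynkin diagrams -/

/-- The types `X_ñ^(k)` of affine Kac-Moody algebras. The parameter `n` is always the rank of
`𝔤₀ = 𝔤^χ`, so that the vertices of the affine Dynkin diagram are `0, 1, …, n`. -/
inductive AffineType : Type
  /-- `A_n^(1)`, `n ≥ 1` -/
  | A (n : ℕ) (hn : 1 ≤ n)
  /-- `B_n^(1)`, `n ≥ 3` -/
  | B (n : ℕ) (hn : 3 ≤ n)
  /-- `C_n^(1)`, `n ≥ 2` -/
  | C (n : ℕ) (hn : 2 ≤ n)
  /-- `D_n^(1)`, `n ≥ 4` -/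
  | D (n : ℕ) (hn : 4 ≤ n)
  /-- `E_6^(1)` -/
  | E6
  /-- `E_7^(1)` -/
  | E7
  /-- `E_8^(1)` -/
  | E8
  /-- `F_4^(1)` -/
  | F4
  /-- `G_2^(1)` -/
  | G2
  /-- `A_{2n}^(2)`, `n ≥ 1` -/
  | twistedAEven (n : ℕ) (hn : 1 ≤ n)
  /-- `A_{2n-1}^(2)`, `n ≥ 3` -/
  | twistedAOdd (n : ℕ) (hn : 3 ≤ n)
  /-- `D_{n+1}^(2)`, `n ≥ 2` -/
  | twistedD (n : ℕ) (hn : 2 ≤ n)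
  /-- `E_6^(2)` -/
  | twistedE6
  /-- `D_4^(3)` -/
  | twistedD4

namespace AffineType

/-- The rank `n` of `𝔤₀`. -/
def rank : AffineType → ℕ
  | A n _ => n
  | B n _ => n
  | C n _ => n
  | D n _ => n
  | E6 => 6
  | E7 => 7
  | E8 => 8
  | F4 => 4
  | G2 => 2
  | twistedAEven n _ => n
  | twistedAOdd n _ => n
  | twistedD n _ => n
  | twistedE6 => 4
  | twistedD4 => 2

/-- The order `k` of the diagram automorphism `χ`. -/
def order : AffineType → ℕ
  | twistedAEven _ _ => 2
  | twistedAOdd _ _ => 2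
  | twistedD _ _ => 2
  | twistedE6 => 2
  | twistedD4 => 3
  | _ => 1

/-- The type is `A_{2n}^(2)` for some `n`. -/
def IsTwistedAEven : AffineType → Prop
  | twistedAEven _ _ => True
  | _ => False

/-- The edges `{i, j}`, `i < j`, of the affine Dynkin diagram. -/
def Edge : AffineType → ℕ → ℕ → Prop
  | A n _, i, j => i + 1 = j ∨ (i = 0 ∧ j = n)
  | B _ _, i, j => (1 ≤ i ∧ i + 1 = j) ∨ (i = 0 ∧ j = 2)
  | C _ _, i, j => i + 1 = j
  | D n _, i, j => (1 ≤ i ∧ i + 1 = j ∧ j < n) ∨ (i = 0 ∧ j = 2) ∨ (i + 2 = n ∧ j = n)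
  | E6, i, j => (i, j) ∈ [(1, 3), (3, 4), (4, 5), (5, 6), (2, 4), (0, 2)]
  | E7, i, j => (i, j) ∈ [(1, 3), (3, 4), (4, 5), (5, 6), (6, 7), (2, 4), (0, 1)]
  | E8, i, j => (i, j) ∈ [(1, 3), (3, 4), (4, 5), (5, 6), (6, 7), (7, 8), (2, 4), (0, 8)]
  | F4, i, j => i + 1 = j
  | G2, i, j => i + 1 = j
  | twistedAEven _ _, i, j => i + 1 = j
  | twistedAOdd _ _, i, j => (1 ≤ i ∧ i + 1 = j) ∨ (i = 0 ∧ j = 2)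
  | twistedD _ _, i, j => i + 1 = j
  | twistedE6, i, j => i + 1 = j
  | twistedD4, i, j => i + 1 = j

/-- The integers `d_i`: the positive coprime integers with `d_i a_ij = d_j a_ji`. The form on the
root lattice is `(α_i | α_j) = d_i a_ij`, so `α_i` has square length `2 d_i`. -/
def symmetrizer : AffineType → ℕ → ℕ
  | A _ _, _ => 1
  | B n _, i => if i = n then 1 else 2
  | C n _, i => if i = 0 ∨ i = n then 2 else 1
  | D _ _, _ => 1
  | E6, _ => 1
  | E7, _ => 1
  | E8, _ => 1
  | F4, i => if i ≤ 2 then 2 else 1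
  | G2, i => if i ≤ 1 then 3 else 1
  | twistedAEven n _, i => if i = 0 then 4 else if i = n then 1 else 2
  | twistedAOdd n _, i => if i = n then 2 else 1
  | twistedD n _, i => if i = 0 ∨ i = n then 1 else 2
  | twistedE6, i => if i ≤ 2 then 1 else 2
  | twistedD4, i => if i ≤ 1 then 1 else 3

/-- The coefficients of `δ` with respect to the simple roots `α_0, …, α_n`: the positive coprime
integers in the kernel of the Cartan matrix. -/
def mark : AffineType → ℕ → ℕ
  | A _ _, _ => 1
  | B _ _, i => if i ≤ 1 then 1 else 2
  | C n _, i => if i = 0 ∨ i = n then 1 else 2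
  | D n _, i => if i ≤ 1 ∨ n ≤ i + 1 then 1 else 2
  | E6, i => [1, 1, 2, 2, 3, 2, 1].getD i 0
  | E7, i => [1, 2, 2, 3, 4, 3, 2, 1].getD i 0
  | E8, i => [1, 2, 3, 4, 6, 5, 4, 3, 2].getD i 0
  | F4, i => [1, 2, 3, 4, 2].getD i 0
  | G2, i => [1, 2, 3].getD i 0
  | twistedAEven _ _, i => if i = 0 then 1 else 2
  | twistedAOdd n _, i => if i ≤ 1 ∨ i = n then 1 else 2
  | twistedD _ _, _ => 1
  | twistedE6, i => [1, 2, 3, 2, 1].getD i 0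
  | twistedD4, i => [1, 2, 1].getD i 0

variable (T : AffineType)

/-- The set `I = {0, 1, …, n}` of vertices of the affine Dynkin diagram. -/
abbrev Vertex : Type := Fin (T.rank + 1)

/-- The set `I₀ = I \ {0} = {1, …, n}`, embedded in `I` by `Fin.succ`. -/
abbrev Vertex₀ : Type := Fin T.rank

/-- `d_i` for `i ∈ I₀`. -/
def d (i : T.Vertex₀) : ℕ := T.symmetrizer (i.succ : T.Vertex)

open Classical in
/-- The affine Cartan matrix `A = (a_ij)`, `a_ij = 2 (α_i | α_j) / (α_i | α_i)`. For an edge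
between `i` and `j` one has `(α_i | α_j) = - max d_i d_j`, except in type `A_1^(1)`, where
`a_01 = a_10 = -2`. -/
def cartan : Matrix T.Vertex T.Vertex ℤ := fun i j =>
  if i = j then 2
  else if T.Edge i j ∨ T.Edge j i then
    if T.order = 1 ∧ T.rank = 1 then -2
    else -((max (T.symmetrizer i) (T.symmetrizer j) / T.symmetrizer i : ℕ) : ℤ)
  else 0

/-- The Cartan matrix `A₀ = (a_ij)_{i, j ∈ I₀}` of `𝔤₀`. -/
def cartan₀ : Matrix T.Vertex₀ T.Vertex₀ ℤ := fun i j => T.cartan i.succ j.succ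

/-! ## Root lattice, Weyl group, roots -/

/-- The root lattice `Q = ⨁_{i ∈ I} ℤ α_i`. -/
abbrev RootLattice : Type := T.Vertex → ℤ

/-- The simple root `α_i`, `i ∈ I`. -/
def simpleRoot (i : T.Vertex) : T.RootLattice := Pi.single i 1

/-- The sublattice `Q₀ = ⨁_{i ∈ I₀} ℤ α_i` of `Q`. -/
def Q₀ : Submodule ℤ T.RootLattice :=
  Submodule.span ℤ (Set.range fun i : T.Vertex₀ => T.simpleRoot i.succ)

/-- The imaginary root `δ`. -/
def δ : T.RootLattice := fun i => (T.mark i : ℤ)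

/-- The simple coroot of `i ∈ I`, as the linear form `α_j ↦ a_ij` on `Q`. -/
def simpleCoroot (i : T.Vertex) : Module.Dual ℤ T.RootLattice :=
  Fintype.linearCombination ℤ (T.cartan i)

theorem simpleCoroot_simpleRoot (i j : T.Vertex) :
    T.simpleCoroot i (T.simpleRoot j) = T.cartan i j := by
  simp [simpleCoroot, simpleRoot]

theorem simpleCoroot_simpleRoot_self (i : T.Vertex) :
    T.simpleCoroot i (T.simpleRoot i) = 2 := by
  rw [simpleCoroot_simpleRoot]
  simp [cartan]

/-- The simple reflection `s_i : α_j ↦ α_j - a_ij α_i`, `i ∈ I`. -/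
def simpleReflection (i : T.Vertex) : T.RootLattice ≃ₗ[ℤ] T.RootLattice :=
  Module.reflection (T.simpleCoroot_simpleRoot_self i)

/-- The affine Weyl group `W = ⟨s_i | i ∈ I⟩`. -/
def weylGroup : Subgroup (T.RootLattice ≃ₗ[ℤ] T.RootLattice) :=
  Subgroup.closure (Set.range T.simpleReflection)

/-- The real roots: the `W`-translates of the simple roots. -/
def realRoots : Set T.RootLattice :=
  {β | ∃ w ∈ T.weylGroup, ∃ i : T.Vertex, β = w (T.simpleRoot i)}

/-- The imaginary roots: the nonzero integer multiples of `δ`. -/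
def imaginaryRoots : Set T.RootLattice :=
  {β | ∃ m : ℤ, m ≠ 0 ∧ β = m • T.δ}

/-- The root system `Φ` of the affine Kac-Moody algebra. -/
def roots : Set T.RootLattice := T.realRoots ∪ T.imaginaryRoots

/-! ## The numbers `d̃_i` -/

open Classical in
/-- `d̃_i = 1` if `k = 1` or the type is `A_{2n}^(2)`, and `d̃_i = d_i` otherwise. -/
def dTilde (i : T.Vertex₀) : ℕ :=
  if T.order = 1 ∨ T.IsTwistedAEven then 1 else T.d i

/-- `d̃_ij = max d̃_i d̃_j`. -/
def dTilde₂ (i j : T.Vertex₀) : ℕ := max (T.dTilde i) (T.dTilde j)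

/-- The condition `(X_ñ^(k), d_i) = (A_{2n}^(2), 1)`. -/
def IsSpecial (i : T.Vertex₀) : Prop := T.IsTwistedAEven ∧ T.d i = 1

end AffineType

/-! ## Lie algebras by generators and relations, opposite Lie algebras, gradings -/

/-- The complex Lie algebra generated by `X` with relations `u = 0`, `u ∈ rels`. -/
def PresentedLieAlgebra {X : Type} (rels : Set (FreeLieAlgebra ℂ X)) : Type :=
  FreeLieAlgebra ℂ X ⧸ LieSubmodule.lieSpan ℂ (FreeLieAlgebra ℂ X) rels

namespace PresentedLieAlgebra

variable {X : Type} (rels : Set (FreeLieAlgebra ℂ X))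

instance : LieRing (PresentedLieAlgebra rels) :=
  inferInstanceAs (LieRing (FreeLieAlgebra ℂ X ⧸
    LieSubmodule.lieSpan ℂ (FreeLieAlgebra ℂ X) rels))

instance : LieAlgebra ℂ (PresentedLieAlgebra rels) :=
  inferInstanceAs (LieAlgebra ℂ (FreeLieAlgebra ℂ X ⧸
    LieSubmodule.lieSpan ℂ (FreeLieAlgebra ℂ X) rels))

/-- The image of a generator. -/
def of (x : X) : PresentedLieAlgebra rels :=
  LieSubmodule.Quotient.mk (N := LieSubmodule.lieSpan ℂ (FreeLieAlgebra ℂ X) rels)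
    (FreeLieAlgebra.of ℂ x)

end PresentedLieAlgebra

/-- The opposite `L^op` of a Lie algebra `L`: the same vector space with bracket
`[x, y]^op = [y, x]`. -/
def LieOpposite (L : Type) : Type := L

namespace LieOpposite

variable {L : Type}

/-- The identity map `L → L^op`. -/
def op (x : L) : LieOpposite L := x

/-- The identity map `L^op → L`. -/
def unop (x : LieOpposite L) : L := x

instance [LieRing L] : AddCommGroup (LieOpposite L) := inferInstanceAs (AddCommGroup L)

instance [LieRing L] [LieAlgebra ℂ L] : Module ℂ (LieOpposite L) :=
  inferInstanceAs (Module ℂ L)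

instance [LieRing L] : LieRing (LieOpposite L) where
  bracket x y := op ⁅unop y, unop x⁆
  add_lie x y z := lie_add (unop z) (unop x) (unop y)
  lie_add x y z := add_lie (unop y) (unop z) (unop x)
  lie_self x := lie_self (unop x)
  leibniz_lie x y z := by
    change ⁅⁅unop z, unop y⁆, unop x⁆ = ⁅unop z, ⁅unop y, unop x⁆⁆ + ⁅⁅unop z, unop x⁆, unop y⁆
    rw [lie_lie, sub_eq_add_neg, lie_skew]

instance [LieRing L] [LieAlgebra ℂ L] : LieAlgebra ℂ (LieOpposite L) where
  lie_smul t x y := smul_lie t (unop y) (unop x)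

end LieOpposite

/-- `IsMonomial x wt γ u`: the element `u` is an iterated Lie bracket (with any arrangement of
brackets) of elements `x i` whose weights `wt i` sum up to `γ`. -/
inductive IsMonomial {L ι Γ : Type} [LieRing L] [AddCommGroup Γ] (x : ι → L) (wt : ι → Γ) :
    Γ → L → Prop
  | gen (i : ι) : IsMonomial x wt (wt i) (x i)
  | lie {γ γ' : Γ} {u v : L} (hu : IsMonomial x wt γ u) (hv : IsMonomial x wt γ' v) :
      IsMonomial x wt (γ + γ') ⁅u, v⁆

/-- The `γ`-homogeneous component of a Lie algebra generated by homogeneous elements `x i` of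
degree `wt i`: the linear span of the iterated brackets of generators of total degree `γ`. -/
def gradedPiece {L ι Γ : Type} [LieRing L] [LieAlgebra ℂ L] [AddCommGroup Γ]
    (x : ι → L) (wt : ι → Γ) (γ : Γ) : Submodule ℂ L :=
  Submodule.span ℂ {u | IsMonomial x wt γ u}

namespace AffineType

variable (T : AffineType)

/-! ## The Lie algebra `L₊` -/

/-- The free generator `x_{i,r}⁺`, `i ∈ I₀`, `r ≥ 0`. -/
def freeX (i : T.Vertex₀) (r : ℕ) : FreeLieAlgebra ℂ (T.Vertex₀ × ℕ) :=
  FreeLieAlgebra.of ℂ (i, r)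

/-- The left-normed bracket `[…[[x_{j,s}⁺, x_{i,t₁}⁺], x_{i,t₂}⁺], …, x_{i,t_m}⁺]` for the list
`t = [t₁, …, t_m]`. -/
def leftBracket (i j : T.Vertex₀) (s : ℕ) (t : List ℕ) : FreeLieAlgebra ℂ (T.Vertex₀ × ℕ) :=
  t.foldl (fun u l => ⁅u, T.freeX i l⁆) (T.freeX j s)

/-- The left-hand sides of the defining relations of `L₊`. -/
inductive IsRelator : FreeLieAlgebra ℂ (T.Vertex₀ × ℕ) → Prop
  | zx (i : T.Vertex₀) (r : ℕ) (h : ¬ T.dTilde i ∣ r) : IsRelator (T.freeX i r)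
  | xd (i j : T.Vertex₀) (r s : ℕ) (hr : T.dTilde i ∣ r) (hs : T.dTilde j ∣ s)
      (h : T.cartan₀ i j < 0) :
      IsRelator (⁅T.freeX i (r + T.dTilde₂ i j), T.freeX j s⁆ +
        ⁅T.freeX j (s + T.dTilde₂ i j), T.freeX i r⁆)
  | x1 (i : T.Vertex₀) (r : Fin 2 → ℕ) (h : ¬ T.IsSpecial i) :
      IsRelator (∑ σ : Equiv.Perm (Fin 2),
        ⁅T.freeX i (r (σ 0) + T.dTilde i), T.freeX i (r (σ 1))⁆)
  | x2 (i : T.Vertex₀) (r : Fin 2 → ℕ) (h : T.IsSpecial i) :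
      IsRelator (∑ σ : Equiv.Perm (Fin 2),
        ⁅T.freeX i (r (σ 0) + 2), T.freeX i (r (σ 1))⁆)
  | x3 (i : T.Vertex₀) (r : Fin 3 → ℕ) (h : T.IsSpecial i) :
      IsRelator (∑ σ : Equiv.Perm (Fin 3),
        ⁅⁅T.freeX i (r (σ 0) + 1), T.freeX i (r (σ 1))⁆, T.freeX i (r (σ 2))⁆)
  | t2 (i j : T.Vertex₀) (r : Fin 2 → ℕ) (s : ℕ) (h : T.cartan₀ i j = -2) (hk : T.order = 2)
      (hT : ¬ T.IsTwistedAEven) :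
      IsRelator (∑ σ : Equiv.Perm (Fin 2),
        ⁅⁅T.freeX j s, T.freeX i (r (σ 0) + 1)⁆, T.freeX i (r (σ 1))⁆)
  | s2 (i j : T.Vertex₀) (r : Fin 2 → ℕ) (s : ℕ) (h : T.cartan₀ i j = -2)
      (hT : T.IsTwistedAEven) :
      IsRelator (∑ σ : Equiv.Perm (Fin 2),
        (⁅⁅T.freeX j s, T.freeX i (r (σ 0) + 1)⁆, T.freeX i (r (σ 1))⁆ +
          ⁅⁅T.freeX j s, T.freeX i (r (σ 1))⁆, T.freeX i (r (σ 0) + 1)⁆))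
  | t3 (i j : T.Vertex₀) (r : Fin 2 → ℕ) (s : ℕ) (h : T.cartan₀ i j = -3) (hk : T.order = 3) :
      IsRelator (∑ σ : Equiv.Perm (Fin 2),
        ((2 : ℂ) • ⁅⁅T.freeX j s, T.freeX i (r (σ 0) + 2)⁆, T.freeX i (r (σ 1))⁆ +
          ⁅⁅T.freeX j s, T.freeX i (r (σ 0) + 1)⁆, T.freeX i (r (σ 1) + 1)⁆))
  | u3 (i j : T.Vertex₀) (r : Fin 3 → ℕ) (s : ℕ) (h : T.cartan₀ i j = -3) (hk : T.order = 3) :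
      IsRelator (∑ σ : Equiv.Perm (Fin 3),
        ⁅⁅⁅T.freeX j s, T.freeX i (r (σ 0) + 1)⁆, T.freeX i (r (σ 1))⁆, T.freeX i (r (σ 2))⁆)
  | serre (i j : T.Vertex₀) (hij : i ≠ j) (r : Fin (1 - T.cartan₀ i j).toNat → ℕ) (s : ℕ) :
      IsRelator (∑ σ : Equiv.Perm (Fin (1 - T.cartan₀ i j).toNat),
        T.leftBracket i j s (List.ofFn fun l => r (σ l)))

/-- `L₊`: the Lie algebra generated by the `x_{i,r}⁺` (`i ∈ I₀`, `r ≥ 0`) with the relations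
above. -/
abbrev LPlus : Type := PresentedLieAlgebra {u | T.IsRelator u}

/-- The generator `x_{i,r}⁺` of `L₊`. -/
def xPlus (p : T.Vertex₀ × ℕ) : T.LPlus := PresentedLieAlgebra.of _ p

/-! ## The Lie algebras `L₋`, `L₀` and the space `L` -/

/-- `L₋ = (L₊)^op`. -/
abbrev LMinus : Type := LieOpposite T.LPlus

/-- `x_{i,r}⁻`: the element `-x_{i,r}⁺`, seen in `L₋`. -/
def xMinus (p : T.Vertex₀ × ℕ) : T.LMinus := LieOpposite.op (-T.xPlus p)

/-- `L₀`: the abelian Lie algebra generated by the `h_{i,r}` (`i ∈ I₀`, `r ≥ 0`) with the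
relations `h_{i,r} = 0` for `d̃_i ∤ r`. -/
abbrev LZero : Type :=
  PresentedLieAlgebra ({u | ∃ p q : T.Vertex₀ × ℕ,
      u = ⁅FreeLieAlgebra.of ℂ p, FreeLieAlgebra.of ℂ q⁆} ∪
    {u | ∃ (i : T.Vertex₀) (r : ℕ), ¬ T.dTilde i ∣ r ∧ u = FreeLieAlgebra.of ℂ (i, r)})

/-- The generator `h_{i,r}` of `L₀`. -/
def hZero (p : T.Vertex₀ × ℕ) : T.LZero := PresentedLieAlgebra.of _ p

/-- `L = L₋ ⊕ L₀ ⊕ L₊`. -/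
abbrev LTotal : Type := T.LMinus × T.LZero × T.LPlus

/-- The homogeneous component `L_β`, `β ∈ Q`, for the `Q`-grading of `L` in which `x_{i,r}⁺`,
`x_{i,r}⁻`, `h_{i,r}` have degrees `α_i + rδ`, `-α_i + rδ`, `rδ`. -/
def component (β : T.RootLattice) : Submodule ℂ T.LTotal :=
  (gradedPiece T.xMinus (fun p => -T.simpleRoot p.1.succ + p.2 • T.δ) β).prod
    ((gradedPiece T.hZero (fun p => p.2 • T.δ) β).prod
      (gradedPiece T.xPlus (fun p => T.simpleRoot p.1.succ + p.2 • T.δ) β))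

end AffineType

end

/-! The proof rests on a reflection principle for the Lie algebra `L₊`, whose component of degree
`α + rδ` is `piece (α, r)`.

Fix `i ∈ I₀` and let `raise i` be the derivation `u ↦ [u, x_{i,0}]`. The defining relations imply that
every left-normed bracket `[…[x_{j,s}, x_{i,t₁}], …, x_{i,t_m}]` with `j ≠ i` is a combination of
elements of *strings* `u, raise i u, …, raise i ^ m u` with `raise i ^ (m + 1) u = 0` whose bottom `u`
has weight `-m` with respect to the coroot `α_i^∨` (`leftBracketPlus_mem`, by cases according to
`d̃_i`, `d̃_j` and `a_ij`). These brackets generate a Lie subalgebra which contains all components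
whose degree is not in `ℤ α_i + ℤ δ`. A lowering operator is not available on `L₊`, but it is on the
free nonassociative algebra generated by the strings: there the `sl₂`-actions on the strings extend by
derivations, and the raising operator is locally nilpotent. By `sl₂`-theory (`exists_raise_eq`),
the `p`-th power of the raising operator maps weight `-p` onto weight `p`, and this passes to the
quotient (`gradedPiece_strings_le`). Therefore `raise i ^ p` maps the component of degree
`s_i α + rδ` onto the one of degree `α + rδ` if `p = ⟨α, α_i^∨⟩ ≥ 0` and `α` is not a multiple of `α_i`
(`piece_le_map_raise`).

Since the invariant form is positive definite on `Q₀` (`form_self_pos`), every `α > 0` in `Q₀` pairs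
positively with some coroot (`exists_simpleCoroot_pos`), so that induction on the height reduces
the assertion to multiples of simple roots, up to simple reflections, which fix `δ` and preserve the
set of real roots. The components of degree `m α_i + rδ` are computed directly (`piece_of_multiple`):
they are at most one-dimensional, and vanish unless `m = 1` and `d̃_i ∣ r`, or, in type `A_{2n}^(2)`
with `d_i = 1`, `m = 2` and `r` is odd.

It remains to see that these degrees are real roots (`simpleRoot_add_smul_δ_mem_realRoots`,
`special_mem_realRoots`). Reflections in `s_i`, `i ∈ I₀`, lead from `α_0 = δ - (δ - α_0)` to a root
`δ + α_i`, or `δ + 2 α_i` in type `A_{2n}^(2)`, for one `i ∈ I₀` (`exists_simpleRoot_add_δ`). The product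
of its reflection with `s_i` is a translation by a multiple of `δ` (`add_smul_δ_mem_realRoots`). Such
translations yield the roots `α_i + rδ` and, along the edges of the diagram, the same for all
other vertices (`edge_propagate`).

Finally, as a vector space `L₋` is `L₊` with the signs of the `α_i` reversed, and `L₀` lives in degrees
`rδ`. As the degrees of `L₊` are nonnegative combinations of the `α_i`, modulo `δ`, only one of `L₊`,
`L₋` contributes in a given degree. -/

noncomputable section

/-! ### Graded pieces -/

section GradedPiece

variable {L ι κ Γ Γ' : Type} [LieRing L] [LieAlgebra ℂ L] [AddCommGroup Γ] [AddCommGroup Γ']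

theorem mem_gradedPiece_gen (x : ι → L) (wt : ι → Γ) (i : ι) :
    x i ∈ gradedPiece x wt (wt i) :=
  Submodule.subset_span (IsMonomial.gen i)

theorem lie_mem_gradedPiece {x : ι → L} {wt : ι → Γ} {γ γ' : Γ} {u v : L}
    (hu : u ∈ gradedPiece x wt γ) (hv : v ∈ gradedPiece x wt γ') :
    ⁅u, v⁆ ∈ gradedPiece x wt (γ + γ') := by
  induction hu using Submodule.span_induction with
  | zero => simp
  | add a b _ _ ha hb => rw [add_lie]; exact add_mem ha hb
  | smul c a _ ha => rw [smul_lie]; exact Submodule.smul_mem _ _ ha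
  | mem a ha =>
    induction hv using Submodule.span_induction with
    | zero => simp
    | add b c _ _ hb hc => rw [lie_add]; exact add_mem hb hc
    | smul c b _ hb => rw [lie_smul]; exact Submodule.smul_mem _ _ hb
    | mem b hb => exact Submodule.subset_span (IsMonomial.lie ha hb)

theorem gradedPiece_le {x : ι → L} {wt : ι → Γ} {y : κ → L} {wt' : κ → Γ}
    (h : ∀ i, x i ∈ gradedPiece y wt' (wt i)) (γ : Γ) :
    gradedPiece x wt γ ≤ gradedPiece y wt' γ := by
  refine Submodule.span_le.2 fun u hu => ?_
  induction hu with
  | gen i => exact h i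
  | lie _ _ h₁ h₂ => exact lie_mem_gradedPiece h₁ h₂

/-- Pushing the degrees forward along an injective homomorphism does not change the pieces. -/
theorem gradedPiece_comp_le (x : ι → L) (wt : ι → Γ) (f : Γ →+ Γ') (hf : Function.Injective f)
    (γ : Γ) : gradedPiece x (fun i => f (wt i)) (f γ) ≤ gradedPiece x wt γ := by
  have key : ∀ {γ' u}, IsMonomial x (fun i => f (wt i)) γ' u →
      ∃ γ, γ' = f γ ∧ IsMonomial x wt γ u := by
    intro γ' u hu
    induction hu with
    | gen i => exact ⟨_, rfl, .gen i⟩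
    | lie _ _ h₁ h₂ =>
      obtain ⟨a, rfl, ha⟩ := h₁
      obtain ⟨b, rfl, hb⟩ := h₂
      exact ⟨a + b, (map_add f a b).symm, .lie ha hb⟩
  refine Submodule.span_mono fun u hu => ?_
  obtain ⟨a, ha, h⟩ := key hu
  rwa [hf ha]

end GradedPiece

/-! ### Symmetry of weights under a raising operator -/

section Sl2

variable {V Γ : Type} [AddCommGroup V] [Module ℂ V] [AddCommGroup Γ]
  {E F : Module.End ℂ V} {W : Γ → Submodule ℂ V} {α : Γ} {c : Γ →+ ℤ}

theorem iterate_mem_weight (hF : ∀ γ, ∀ v ∈ W γ, F v ∈ W (γ - α)) (k : ℕ) {γ : Γ} {v : V}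
    (hv : v ∈ W γ) : (F ^ k) v ∈ W (γ - k • α) := by
  induction k with
  | zero => simpa using hv
  | succ k ih =>
    rw [pow_succ', Module.End.mul_apply]
    have := hF _ _ ih
    rwa [sub_sub, ← succ_nsmul] at this

/-- The action of `E` on the `sl₂`-module generated by a highest weight vector `v`. -/
theorem raise_lower_primitive (hα : c α = 2)
    (hF : ∀ γ, ∀ v ∈ W γ, F v ∈ W (γ - α))
    (hEF : ∀ γ, ∀ v ∈ W γ, E (F v) - F (E v) = (c γ : ℂ) • v)
    {γ : Γ} {v : V} (hv : v ∈ W γ) (hE0 : E v = 0) (k : ℕ) :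
    E ((F ^ (k + 1)) v) = ((k + 1 : ℂ) * (c γ - k)) • (F ^ k) v := by
  induction k with
  | zero => simpa [hE0] using hEF γ v hv
  | succ k ih =>
    have h := hEF _ _ (iterate_mem_weight hF (k + 1) hv)
    rw [pow_succ', Module.End.mul_apply, sub_eq_iff_eq_add.1 h, ih, map_smul,
      ← Module.End.mul_apply, ← pow_succ', ← add_smul]
    congr 1
    simp only [map_sub, map_nsmul, hα]
    push_cast
    simp only [nsmul_eq_mul]
    push_cast
    ring

theorem exists_raise_lower_primitive (hα : c α = 2)
    (hF : ∀ γ, ∀ v ∈ W γ, F v ∈ W (γ - α))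
    (hEF : ∀ γ, ∀ v ∈ W γ, E (F v) - F (E v) = (c γ : ℂ) • v)
    {γ : Γ} {v : V} (hv : v ∈ W γ) (hE0 : E v = 0) (k : ℕ) (hk : (k : ℤ) ≤ c γ) :
    ∃ s : ℂ, s ≠ 0 ∧ (E ^ k) ((F ^ k) v) = s • v := by
  induction k with
  | zero => exact ⟨1, one_ne_zero, by simp⟩
  | succ k ih =>
    obtain ⟨s, hs, h⟩ := ih (by push_cast at hk; lia)
    refine ⟨((k + 1 : ℂ) * (c γ - k)) * s, mul_ne_zero (mul_ne_zero ?_ ?_) hs, ?_⟩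
    · exact_mod_cast Nat.succ_ne_zero k
    · have : (c γ - k : ℤ) ≠ 0 := by push_cast at hk; lia
      exact_mod_cast this
    · rw [pow_succ, Module.End.mul_apply, raise_lower_primitive hα hF hEF hv hE0, map_smul, h,
        smul_smul]

/-- In a graded `sl₂`-module on which the raising operator `E` is locally nilpotent, every vector
of weight `p ≥ 0` is the image under `E ^ p` of a vector of weight `-p`. -/
theorem exists_raise_eq (hα : c α = 2)
    (hE : ∀ γ, ∀ v ∈ W γ, E v ∈ W (γ + α)) (hF : ∀ γ, ∀ v ∈ W γ, F v ∈ W (γ - α))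
    (hEF : ∀ γ, ∀ v ∈ W γ, E (F v) - F (E v) = (c γ : ℂ) • v)
    (hnil : ∀ v, ∃ N : ℕ, (E ^ N) v = 0)
    {γ : Γ} {p : ℕ} (hp : c γ = p) {v : V} (hv : v ∈ W γ) :
    ∃ w ∈ W (γ - p • α), (E ^ p) w = v := by
  have hE' : ∀ k : ℕ, ∀ γ, ∀ v ∈ W γ, (E ^ k) v ∈ W (γ + k • α) := fun k γ v hv => by
    have := iterate_mem_weight (F := E) (W := W) (α := -α) (γ := γ)
      (fun γ v hv => by simpa using hE γ v hv) k hv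
    simpa using this
  obtain ⟨N, hN⟩ := hnil v
  induction N generalizing v with
  | zero => exact ⟨0, zero_mem _, by simpa using hN.symm⟩
  | succ N ih =>
    -- `E ^ N v` is a highest weight vector of weight `p + 2 N`.
    have hv' := hE' N γ v hv
    have hprim : E ((E ^ N) v) = 0 := by
      rw [← Module.End.mul_apply, ← pow_succ']; exact hN
    have hc : c (γ + N • α) = p + 2 * N := by
      rw [map_add, map_nsmul, hα, hp, nsmul_eq_mul]; ring
    obtain ⟨s, hs, h⟩ := exists_raise_lower_primitive hα hF hEF hv' hprim (N + p)
      (by rw [hc]; push_cast; lia)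
    have hw := iterate_mem_weight hF (N + p) hv'
    set w := (F ^ (N + p)) ((E ^ N) v) with hw_def
    rw [show γ + N • α - (N + p) • α = γ - p • α by rw [add_nsmul]; abel] at hw
    have hw' : (E ^ p) w ∈ W γ := by simpa using hE' p _ _ hw
    obtain ⟨w₁, hw₁, h₁⟩ := ih (v := v - s⁻¹ • (E ^ p) w)
      (sub_mem hv (Submodule.smul_mem _ _ hw')) (by
        rw [map_sub, map_smul, ← Module.End.mul_apply, ← pow_add, h, smul_smul,
          inv_mul_cancel₀ hs, one_smul, sub_self])
    exact ⟨w₁ + s⁻¹ • w, add_mem hw₁ (Submodule.smul_mem _ _ hw), by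
      rw [map_add, h₁, map_smul, sub_add_cancel]⟩

end Sl2

/-! ### Lie algebras generated by strings -/

section Strings

/-- The positions `0, …, m s` in the strings `s ∈ S`, a string of `s` having `m s + 1` elements. -/
abbrev StringLeaf {S : Type} (m : S → ℕ) : Type := Σ s, Fin (m s + 1)

/-- The underlying space of the free nonassociative algebra on the set `Y`. -/
abbrev MagmaSpace (Y : Type) : Type := FreeMagma Y →₀ ℂ

namespace MagmaSpace

variable {Y : Type}

/-- The product of the free nonassociative algebra. -/
def prod : MagmaSpace Y →ₗ[ℂ] MagmaSpace Y →ₗ[ℂ] MagmaSpace Y :=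
  Finsupp.linearCombination ℂ fun a => Finsupp.linearCombination ℂ fun b =>
    Finsupp.single (a * b) 1

theorem prod_single (a b : FreeMagma Y) :
    prod (Finsupp.single a 1) (Finsupp.single b 1) = Finsupp.single (a * b) (1 : ℂ) := by
  simp [prod]

/-- The value on a tree of the derivation extending `D`. -/
def derivTree (D : Y → MagmaSpace Y) : FreeMagma Y → MagmaSpace Y
  | .of y => D y
  | .mul a b => prod (derivTree D a) (Finsupp.single b 1) +
      prod (Finsupp.single a 1) (derivTree D b)

/-- The derivation of the free nonassociative algebra with given values on the generators. -/
def deriv (D : Y → MagmaSpace Y) : Module.End ℂ (MagmaSpace Y) :=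
  Finsupp.linearCombination ℂ (derivTree D)

theorem deriv_single (D : Y → MagmaSpace Y) (a : FreeMagma Y) :
    deriv D (Finsupp.single a 1) = derivTree D a := by
  simp [deriv]

theorem deriv_of (D : Y → MagmaSpace Y) (y : Y) :
    deriv D (Finsupp.single (.of y) 1) = D y := by
  rw [deriv_single, derivTree]

/-- A linear statement holds as soon as it holds on trees. -/
theorem induction_single {P : MagmaSpace Y → Prop} (h0 : P 0)
    (hadd : ∀ u v, P u → P v → P (u + v)) (hsmul : ∀ (t : ℂ) u, P u → P (t • u))
    (h : ∀ a, P (Finsupp.single a 1)) (u : MagmaSpace Y) : P u := by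
  induction u using Finsupp.induction_linear with
  | zero => exact h0
  | add u v hu hv => exact hadd u v hu hv
  | single a t => simpa using hsmul t _ (h a)

theorem deriv_prod (D : Y → MagmaSpace Y) (u v : MagmaSpace Y) :
    deriv D (prod u v) = prod (deriv D u) v + prod u (deriv D v) := by
  induction u using induction_single with
  | h0 => simp
  | hadd a b ha hb => simp only [map_add, LinearMap.add_apply, ha, hb]; abel
  | hsmul t a ha => simp only [map_smul, LinearMap.smul_apply, ha, smul_add]
  | h a =>
    induction v using induction_single with
    | h0 => simp
    | hadd b c hb hc => simp only [map_add, hb, hc]; abel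
    | hsmul t b hb => simp only [map_smul, hb, smul_add]
    | h b =>
      rw [prod_single, deriv_single, deriv_single, deriv_single]
      rfl

variable {Γ : Type} [AddCommGroup Γ]

/-- The total weight of a tree. -/
def treeWeight (wt : Y → Γ) : FreeMagma Y → Γ
  | .of y => wt y
  | .mul a b => treeWeight wt a + treeWeight wt b

/-- The span of the trees of weight `γ`. -/
def weightSpace (wt : Y → Γ) (γ : Γ) : Submodule ℂ (MagmaSpace Y) :=
  Submodule.span ℂ {u | ∃ a, treeWeight wt a = γ ∧ u = Finsupp.single a 1}

theorem single_mem_weightSpace (wt : Y → Γ) (a : FreeMagma Y) :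
    Finsupp.single a 1 ∈ weightSpace wt (treeWeight wt a) :=
  Submodule.subset_span ⟨a, rfl, rfl⟩

theorem prod_mem_weightSpace {wt : Y → Γ} {γ γ' : Γ} {u v : MagmaSpace Y}
    (hu : u ∈ weightSpace wt γ) (hv : v ∈ weightSpace wt γ') :
    prod u v ∈ weightSpace wt (γ + γ') := by
  induction hu using Submodule.span_induction with
  | zero => simp
  | add a b _ _ ha hb => rw [map_add]; exact add_mem ha hb
  | smul c a _ ha => rw [map_smul]; exact Submodule.smul_mem _ _ ha
  | mem a ha =>
    induction hv using Submodule.span_induction with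
    | zero => simp
    | add b c _ _ hb hc => rw [map_add]; exact add_mem hb hc
    | smul c b _ hb => rw [map_smul]; exact Submodule.smul_mem _ _ hb
    | mem b hb =>
      obtain ⟨a, rfl, rfl⟩ := ha
      obtain ⟨b, rfl, rfl⟩ := hb
      rw [prod_single]
      exact single_mem_weightSpace wt (a * b)

theorem deriv_mem_weightSpace {wt : Y → Γ} {D : Y → MagmaSpace Y} {β : Γ}
    (hD : ∀ y, D y ∈ weightSpace wt (wt y + β)) (γ : Γ) (u : MagmaSpace Y)
    (hu : u ∈ weightSpace wt γ) : deriv D u ∈ weightSpace wt (γ + β) := by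
  induction hu using Submodule.span_induction with
  | zero => simp
  | add a b _ _ ha hb => rw [map_add]; exact add_mem ha hb
  | smul c a _ ha => rw [map_smul]; exact Submodule.smul_mem _ _ ha
  | mem u hu =>
    obtain ⟨a, rfl, rfl⟩ := hu
    rw [deriv_single]
    induction a with
    | ih1 y => exact hD y
    | ih2 a b ha hb =>
      refine add_mem ?_ ?_
      · have := prod_mem_weightSpace ha (single_mem_weightSpace wt b)
        rwa [add_right_comm] at this
      · have := prod_mem_weightSpace (single_mem_weightSpace wt a) hb
        rwa [← add_assoc] at this

theorem deriv_pow_prod_eq_zero (D : Y → MagmaSpace Y) (k : ℕ) :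
    ∀ {N M : ℕ}, N + M = k → ∀ {u v : MagmaSpace Y}, (deriv D ^ N) u = 0 →
      (deriv D ^ M) v = 0 → (deriv D ^ k) (prod u v) = 0 := by
  induction k with
  | zero =>
    intro N M h u v hu _
    obtain rfl : N = 0 := by lia
    obtain rfl : u = 0 := by simpa using hu
    simp
  | succ k ih =>
    intro N M h u v hu hv
    rcases N with _ | N
    · obtain rfl : u = 0 := by simpa using hu
      simp
    rcases M with _ | M
    · obtain rfl : v = 0 := by simpa using hv
      simp
    rw [pow_succ, Module.End.mul_apply, deriv_prod, map_add,
      ih (N := N) (M := M + 1) (by lia) (by rwa [pow_succ, Module.End.mul_apply] at hu) hv,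
      ih (N := N + 1) (M := M) (by lia) hu (by rwa [pow_succ, Module.End.mul_apply] at hv),
      add_zero]

theorem deriv_locally_nilpotent {D : Y → MagmaSpace Y}
    (hD : ∀ y, ∃ N : ℕ, (deriv D ^ N) (Finsupp.single (.of y) 1) = 0) (u : MagmaSpace Y) :
    ∃ N : ℕ, (deriv D ^ N) u = 0 := by
  induction u using induction_single with
  | h0 => exact ⟨0, rfl⟩
  | hadd a b ha hb =>
    obtain ⟨N, hN⟩ := ha
    obtain ⟨M, hM⟩ := hb
    refine ⟨N + M, ?_⟩
    rw [map_add, pow_add, Module.End.mul_apply _ _ b, hM, map_zero, add_zero,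
      (Commute.refl (deriv D)).pow_pow N M |>.eq, Module.End.mul_apply, hN, map_zero]
  | hsmul t a ha =>
    obtain ⟨N, hN⟩ := ha
    exact ⟨N, by rw [map_smul, hN, smul_zero]⟩
  | h a =>
    induction a with
    | ih1 y => exact hD y
    | ih2 a b ha hb =>
      obtain ⟨N, hN⟩ := ha
      obtain ⟨M, hM⟩ := hb
      exact ⟨N + M, by
        have := deriv_pow_prod_eq_zero D _ rfl hN hM
        rwa [prod_single] at this⟩

/-- Both sides are derivations, so that it suffices to compute `[D, D']` on the generators. -/
theorem deriv_commutator {D D' : Y → MagmaSpace Y} {wt : Y → Γ} {c : Γ →+ ℤ}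
    (h : ∀ y, deriv D (D' y) - deriv D' (D y) =
      (c (wt y) : ℂ) • (Finsupp.single (.of y) 1 : MagmaSpace Y))
    (γ : Γ) (u : MagmaSpace Y) (hu : u ∈ weightSpace wt γ) :
    deriv D (deriv D' u) - deriv D' (deriv D u) = (c γ : ℂ) • u := by
  induction hu using Submodule.span_induction with
  | zero => simp
  | add a b _ _ ha hb => simp only [map_add, smul_add, ← ha, ← hb]; abel
  | smul t a _ ha => rw [smul_comm, ← ha]; simp only [map_smul, smul_sub]
  | mem u hu =>
    obtain ⟨a, rfl, rfl⟩ := hu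
    induction a with
    | ih1 y => rw [deriv_of, deriv_of]; exact h y
    | ih2 a b ha hb =>
      have key (x z : MagmaSpace Y) : deriv D (deriv D' (prod x z)) - deriv D' (deriv D (prod x z)) =
          prod (deriv D (deriv D' x) - deriv D' (deriv D x)) z +
            prod x (deriv D (deriv D' z) - deriv D' (deriv D z)) := by
        simp only [deriv_prod, map_add, map_sub, LinearMap.sub_apply]
        abel
      rw [← prod_single, key, ha, hb, map_smul, map_smul, LinearMap.smul_apply, ← add_smul]
      congr 1
      change _ = ((c (treeWeight wt a + treeWeight wt b) : ℤ) : ℂ)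
      rw [map_add]
      push_cast
      rfl

variable {L : Type} [LieRing L] [LieAlgebra ℂ L]

/-- The value of a tree of Lie brackets. -/
def evalTree (y : Y → L) : FreeMagma Y → L
  | .of i => y i
  | .mul a b => ⁅evalTree y a, evalTree y b⁆

/-- The linear map from the free nonassociative algebra to a Lie algebra which turns products into
brackets. -/
def eval (y : Y → L) : MagmaSpace Y →ₗ[ℂ] L := Finsupp.linearCombination ℂ (evalTree y)

theorem eval_single (y : Y → L) (a : FreeMagma Y) :
    eval y (Finsupp.single a 1) = evalTree y a := by
  simp [eval]

theorem eval_prod (y : Y → L) (u v : MagmaSpace Y) :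
    eval y (prod u v) = ⁅eval y u, eval y v⁆ := by
  induction u using induction_single with
  | h0 => simp
  | hadd a b ha hb => simp only [map_add, LinearMap.add_apply, ha, hb, add_lie]
  | hsmul t a ha => simp only [map_smul, LinearMap.smul_apply, ha, smul_lie]
  | h a =>
    induction v using induction_single with
    | h0 => simp
    | hadd b c hb hc => simp only [map_add, hb, hc, lie_add]
    | hsmul t b hb => simp only [map_smul, hb, lie_smul]
    | h b => rw [prod_single, eval_single, eval_single, eval_single]; rfl

theorem gradedPiece_eq_map_eval (y : Y → L) (wt : Y → Γ) (γ : Γ) :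
    gradedPiece y wt γ = (weightSpace wt γ).map (eval y) := by
  apply le_antisymm
  · refine Submodule.span_le.2 fun u hu => ?_
    induction hu with
    | gen i =>
      exact ⟨_, single_mem_weightSpace wt (.of i), eval_single y _⟩
    | lie _ _ h₁ h₂ =>
      obtain ⟨a, ha, rfl⟩ := h₁
      obtain ⟨b, hb, rfl⟩ := h₂
      exact ⟨_, prod_mem_weightSpace ha hb, eval_prod y a b⟩
  · rw [weightSpace, Submodule.map_span, Submodule.span_le]
    rintro _ ⟨_, ⟨a, rfl, rfl⟩, rfl⟩
    rw [eval_single]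
    apply Submodule.subset_span
    induction a with
    | ih1 i => exact IsMonomial.gen i
    | ih2 a b ha hb => exact IsMonomial.lie ha hb

/-- A derivation of `L` lifts to the free nonassociative algebra. -/
theorem eval_deriv {y : Y → L} {D : Y → MagmaSpace Y} {d : Module.End ℂ L}
    (hd : ∀ u v : L, d ⁅u, v⁆ = ⁅d u, v⁆ + ⁅u, d v⁆) (h : ∀ i, eval y (D i) = d (y i))
    (u : MagmaSpace Y) : eval y (deriv D u) = d (eval y u) := by
  induction u using induction_single with
  | h0 => simp
  | hadd a b ha hb => simp only [map_add, ha, hb]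
  | hsmul t a ha => simp only [map_smul, ha]
  | h a =>
    rw [deriv_single, eval_single]
    induction a with
    | ih1 i => exact h i
    | ih2 a b ha hb =>
      change eval y (prod _ _ + prod _ _) = d ⁅_, _⁆
      rw [map_add, eval_prod, eval_prod, ha, hb, eval_single, eval_single, hd]

end MagmaSpace

open MagmaSpace

variable {S : Type} (m : S → ℕ)

/-- The raising operator on leaves. -/
def leafRaise (p : StringLeaf m) : MagmaSpace (StringLeaf m) :=
  if h : (p.2 : ℕ) < m p.1 then Finsupp.single (.of ⟨p.1, ⟨p.2 + 1, by lia⟩⟩) 1 else 0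

/-- The lowering operator on leaves, normalized so that each string becomes an irreducible
`sl₂`-module. -/
def leafLower (p : StringLeaf m) : MagmaSpace (StringLeaf m) :=
  ((p.2 : ℂ) * (m p.1 - p.2 + 1)) •
    Finsupp.single (.of ⟨p.1, ⟨(p.2 : ℕ) - 1, by have := p.2.2; lia⟩⟩) 1

/-- The relation `[E, F] = H` on a string whose lowest vector has weight `-m`. -/
theorem leafRaise_lower_commutator (p : StringLeaf m) :
    deriv (leafRaise m) (leafLower m p) - deriv (leafLower m) (leafRaise m p) =
      (2 * (p.2 : ℂ) - m p.1) • (Finsupp.single (.of p) 1 : MagmaSpace (StringLeaf m)) := by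
  obtain ⟨s, l, hl⟩ := p
  have h₁ : deriv (leafRaise m) (leafLower m ⟨s, l, hl⟩) =
      ((l : ℂ) * (m s - l + 1)) • Finsupp.single (.of ⟨s, l, hl⟩) 1 := by
    rw [leafLower, map_smul, deriv_of, leafRaise]
    rcases l with _ | l
    · simp
    · rw [dif_pos (by simp; lia)]
      simp
  have h₂ : deriv (leafLower m) (leafRaise m ⟨s, l, hl⟩) =
      (((l : ℂ) + 1) * (m s - l)) • Finsupp.single (.of ⟨s, l, hl⟩) 1 := by
    rw [leafRaise]
    split_ifs with h
    · rw [deriv_of, leafLower]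
      simp only [Nat.add_sub_cancel]
      push_cast
      congr 1
      ring
    · obtain rfl : l = m s := by simp at h; lia
      simp
  rw [h₁, h₂, ← sub_smul]
  congr 1
  simp only
  ring

variable {L Γ : Type} [LieRing L] [LieAlgebra ℂ L] [AddCommGroup Γ]

/-- Let `d` be a derivation of a Lie algebra and let each `u s` generate a string
`u s, d (u s), …, d ^ (m s) (u s)`, ending there, whose weights are symmetric about zero. Then on
the Lie subalgebra generated by the strings, `d ^ p` maps the piece of weight `-p` onto the piece of
weight `p`. The reason is that this subalgebra is an equivariant quotient of the free nonassociative
algebra on the strings, which is an `sl₂`-module. -/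
theorem gradedPiece_strings_le {m : S → ℕ} {d : Module.End ℂ L}
    (hd : ∀ u v : L, d ⁅u, v⁆ = ⁅d u, v⁆ + ⁅u, d v⁆)
    {u : S → L} {wt : S → Γ} {α : Γ} {c : Γ →+ ℤ} (hα : c α = 2)
    (hwt : ∀ s, c (wt s) = -m s) (hu : ∀ s, (d ^ (m s + 1)) (u s) = 0)
    {γ : Γ} {p : ℕ} (hp : c γ = p) :
    gradedPiece (fun q : StringLeaf m => (d ^ (q.2 : ℕ)) (u q.1))
        (fun q => wt q.1 + (q.2 : ℕ) • α) γ ≤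
      (gradedPiece (fun q : StringLeaf m => (d ^ (q.2 : ℕ)) (u q.1))
        (fun q => wt q.1 + (q.2 : ℕ) • α) (γ - p • α)).map (d ^ p) := by
  set y := fun q : StringLeaf m => (d ^ (q.2 : ℕ)) (u q.1) with hy
  set w := fun q : StringLeaf m => wt q.1 + (q.2 : ℕ) • α with hw
  have hcomp : ∀ i, eval y (leafRaise m i) = d (y i) := by
    rintro ⟨s, l, hl⟩
    rw [leafRaise]
    split_ifs with h
    · rw [eval_single]
      simp only [evalTree, hy]
      rw [pow_succ', Module.End.mul_apply]
    · obtain rfl : l = m s := by simp at h; lia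
      simp only [hy, map_zero]
      rw [← Module.End.mul_apply, ← pow_succ', hu]
  have hraise : ∀ i, leafRaise m i ∈ weightSpace w (w i + α) := by
    rintro ⟨s, l, hl⟩
    rw [leafRaise]
    split_ifs with h
    · have := single_mem_weightSpace w (.of (⟨s, ⟨l + 1, by simp at h; lia⟩⟩ : StringLeaf m))
      convert this using 2
      simp only [hw, treeWeight]
      rw [succ_nsmul, add_assoc]
    · exact zero_mem _
  have hlower : ∀ i, leafLower m i ∈ weightSpace w (w i + -α) := by
    rintro ⟨s, l, hl⟩
    rw [leafLower]
    rcases l with _ | l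
    · simp
    · refine Submodule.smul_mem _ _ ?_
      have := single_mem_weightSpace w (.of (⟨s, ⟨l, by lia⟩⟩ : StringLeaf m))
      have e : w ⟨s, ⟨l + 1, hl⟩⟩ + -α = treeWeight w (.of ⟨s, ⟨l, by lia⟩⟩) := by
        simp only [hw, treeWeight]
        rw [succ_nsmul]
        abel
      rw [e]
      exact this
  have hnil : ∀ i : StringLeaf m, ∃ N : ℕ,
      (deriv (leafRaise m) ^ N) (Finsupp.single (.of i) 1) = 0 := by
    have key : ∀ k : ℕ, ∀ i : StringLeaf m, m i.1 + 1 - (i.2 : ℕ) ≤ k →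
        (deriv (leafRaise m) ^ k) (Finsupp.single (.of i) 1) = 0 := by
      intro k
      induction k with
      | zero => rintro ⟨s, l, hl⟩ h; simp at h; lia
      | succ k ih =>
        rintro ⟨s, l, hl⟩ h
        rw [pow_succ, Module.End.mul_apply, deriv_of, leafRaise]
        split_ifs with h'
        · apply ih; simp at h ⊢; lia
        · simp
    exact fun i => ⟨_, key _ i le_rfl⟩
  intro v hv
  rw [gradedPiece_eq_map_eval] at hv
  obtain ⟨v, hv, rfl⟩ := hv
  obtain ⟨v', hv', rfl⟩ := exists_raise_eq (E := deriv (leafRaise m)) (F := deriv (leafLower m))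
    (W := weightSpace w) (α := α) (c := c) hα (deriv_mem_weightSpace hraise)
    (fun γ v hv => by simpa [sub_eq_add_neg] using deriv_mem_weightSpace hlower γ v hv)
    (deriv_commutator fun i => by
      rw [leafRaise_lower_commutator]
      congr 1
      simp only [hw, map_add, map_nsmul, hα, hwt, nsmul_eq_mul]
      push_cast
      ring)
    (deriv_locally_nilpotent hnil) hp hv
  refine ⟨eval y v', ?_, ?_⟩
  · rw [gradedPiece_eq_map_eval]
    exact ⟨v', hv', rfl⟩
  · clear hv hv'
    generalize hk : p = k
    clear hk hp
    induction k generalizing v' with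
    | zero => rfl
    | succ k ih =>
      rw [pow_succ, Module.End.mul_apply, ← eval_deriv hd hcomp, ih, ← Module.End.mul_apply,
        ← pow_succ]

end Strings

/-! ### The relations of `L₊` -/

theorem sum_perm_fin_two {M : Type} [AddCommMonoid M] (g : Fin 2 → Fin 2 → M) :
    ∑ σ : Equiv.Perm (Fin 2), g (σ 0) (σ 1) = g 0 1 + g 1 0 := by
  rw [show (Finset.univ : Finset (Equiv.Perm (Fin 2))) = {1, Equiv.swap 0 1} by decide,
    Finset.sum_pair (by decide)]
  simp

theorem sum_perm_fin_three {M : Type} [AddCommMonoid M] (g : Fin 3 → Fin 3 → Fin 3 → M) :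
    ∑ σ : Equiv.Perm (Fin 3), g (σ 0) (σ 1) (σ 2) =
      g 0 1 2 + g 0 2 1 + g 1 0 2 + g 1 2 0 + g 2 0 1 + g 2 1 0 := by
  rw [← Equiv.sum_comp (Equiv.Perm.decomposeFin.symm : _ ≃ Equiv.Perm (Fin 3)),
    Fintype.sum_prod_type]
  simp only [Fin.sum_univ_three]
  rw [show (Finset.univ : Finset (Equiv.Perm (Fin 2))) = {1, Equiv.swap 0 1} by decide,
    Finset.sum_pair (by decide), Finset.sum_pair (by decide), Finset.sum_pair (by decide)]
  have e1 : (Equiv.Perm.decomposeFin.symm (0, 1) : Equiv.Perm (Fin 3)) = 1 := by decide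
  have e2 : (Equiv.Perm.decomposeFin.symm (0, Equiv.swap 0 1) : Equiv.Perm (Fin 3)) =
    Equiv.swap 1 2 := by decide
  have e3 : (Equiv.Perm.decomposeFin.symm (1, 1) : Equiv.Perm (Fin 3)) = Equiv.swap 0 1 := by decide
  have e4 : (Equiv.Perm.decomposeFin.symm (1, Equiv.swap 0 1) : Equiv.Perm (Fin 3)) =
    Equiv.swap 0 1 * Equiv.swap 1 2 := by decide
  have e5 : (Equiv.Perm.decomposeFin.symm (2, 1) : Equiv.Perm (Fin 3)) = Equiv.swap 0 2 := by decide
  have e6 : (Equiv.Perm.decomposeFin.symm (2, Equiv.swap 0 1) : Equiv.Perm (Fin 3)) =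
    Equiv.swap 0 2 * Equiv.swap 1 2 := by decide
  rw [e1, e2, e3, e4, e5, e6]
  have h0 : (1 : Equiv.Perm (Fin 3)) 0 = 0 ∧ (1 : Equiv.Perm (Fin 3)) 1 = 1 ∧
    (1 : Equiv.Perm (Fin 3)) 2 = 2 := by decide
  have h1 : Equiv.swap (1 : Fin 3) 2 0 = 0 ∧ Equiv.swap (1 : Fin 3) 2 1 = 2 ∧
    Equiv.swap (1 : Fin 3) 2 2 = 1 := by decide
  have h2 : Equiv.swap (0 : Fin 3) 1 0 = 1 ∧ Equiv.swap (0 : Fin 3) 1 1 = 0 ∧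
    Equiv.swap (0 : Fin 3) 1 2 = 2 := by decide
  have h3 : Equiv.swap (0 : Fin 3) 2 0 = 2 ∧ Equiv.swap (0 : Fin 3) 2 1 = 1 ∧
    Equiv.swap (0 : Fin 3) 2 2 = 0 := by decide
  simp only [Equiv.Perm.mul_apply, h0, h1, h2, h3, add_assoc]
  abel

/-- The linear map `u ↦ ⁅u, x⁆`. -/
def bracketRight {L : Type} [LieRing L] [LieAlgebra ℂ L] (x : L) : Module.End ℂ L where
  toFun u := ⁅u, x⁆
  map_add' u v := add_lie u v x
  map_smul' t u := smul_lie t u x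

theorem bracketRight_apply {L : Type} [LieRing L] [LieAlgebra ℂ L] (x u : L) :
    bracketRight x u = ⁅u, x⁆ := rfl

theorem bracketRight_lie {L : Type} [LieRing L] [LieAlgebra ℂ L] (x u v : L) :
    bracketRight x ⁅u, v⁆ = ⁅bracketRight x u, v⁆ + ⁅u, bracketRight x v⁆ := by
  simp only [bracketRight_apply]
  rw [← lie_skew ⁅u, v⁆ x, leibniz_lie x u v, ← lie_skew u x, ← lie_skew v x, neg_lie, lie_neg]
  abel

theorem bracketRight_commute {L : Type} [LieRing L] [LieAlgebra ℂ L] {x y : L} (h : ⁅x, y⁆ = 0) :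
    Commute (bracketRight x) (bracketRight y) := by
  ext u
  simp only [Module.End.mul_apply]
  have := bracketRight_lie x u y
  rwa [bracketRight_apply x y, ← lie_skew y x, h, neg_zero, lie_zero, add_zero] at this

namespace AffineType

variable (T : AffineType)

/-- The projection from the free Lie algebra onto `L₊`. -/
def toLPlus : FreeLieAlgebra ℂ (T.Vertex₀ × ℕ) →ₗ⁅ℂ⁆ T.LPlus where
  toFun := LieSubmodule.Quotient.mk (N := LieSubmodule.lieSpan ℂ _ {u | T.IsRelator u})
  map_add' _ _ := rfl
  map_smul' _ _ := rfl
  map_lie' := rfl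

theorem toLPlus_freeX (i : T.Vertex₀) (r : ℕ) : T.toLPlus (T.freeX i r) = T.xPlus (i, r) := rfl

variable {T}

theorem toLPlus_eq_zero {u : FreeLieAlgebra ℂ (T.Vertex₀ × ℕ)} (h : T.IsRelator u) :
    T.toLPlus u = 0 :=
  (LieSubmodule.Quotient.mk_eq_zero').2 (LieSubmodule.subset_lieSpan h)

theorem xPlus_eq_zero {i : T.Vertex₀} {r : ℕ} (h : ¬ T.dTilde i ∣ r) : T.xPlus (i, r) = 0 :=
  toLPlus_eq_zero (.zx i r h)

theorem xPlus_shift {i j : T.Vertex₀} {r s : ℕ} (hr : T.dTilde i ∣ r) (hs : T.dTilde j ∣ s)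
    (h : T.cartan₀ i j < 0) :
    ⁅T.xPlus (j, s), T.xPlus (i, r + T.dTilde₂ i j)⁆ =
      ⁅T.xPlus (j, s + T.dTilde₂ i j), T.xPlus (i, r)⁆ := by
  have := toLPlus_eq_zero (.xd i j r s hr hs h)
  simp only [map_add, LieHom.map_lie, toLPlus_freeX] at this
  rw [← lie_skew, neg_eq_iff_add_eq_zero.2 this]

theorem xPlus_swap {i : T.Vertex₀} (h : ¬ T.IsSpecial i) (a b : ℕ) :
    ⁅T.xPlus (i, a + T.dTilde i), T.xPlus (i, b)⁆ +
      ⁅T.xPlus (i, b + T.dTilde i), T.xPlus (i, a)⁆ = 0 := by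
  have := toLPlus_eq_zero (.x1 i ![a, b] h)
  rw [sum_perm_fin_two fun p q : Fin 2 =>
    ⁅T.freeX i (![a, b] p + T.dTilde i), T.freeX i (![a, b] q)⁆] at this
  simpa [toLPlus_freeX] using this

theorem xPlus_special_swap {i : T.Vertex₀} (h : T.IsSpecial i) (a b : ℕ) :
    ⁅T.xPlus (i, a + 2), T.xPlus (i, b)⁆ + ⁅T.xPlus (i, b + 2), T.xPlus (i, a)⁆ = 0 := by
  have := toLPlus_eq_zero (.x2 i ![a, b] h)
  rw [sum_perm_fin_two fun p q : Fin 2 =>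
    ⁅T.freeX i (![a, b] p + 2), T.freeX i (![a, b] q)⁆] at this
  simpa [toLPlus_freeX] using this

theorem xPlus_special_triple {i : T.Vertex₀} (h : T.IsSpecial i) (a b c : ℕ) :
    ⁅⁅T.xPlus (i, a + 1), T.xPlus (i, b)⁆, T.xPlus (i, c)⁆ +
    ⁅⁅T.xPlus (i, a + 1), T.xPlus (i, c)⁆, T.xPlus (i, b)⁆ +
    ⁅⁅T.xPlus (i, b + 1), T.xPlus (i, a)⁆, T.xPlus (i, c)⁆ +
    ⁅⁅T.xPlus (i, b + 1), T.xPlus (i, c)⁆, T.xPlus (i, a)⁆ +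
    ⁅⁅T.xPlus (i, c + 1), T.xPlus (i, a)⁆, T.xPlus (i, b)⁆ +
    ⁅⁅T.xPlus (i, c + 1), T.xPlus (i, b)⁆, T.xPlus (i, a)⁆ = 0 := by
  have := toLPlus_eq_zero (.x3 i ![a, b, c] h)
  rw [sum_perm_fin_three fun p q w : Fin 3 =>
    ⁅⁅T.freeX i (![a, b, c] p + 1), T.freeX i (![a, b, c] q)⁆, T.freeX i (![a, b, c] w)⁆] at this
  simpa [toLPlus_freeX] using this

theorem xPlus_double_two {i j : T.Vertex₀} (h : T.cartan₀ i j = -2) (hk : T.order = 2)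
    (hT : ¬ T.IsTwistedAEven) (s a b : ℕ) :
    ⁅⁅T.xPlus (j, s), T.xPlus (i, a + 1)⁆, T.xPlus (i, b)⁆ +
      ⁅⁅T.xPlus (j, s), T.xPlus (i, b + 1)⁆, T.xPlus (i, a)⁆ = 0 := by
  have := toLPlus_eq_zero (.t2 i j ![a, b] s h hk hT)
  rw [sum_perm_fin_two fun p q : Fin 2 =>
    ⁅⁅T.freeX j s, T.freeX i (![a, b] p + 1)⁆, T.freeX i (![a, b] q)⁆] at this
  simpa [toLPlus_freeX] using this

theorem xPlus_double_special {i j : T.Vertex₀} (h : T.cartan₀ i j = -2)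
    (hT : T.IsTwistedAEven) (s a b : ℕ) :
    ⁅⁅T.xPlus (j, s), T.xPlus (i, a + 1)⁆, T.xPlus (i, b)⁆ +
      ⁅⁅T.xPlus (j, s), T.xPlus (i, b)⁆, T.xPlus (i, a + 1)⁆ +
      (⁅⁅T.xPlus (j, s), T.xPlus (i, b + 1)⁆, T.xPlus (i, a)⁆ +
      ⁅⁅T.xPlus (j, s), T.xPlus (i, a)⁆, T.xPlus (i, b + 1)⁆) = 0 := by
  have := toLPlus_eq_zero (.s2 i j ![a, b] s h hT)
  rw [sum_perm_fin_two fun p q : Fin 2 =>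
    ⁅⁅T.freeX j s, T.freeX i (![a, b] p + 1)⁆, T.freeX i (![a, b] q)⁆ +
    ⁅⁅T.freeX j s, T.freeX i (![a, b] q)⁆, T.freeX i (![a, b] p + 1)⁆] at this
  simpa [toLPlus_freeX] using this

theorem xPlus_double_three {i j : T.Vertex₀} (h : T.cartan₀ i j = -3) (hk : T.order = 3)
    (s a b : ℕ) :
    (2 : ℂ) • ⁅⁅T.xPlus (j, s), T.xPlus (i, a + 2)⁆, T.xPlus (i, b)⁆ +
      ⁅⁅T.xPlus (j, s), T.xPlus (i, a + 1)⁆, T.xPlus (i, b + 1)⁆ +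
      ((2 : ℂ) • ⁅⁅T.xPlus (j, s), T.xPlus (i, b + 2)⁆, T.xPlus (i, a)⁆ +
      ⁅⁅T.xPlus (j, s), T.xPlus (i, b + 1)⁆, T.xPlus (i, a + 1)⁆) = 0 := by
  have := toLPlus_eq_zero (.t3 i j ![a, b] s h hk)
  rw [sum_perm_fin_two fun p q : Fin 2 =>
    (2 : ℂ) • ⁅⁅T.freeX j s, T.freeX i (![a, b] p + 2)⁆, T.freeX i (![a, b] q)⁆ +
    ⁅⁅T.freeX j s, T.freeX i (![a, b] p + 1)⁆, T.freeX i (![a, b] q + 1)⁆] at this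
  simp only [map_add, map_smul, LieHom.map_lie, toLPlus_freeX] at this
  exact this

theorem xPlus_triple_three {i j : T.Vertex₀} (h : T.cartan₀ i j = -3) (hk : T.order = 3)
    (s a b c : ℕ) :
    ⁅⁅⁅T.xPlus (j, s), T.xPlus (i, a + 1)⁆, T.xPlus (i, b)⁆, T.xPlus (i, c)⁆ +
    ⁅⁅⁅T.xPlus (j, s), T.xPlus (i, a + 1)⁆, T.xPlus (i, c)⁆, T.xPlus (i, b)⁆ +
    ⁅⁅⁅T.xPlus (j, s), T.xPlus (i, b + 1)⁆, T.xPlus (i, a)⁆, T.xPlus (i, c)⁆ +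
    ⁅⁅⁅T.xPlus (j, s), T.xPlus (i, b + 1)⁆, T.xPlus (i, c)⁆, T.xPlus (i, a)⁆ +
    ⁅⁅⁅T.xPlus (j, s), T.xPlus (i, c + 1)⁆, T.xPlus (i, a)⁆, T.xPlus (i, b)⁆ +
    ⁅⁅⁅T.xPlus (j, s), T.xPlus (i, c + 1)⁆, T.xPlus (i, b)⁆, T.xPlus (i, a)⁆ = 0 := by
  have := toLPlus_eq_zero (.u3 i j ![a, b, c] s h hk)
  rw [sum_perm_fin_three fun p q w : Fin 3 =>
    ⁅⁅⁅T.freeX j s, T.freeX i (![a, b, c] p + 1)⁆, T.freeX i (![a, b, c] q)⁆,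
      T.freeX i (![a, b, c] w)⁆] at this
  simpa [toLPlus_freeX] using this

/-- The left-normed bracket `[…[x_{j,s}, x_{i,t₁}], …, x_{i,t_m}]` in `L₊`. -/
def leftBracketPlus (i j : T.Vertex₀) (s : ℕ) (t : List ℕ) : T.LPlus :=
  t.foldl (fun u l => ⁅u, T.xPlus (i, l)⁆) (T.xPlus (j, s))

theorem leftBracketPlus_append (i j : T.Vertex₀) (s : ℕ) (t : List ℕ) (r : ℕ) :
    leftBracketPlus i j s (t ++ [r]) = ⁅leftBracketPlus i j s t, T.xPlus (i, r)⁆ := by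
  simp [leftBracketPlus, List.foldl_append]

theorem toLPlus_leftBracket (i j : T.Vertex₀) (s : ℕ) (t : List ℕ) :
    T.toLPlus (T.leftBracket i j s t) = leftBracketPlus i j s t := by
  induction t using List.reverseRecOn with
  | nil => rfl
  | append_singleton t r ih =>
    rw [leftBracketPlus_append, ← ih, leftBracket, List.foldl_append]
    rfl

theorem xPlus_serre {i j : T.Vertex₀} (hij : i ≠ j) {m : ℕ}
    (hm : (1 - T.cartan₀ i j).toNat = m) (r : Fin m → ℕ) (s : ℕ) :
    ∑ σ : Equiv.Perm (Fin m), leftBracketPlus i j s (List.ofFn fun l => r (σ l)) = 0 := by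
  subst hm
  have := toLPlus_eq_zero (.serre i j hij r s)
  simpa only [map_sum, toLPlus_leftBracket] using this

theorem xPlus_serre_zero {i j : T.Vertex₀} (hij : i ≠ j) {m : ℕ} (hm : T.cartan₀ i j = -m)
    (s : ℕ) : (bracketRight (T.xPlus (i, 0)) ^ (m + 1)) (T.xPlus (j, s)) = 0 := by
  have h := xPlus_serre hij (m := m + 1) (by lia) (fun _ => 0) s
  rw [Finset.sum_const, ← Nat.cast_smul_eq_nsmul ℂ, smul_eq_zero] at h
  have h' : ∀ k : ℕ, leftBracketPlus i j s (List.ofFn fun _ : Fin k => 0) =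
      (bracketRight (T.xPlus (i, 0)) ^ k) (T.xPlus (j, s)) := fun k => by
    induction k with
    | zero => rfl
    | succ k ih =>
      rw [List.ofFn_succ_last, leftBracketPlus_append, ih, pow_succ']
      rfl
  rw [← h']
  refine h.resolve_left ?_
  simp [Fintype.card_perm, Nat.factorial_ne_zero]

/-- If `i` is not special, the `x_{i,r}` commute. -/
theorem xPlus_lie_self_of_not_special {i : T.Vertex₀} (h : ¬ T.IsSpecial i) (a b : ℕ) :
    ⁅T.xPlus (i, a), T.xPlus (i, b)⁆ = 0 := by
  have two {v : T.LPlus} (hv : v + v = 0) : v = 0 := by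
    rw [← two_smul ℂ] at hv
    exact (smul_eq_zero.1 hv).resolve_left two_ne_zero
  by_cases ha : T.dTilde i ∣ a
  swap
  · rw [xPlus_eq_zero ha, zero_lie]
  by_cases hb : T.dTilde i ∣ b
  swap
  · rw [xPlus_eq_zero hb, lie_zero]
  obtain ⟨a, rfl⟩ := ha
  obtain ⟨b, rfl⟩ := hb
  set D := T.dTilde i
  -- the bracket only depends on `a + b`, and it is antisymmetric
  have shift : ∀ a b : ℕ, ⁅T.xPlus (i, D * (a + 1)), T.xPlus (i, D * b)⁆ =
      ⁅T.xPlus (i, D * a), T.xPlus (i, D * (b + 1))⁆ := fun a b => by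
    have := xPlus_swap h (D * a) (D * b)
    rw [← lie_skew (T.xPlus (i, D * a)), ← add_eq_zero_iff_eq_neg]
    simpa [mul_add] using this
  have shifts : ∀ a b : ℕ, ⁅T.xPlus (i, D * a), T.xPlus (i, D * b)⁆ =
      ⁅T.xPlus (i, D * 0), T.xPlus (i, D * (a + b))⁆ := fun a => by
    induction a with
    | zero => intro b; rw [zero_add]
    | succ a ih => intro b; rw [shift, ih, show a + (b + 1) = a + 1 + b by lia]
  apply two
  nth_rewrite 2 [← lie_skew]
  rw [shifts a, shifts b, add_comm b a, add_neg_cancel]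

end AffineType

namespace AffineType

variable (T : AffineType)

/-! ### Cartan integers of adjacent vertices -/

theorem symmetrizer_pos (i : ℕ) : 0 < T.symmetrizer i := by
  cases T <;> simp only [symmetrizer] <;> (try split_ifs) <;> norm_num

theorem symmetrizer_dvd (i j : ℕ) :
    T.symmetrizer i ∣ T.symmetrizer j ∨ T.symmetrizer j ∣ T.symmetrizer i := by
  cases T <;> simp only [symmetrizer] <;> (try split_ifs) <;> norm_num

theorem cartan_self (i : T.Vertex) : T.cartan i i = 2 := by simp [cartan]

theorem cartan_nonpos {i j : T.Vertex} (h : i ≠ j) : T.cartan i j ≤ 0 := by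
  rw [cartan, if_neg h]
  split_ifs
  · norm_num
  · exact neg_nonpos.2 (by positivity)
  · exact le_rfl

variable {T}

theorem cartan₀_nonpos {i j : T.Vertex₀} (h : i ≠ j) : T.cartan₀ i j ≤ 0 :=
  T.cartan_nonpos (by simpa using h)

/-- The exceptional value `a_01 = a_10 = -2` of type `A_1^(1)` does not occur within `I₀`. -/
theorem cartan₀_eq_of_neg {i j : T.Vertex₀} (hij : i ≠ j) (h : T.cartan₀ i j < 0) :
    T.cartan₀ i j = -((max (T.d i) (T.d j) / T.d i : ℕ) : ℤ) := by
  have hij' : i.succ ≠ j.succ := by simpa using hij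
  rw [cartan₀, cartan, if_neg hij'] at h ⊢
  have hrank : T.rank ≠ 1 := by
    intro h1
    have := i.2
    have := j.2
    exact hij (Fin.ext (by lia))
  split_ifs at h ⊢ with h₁ h₂
  · exact absurd h₂.2 hrank
  · rfl
  · exact absurd h (by simp)

theorem dTilde_eq_one (h : T.order = 1 ∨ T.IsTwistedAEven) (i : T.Vertex₀) : T.dTilde i = 1 :=
  if_pos h

theorem dTilde_eq_d (h : ¬ (T.order = 1 ∨ T.IsTwistedAEven)) (i : T.Vertex₀) :
    T.dTilde i = T.d i :=
  if_neg h

theorem d_eq_one_or_order (h : ¬ (T.order = 1 ∨ T.IsTwistedAEven)) (i : T.Vertex₀) :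
    T.d i = 1 ∨ T.d i = T.order := by
  cases T <;> simp only [order, IsTwistedAEven, d, symmetrizer] at h ⊢ <;> simp_all <;> lia

theorem order_eq (h : ¬ (T.order = 1 ∨ T.IsTwistedAEven)) : T.order = 2 ∨ T.order = 3 := by
  cases T <;> simp [order, IsTwistedAEven] at h ⊢

theorem d_of_isTwistedAEven (h : T.IsTwistedAEven) (i : T.Vertex₀) :
    T.d i = if (i : ℕ) + 1 = T.rank then 1 else 2 := by
  cases T <;> simp [IsTwistedAEven] at h
  change (if (i : ℕ) + 1 = 0 then 4 else if (i : ℕ) + 1 = _ then 1 else 2) = _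
  rw [if_neg (Nat.succ_ne_zero _)]
  rfl

/-- The four kinds of ordered pairs of adjacent vertices, according to the relations of `L₊` that
involve them. -/
theorem adjacent_cases {i j : T.Vertex₀} (hij : i ≠ j) (h : T.cartan₀ i j < 0) :
    (¬ T.IsSpecial i ∧ T.dTilde j ∣ T.dTilde i) ∨
    (T.IsSpecial i ∧ T.cartan₀ i j = -2 ∧ T.dTilde i = 1 ∧ T.dTilde j = 1) ∨
    (¬ T.IsSpecial i ∧ T.order = 2 ∧ ¬ T.IsTwistedAEven ∧ T.cartan₀ i j = -2 ∧
      T.dTilde i = 1 ∧ T.dTilde j = 2) ∨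
    (¬ T.IsSpecial i ∧ T.order = 3 ∧ T.cartan₀ i j = -3 ∧ T.dTilde i = 1 ∧ T.dTilde j = 3) := by
  have ha := cartan₀_eq_of_neg hij h
  by_cases hT : T.order = 1 ∨ T.IsTwistedAEven
  · rw [dTilde_eq_one hT, dTilde_eq_one hT]
    by_cases hs : T.IsSpecial i
    · refine .inr (.inl ⟨hs, ?_, rfl, rfl⟩)
      have hj : T.d j = 2 := by
        have hi := hs.2
        rw [d_of_isTwistedAEven hs.1] at hi ⊢
        have : (i : ℕ) ≠ j := fun h => hij (Fin.ext h)
        split_ifs at hi ⊢ <;> lia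
      rw [ha, hs.2, hj]
      rfl
    · exact .inl ⟨hs, one_dvd _⟩
  · have hs : ¬ T.IsSpecial i := fun h => hT (.inr h.1)
    rw [dTilde_eq_d hT, dTilde_eq_d hT]
    rcases d_eq_one_or_order hT i with hi | hi
    · rcases d_eq_one_or_order hT j with hj | hj
      · exact .inl ⟨hs, by rw [hi, hj]⟩
      · rw [hi, hj] at ha
        rcases order_eq hT with ho | ho
        · exact .inr (.inr (.inl ⟨hs, ho, fun h => hT (.inr h), by rw [ha, ho]; rfl, hi,
            by rw [hj, ho]⟩))
        · exact .inr (.inr (.inr ⟨hs, ho, by rw [ha, ho]; rfl, hi, by rw [hj, ho]⟩))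
    · refine .inl ⟨hs, ?_⟩
      rcases d_eq_one_or_order hT j with hj | hj <;> simp [hi, hj]

/-! ### Strings of a simple root -/

variable (T) in
/-- The degrees of `L₊`: the pair `(α, r)` stands for `α + r δ`. -/
abbrev LoopWeight : Type := (T.Vertex₀ → ℤ) × ℤ

/-- The degree `α_i + r δ` of `x_{i,r}`. -/
def loopWt (p : T.Vertex₀ × ℕ) : T.LoopWeight := (Pi.single p.1 1, p.2)

/-- The homogeneous components of `L₊`. -/
def piece (γ : T.LoopWeight) : Submodule ℂ T.LPlus := gradedPiece T.xPlus loopWt γ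

/-- The coroot of `i ∈ I₀`, as a form on degrees. -/
def loopCoroot (i : T.Vertex₀) : T.LoopWeight →+ ℤ where
  toFun γ := ∑ j, T.cartan₀ i j * γ.1 j
  map_zero' := by simp
  map_add' γ γ' := by simp [mul_add, Finset.sum_add_distrib]

theorem loopCoroot_loopWt (i : T.Vertex₀) (p : T.Vertex₀ × ℕ) :
    loopCoroot i (loopWt p) = T.cartan₀ i p.1 := by
  simp [loopCoroot, loopWt, Pi.single_apply]

theorem loopCoroot_self (i : T.Vertex₀) (r : ℕ) : loopCoroot i (loopWt (i, r)) = 2 := by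
  rw [loopCoroot_loopWt]
  exact T.cartan_self _

/-- The raising operator `u ↦ [u, x_{i,0}]`. -/
def raise (i : T.Vertex₀) : Module.End ℂ T.LPlus := bracketRight (T.xPlus (i, 0))

theorem xPlus_mem_piece (p : T.Vertex₀ × ℕ) : T.xPlus p ∈ piece (loopWt p) :=
  mem_gradedPiece_gen _ _ p

theorem lie_mem_piece {γ γ' : T.LoopWeight} {u v : T.LPlus} (hu : u ∈ piece γ)
    (hv : v ∈ piece γ') : ⁅u, v⁆ ∈ piece (γ + γ') :=
  lie_mem_gradedPiece hu hv

theorem raise_pow_mem_piece (i : T.Vertex₀) (l : ℕ) {γ : T.LoopWeight} {u : T.LPlus}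
    (hu : u ∈ piece γ) : (raise i ^ l) u ∈ piece (γ + l • loopWt (i, 0)) := by
  induction l with
  | zero => simpa using hu
  | succ l ih =>
    rw [pow_succ', Module.End.mul_apply, succ_nsmul, ← add_assoc]
    exact lie_mem_piece ih (xPlus_mem_piece _)

/-- `u` is a homogeneous element at the bottom of an `i`-string with symmetric weights, of length
at most `m + 1`. -/
def IsStringBase (i : T.Vertex₀) (γ : T.LoopWeight) (m : ℕ) (u : T.LPlus) : Prop :=
  u ∈ piece γ ∧ loopCoroot i γ = -m ∧ (raise i ^ (m + 1)) u = 0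

/-- The type of all `i`-strings. -/
abbrev StringBase (i : T.Vertex₀) : Type :=
  {p : T.LoopWeight × ℕ × T.LPlus // IsStringBase i p.1 p.2.1 p.2.2}

/-- The components of the subalgebra of `L₊` generated by all `i`-strings. -/
def stringPiece (i : T.Vertex₀) (γ : T.LoopWeight) : Submodule ℂ T.LPlus :=
  gradedPiece (fun q : StringLeaf (fun s : StringBase i => s.1.2.1) =>
    (raise i ^ (q.2 : ℕ)) q.1.1.2.2) (fun q => q.1.1.1 + (q.2 : ℕ) • loopWt (i, 0)) γ

theorem stringPiece_le_piece (i : T.Vertex₀) (γ : T.LoopWeight) :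
    stringPiece i γ ≤ piece γ :=
  gradedPiece_le (fun q => raise_pow_mem_piece i _ q.1.2.1) γ

theorem stringPiece_le_map (i : T.Vertex₀) {γ : T.LoopWeight} {p : ℕ}
    (hp : loopCoroot i γ = p) :
    stringPiece i γ ≤ (stringPiece i (γ - p • loopWt (i, 0))).map (raise i ^ p) :=
  gradedPiece_strings_le (m := fun s : StringBase i => s.1.2.1) (bracketRight_lie _)
    (u := fun s : StringBase i => s.1.2.2) (wt := fun s => s.1.1) (loopCoroot_self i 0)
    (fun s => s.2.2.1) (fun s => s.2.2.2) hp

theorem raise_pow_mem_stringPiece {i : T.Vertex₀} {γ : T.LoopWeight} {m : ℕ} {u : T.LPlus}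
    (h : IsStringBase i γ m u) (l : ℕ) :
    (raise i ^ l) u ∈ stringPiece i (γ + l • loopWt (i, 0)) := by
  by_cases hl : l < m + 1
  · exact mem_gradedPiece_gen _ _
      (⟨⟨(γ, m, u), h⟩, ⟨l, hl⟩⟩ : StringLeaf (fun s : StringBase i => s.1.2.1))
  · rw [← Nat.sub_add_cancel (not_lt.1 hl), pow_add, Module.End.mul_apply, h.2.2, map_zero]
    exact zero_mem _

/-- The span of the vectors of degree `γ` in the `i`-strings starting at given elements. -/
def chainSpan (i : T.Vertex₀) (B : T.LoopWeight → T.LPlus → Prop) (γ : T.LoopWeight) :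
    Submodule ℂ T.LPlus :=
  Submodule.span ℂ {v | ∃ β u, ∃ l : ℕ, B β u ∧ γ = β + l • loopWt (i, 0) ∧ v = (raise i ^ l) u}

variable {i j : T.Vertex₀} {B : T.LoopWeight → T.LPlus → Prop}

theorem mem_chainSpan {γ β : T.LoopWeight} {u : T.LPlus} (h : B β u) (l : ℕ)
    (hγ : γ = β + l • loopWt (i, 0)) : (raise i ^ l) u ∈ chainSpan i B γ :=
  Submodule.subset_span ⟨β, u, l, h, hγ, rfl⟩

theorem raise_pow_mem_chainSpan {γ : T.LoopWeight} {v : T.LPlus} (hv : v ∈ chainSpan i B γ)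
    (l : ℕ) : (raise i ^ l) v ∈ chainSpan i B (γ + l • loopWt (i, 0)) := by
  induction hv using Submodule.span_induction with
  | zero => simp
  | add a b _ _ ha hb => rw [map_add]; exact add_mem ha hb
  | smul c a _ ha => rw [map_smul]; exact Submodule.smul_mem _ _ ha
  | mem v hv =>
    obtain ⟨β, u, k, hB, rfl, rfl⟩ := hv
    rw [← Module.End.mul_apply, ← pow_add]
    exact mem_chainSpan hB _ (by rw [add_nsmul]; abel)

/-- If the span of the strings starting at the elements of `B` is stable under all brackets with
`x_{i,c}`, it contains all left-normed brackets. -/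
theorem leftBracketPlus_mem_chainSpan
    (hR : ∀ β u, B β u → ∀ l c : ℕ, ⁅(raise i ^ l) u, T.xPlus (i, c)⁆ ∈
      chainSpan i B (β + l • loopWt (i, 0) + loopWt (i, c)))
    {s : ℕ} (h0 : B (loopWt (j, s)) (T.xPlus (j, s))) (t : List ℕ) :
    leftBracketPlus i j s t ∈
      chainSpan i B (loopWt (j, s) + (t.map fun r => loopWt (i, r)).sum) := by
  induction t using List.reverseRecOn with
  | nil => simpa [leftBracketPlus] using mem_chainSpan (i := i) h0 0 (by simp)
  | append_singleton t c ih =>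
    rw [leftBracketPlus_append, List.map_append, List.sum_append, ← add_assoc]
    simp only [List.map_cons, List.map_nil, List.sum_cons, List.sum_nil, add_zero]
    generalize loopWt (j, s) + (t.map fun r => loopWt (i, r)).sum = γ at *
    generalize leftBracketPlus i j s t = v at *
    induction ih using Submodule.span_induction with
    | zero => simp
    | add a b _ _ ha hb => rw [add_lie]; exact add_mem ha hb
    | smul c a _ ha => rw [smul_lie]; exact Submodule.smul_mem _ _ ha
    | mem v hv =>
      obtain ⟨β, u, k, hB, rfl, rfl⟩ := hv
      exact hR β u hB k c

theorem leftBracketPlus_mem_stringPiece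
    (hB : ∀ β u, B β u → ∃ m, IsStringBase i β m u)
    (hR : ∀ β u, B β u → ∀ l c : ℕ, ⁅(raise i ^ l) u, T.xPlus (i, c)⁆ ∈
      chainSpan i B (β + l • loopWt (i, 0) + loopWt (i, c)))
    {s : ℕ} (h0 : B (loopWt (j, s)) (T.xPlus (j, s))) (t : List ℕ) :
    leftBracketPlus i j s t ∈
      stringPiece i (loopWt (j, s) + (t.map fun r => loopWt (i, r)).sum) := by
  refine Submodule.span_le.2 ?_ (leftBracketPlus_mem_chainSpan hR h0 t)
  rintro _ ⟨β, u, l, h, hγ, rfl⟩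
  obtain ⟨m, hm⟩ := hB β u h
  rw [hγ]
  exact raise_pow_mem_stringPiece hm l

theorem raise_commute (hi : ¬ T.IsSpecial i) (c : ℕ) :
    Commute (raise i) (bracketRight (T.xPlus (i, c))) :=
  bracketRight_commute (xPlus_lie_self_of_not_special hi 0 c)

theorem lie_raise_pow (hi : ¬ T.IsSpecial i) (l c : ℕ) (u : T.LPlus) :
    ⁅(raise i ^ l) u, T.xPlus (i, c)⁆ = (raise i ^ l) ⁅u, T.xPlus (i, c)⁆ :=
  (LinearMap.congr_fun ((raise_commute hi c).pow_left l).eq u).symm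

/-- For commuting `x_{i,r}` it is enough to check stability at the bottom of the strings. -/
theorem leftBracketPlus_mem_stringPiece_of_not_special (hi : ¬ T.IsSpecial i)
    (hB : ∀ β u, B β u → ∃ m, IsStringBase i β m u)
    (hR : ∀ β u, B β u → ∀ c : ℕ, ⁅u, T.xPlus (i, c)⁆ ∈ chainSpan i B (β + loopWt (i, c)))
    {s : ℕ} (h0 : B (loopWt (j, s)) (T.xPlus (j, s))) (t : List ℕ) :
    leftBracketPlus i j s t ∈
      stringPiece i (loopWt (j, s) + (t.map fun r => loopWt (i, r)).sum) := by
  refine leftBracketPlus_mem_stringPiece hB (fun β u h l c => ?_) h0 t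
  rw [lie_raise_pow hi, add_right_comm]
  exact raise_pow_mem_chainSpan (hR β u h c) l

theorem isStringBase_xPlus (hij : i ≠ j) (s : ℕ) :
    IsStringBase i (loopWt (j, s)) (-T.cartan₀ i j).toNat (T.xPlus (j, s)) := by
  have h := cartan₀_nonpos hij
  refine ⟨xPlus_mem_piece _, ?_, xPlus_serre_zero hij ?_ s⟩
  · rw [loopCoroot_loopWt]; lia
  · lia

theorem loopWt_add_one_smul (s c : ℕ) :
    (loopWt (j, s) + loopWt (i, c) : T.LoopWeight) = loopWt (j, s + c) + 1 • loopWt (i, 0) := by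
  simp [loopWt, add_comm]

theorem dvd_dTilde₂ (hij : i ≠ j) (h : T.cartan₀ i j < 0) :
    T.dTilde i ∣ T.dTilde₂ i j ∧ T.dTilde j ∣ T.dTilde₂ i j := by
  have key : T.dTilde j ∣ T.dTilde i ∨ T.dTilde i ∣ T.dTilde j := by
    rcases adjacent_cases hij h with h | h | h | h
    · exact .inl h.2
    · exact .inl (by rw [h.2.2.2]; exact one_dvd _)
    · exact .inr (by rw [h.2.2.2.2.1]; exact one_dvd _)
    · exact .inr (by rw [h.2.2.2.1]; exact one_dvd _)
  have hpos : ∀ k, 0 < T.dTilde k := fun k => by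
    rw [dTilde]; split_ifs
    · exact one_pos
    · exact T.symmetrizer_pos _
  rw [dTilde₂]
  rcases key with key | key
  · rw [max_eq_left (Nat.le_of_dvd (hpos i) key)]; exact ⟨dvd_rfl, key⟩
  · rw [max_eq_right (Nat.le_of_dvd (hpos j) key)]; exact ⟨key, dvd_rfl⟩

theorem xPlus_shift_mul (hij : i ≠ j) (h : T.cartan₀ i j < 0) {r s : ℕ} (hr : T.dTilde i ∣ r)
    (hs : T.dTilde j ∣ s) (k : ℕ) :
    ⁅T.xPlus (j, s), T.xPlus (i, r + k * T.dTilde₂ i j)⁆ =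
      ⁅T.xPlus (j, s + k * T.dTilde₂ i j), T.xPlus (i, r)⁆ := by
  have hd := dvd_dTilde₂ hij h
  induction k generalizing s with
  | zero => simp
  | succ k ih =>
    rw [add_mul, one_mul, ← add_assoc, xPlus_shift (dvd_add hr (hd.1.mul_left k)) hs h,
      ih (dvd_add hs hd.2), add_assoc, add_comm (T.dTilde₂ i j)]

/-! ### Strings containing the left-normed brackets -/

theorem raise_apply (u : T.LPlus) : raise i u = ⁅u, T.xPlus (i, 0)⁆ := rfl

theorem leftBracketPlus_mem_of_cartan₀_eq_zero (hij : i ≠ j) (h : T.cartan₀ i j = 0) (s : ℕ)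
    (t : List ℕ) : leftBracketPlus i j s t ∈
      stringPiece i (loopWt (j, s) + (t.map fun r => loopWt (i, r)).sum) := by
  have h0 : ∀ s c, ⁅T.xPlus (j, s), T.xPlus (i, c)⁆ = 0 := fun s c => by
    have := xPlus_serre hij (m := 1) (by rw [h]; rfl) (fun _ => c) s
    simpa [leftBracketPlus] using this
  refine leftBracketPlus_mem_stringPiece
    (B := fun β u => ∃ s, β = loopWt (j, s) ∧ u = T.xPlus (j, s)) ?_ ?_ ⟨s, rfl, rfl⟩ t
  · rintro _ _ ⟨s, rfl, rfl⟩
    exact ⟨_, isStringBase_xPlus hij s⟩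
  · rintro _ _ ⟨s, rfl, rfl⟩ l c
    rcases l with _ | l
    · simp [h0]
    · rw [pow_succ, Module.End.mul_apply, raise_apply, h0, map_zero, zero_lie]
      exact zero_mem _

/-- If `d̃_j ∣ d̃_i`, then `[x_{j,s}, x_{i,c}] = [x_{j,s+c}, x_{i,0}]`, and the strings of the `x_{j,s}`
suffice. -/
theorem leftBracketPlus_mem_of_dvd (hij : i ≠ j) (h : T.cartan₀ i j < 0) (hi : ¬ T.IsSpecial i)
    (hd : T.dTilde j ∣ T.dTilde i) (s : ℕ) (t : List ℕ) :
    leftBracketPlus i j s t ∈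
      stringPiece i (loopWt (j, s) + (t.map fun r => loopWt (i, r)).sum) := by
  have hD : T.dTilde i = T.dTilde₂ i j := by
    apply Nat.dvd_antisymm (dvd_dTilde₂ hij h).1
    rw [dTilde₂]
    rcases max_choice (T.dTilde i) (T.dTilde j) with h | h <;> rw [h]
    exact hd
  refine leftBracketPlus_mem_stringPiece_of_not_special hi
    (B := fun β u => ∃ s, β = loopWt (j, s) ∧ u = T.xPlus (j, s)) ?_ ?_ ⟨s, rfl, rfl⟩ t
  · rintro _ _ ⟨s, rfl, rfl⟩
    exact ⟨_, isStringBase_xPlus hij s⟩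
  · rintro _ _ ⟨s, rfl, rfl⟩ c
    by_cases hs : T.dTilde j ∣ s
    swap
    · rw [xPlus_eq_zero hs, zero_lie]; exact zero_mem _
    by_cases hc : T.dTilde i ∣ c
    swap
    · rw [xPlus_eq_zero hc, lie_zero]; exact zero_mem _
    obtain ⟨k, rfl⟩ := hc
    have := xPlus_shift_mul hij h (dvd_zero _) hs k
    rw [← hD, zero_add, mul_comm] at this
    rw [this, loopWt_add_one_smul]
    exact mem_chainSpan (i := i) (u := T.xPlus (j, s + T.dTilde i * k)) ⟨_, rfl, rfl⟩ 1 rfl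

/-- For special `i` the strings of the `x_{j,s}` are stable under the `x_{i,c}`, although these do
not commute. -/
theorem leftBracketPlus_mem_of_special (hij : i ≠ j) (hi : T.IsSpecial i)
    (h : T.cartan₀ i j = -2) (hdi : T.dTilde i = 1) (hdj : T.dTilde j = 1) (s : ℕ) (t : List ℕ) :
    leftBracketPlus i j s t ∈
      stringPiece i (loopWt (j, s) + (t.map fun r => loopWt (i, r)).sum) := by
  have hneg : T.cartan₀ i j < 0 := by lia
  have two {v : T.LPlus} (hv : v + v = 0) : v = 0 := by
    rw [← two_smul ℂ] at hv
    exact (smul_eq_zero.1 hv).resolve_left two_ne_zero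
  have h1 : ∀ s c, ⁅T.xPlus (j, s), T.xPlus (i, c)⁆ = raise i (T.xPlus (j, s + c)) := fun s c => by
    have := xPlus_shift_mul hij hneg (r := 0) (s := s) (by simp) (by rw [hdj]; exact one_dvd _) c
    rwa [dTilde₂, hdi, hdj, max_self, mul_one, zero_add] at this
  -- `[[x_{j,s}, x_{i,0}], x_{i,c}]` changes sign when `c` decreases and `s` increases by one
  have h2 : ∀ c s, ⁅raise i (T.xPlus (j, s)), T.xPlus (i, c + 1)⁆ =
      -⁅raise i (T.xPlus (j, s + 1)), T.xPlus (i, c)⁆ := by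
    have base : ∀ s, ⁅raise i (T.xPlus (j, s)), T.xPlus (i, 1)⁆ =
        -⁅raise i (T.xPlus (j, s + 1)), T.xPlus (i, 0)⁆ := fun s => by
      have := xPlus_double_special h hi.1 s 0 0
      simp only [h1, zero_add, add_zero] at this
      exact eq_neg_of_add_eq_zero_right (two this)
    intro c s
    have h0 := xPlus_double_special h hi.1 s c 0
    simp only [h1, zero_add, add_zero] at h0
    have hb := base (s + c)
    rw [add_assoc] at hb
    rw [hb] at h0
    apply eq_neg_of_add_eq_zero_left
    have h0' := h0
    rw [← h0]
    abel
  have h3 : ∀ c s, ⁅raise i (T.xPlus (j, s)), T.xPlus (i, c)⁆ =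
      ((-1 : ℂ) ^ c) • (raise i ^ 2) (T.xPlus (j, s + c)) := by
    intro c
    induction c with
    | zero => intro s; rw [pow_zero, one_smul, pow_two]; rfl
    | succ c ih =>
      intro s
      rw [h2, ih, pow_succ (-1 : ℂ), mul_neg_one, neg_smul, add_assoc, add_comm 1]
  have h4 : ∀ s, (raise i ^ 3) (T.xPlus (j, s)) = 0 :=
    xPlus_serre_zero hij (m := 2) (by rw [h]; rfl)
  have h5 : ∀ s c, ⁅(raise i ^ 2) (T.xPlus (j, s)), T.xPlus (i, c)⁆ = 0 := by
    intro s c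
    have := xPlus_serre hij (m := 3) (by rw [h]; rfl) ![0, 0, c] s
    have e : ∀ σ : Equiv.Perm (Fin 3), (List.ofFn fun l => ![0, 0, c] (σ l)) =
      [![0, 0, c] (σ 0), ![0, 0, c] (σ 1), ![0, 0, c] (σ 2)] := fun σ => by simp [List.ofFn_succ]
    simp only [e] at this
    rw [sum_perm_fin_three fun p q w : Fin 3 =>
      leftBracketPlus i j s [![0, 0, c] p, ![0, 0, c] q, ![0, 0, c] w]] at this
    have h4' : ∀ s, ⁅(raise i ^ 2) (T.xPlus (j, s)), T.xPlus (i, 0)⁆ = 0 := fun s => by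
      rw [← h4 s, pow_succ' _ 2]; rfl
    simp [leftBracketPlus, h1, h3, h4'] at this
    exact two this
  refine leftBracketPlus_mem_stringPiece
    (B := fun β u => ∃ s, β = loopWt (j, s) ∧ u = T.xPlus (j, s)) ?_ ?_ ⟨s, rfl, rfl⟩ t
  · rintro _ _ ⟨s, rfl, rfl⟩
    exact ⟨_, isStringBase_xPlus hij s⟩
  · rintro _ _ ⟨s, rfl, rfl⟩ l c
    rcases l with _ | _ | _ | l
    · simp only [pow_zero, Module.End.one_apply, zero_smul, add_zero]
      rw [h1, loopWt_add_one_smul]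
      exact mem_chainSpan (i := i) (u := T.xPlus (j, s + c)) ⟨_, rfl, rfl⟩ 1 rfl
    · rw [zero_add, pow_one, h3]
      refine Submodule.smul_mem _ _ (mem_chainSpan (i := i) ⟨_, rfl, rfl⟩ 2 ?_)
      rw [add_right_comm, loopWt_add_one_smul, two_nsmul, one_nsmul, add_assoc]
    · rw [zero_add, h5]; exact zero_mem _
    · rw [show l + 1 + 1 + 1 = l + 3 by rfl, pow_add, Module.End.mul_apply, h4, map_zero, zero_lie]
      exact zero_mem _

/-- For `k = 2` and `a_ij = -2`, the strings start at the `x_{j,s}` (three elements) and at the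
`[x_{j,s}, x_{i,1}]` (one element), with `s` even. -/
theorem leftBracketPlus_mem_of_order_two (hij : i ≠ j) (hi : ¬ T.IsSpecial i)
    (h : T.cartan₀ i j = -2) (hk : T.order = 2) (hT : ¬ T.IsTwistedAEven) (hdi : T.dTilde i = 1)
    (hdj : T.dTilde j = 2) (s : ℕ) (t : List ℕ) :
    leftBracketPlus i j s t ∈
      stringPiece i (loopWt (j, s) + (t.map fun r => loopWt (i, r)).sum) := by
  have hneg : T.cartan₀ i j < 0 := by lia
  have two {v : T.LPlus} (hv : v + v = 0) : v = 0 := by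
    rw [← two_smul ℂ] at hv
    exact (smul_eq_zero.1 hv).resolve_left two_ne_zero
  have h1 : ∀ {s}, 2 ∣ s → ∀ r k, ⁅T.xPlus (j, s), T.xPlus (i, r + k * 2)⁆ =
      ⁅T.xPlus (j, s + k * 2), T.xPlus (i, r)⁆ := fun {s} hs r k => by
    have := xPlus_shift_mul hij hneg (r := r) (s := s) (by simp [hdi]) (by rwa [hdj]) k
    rwa [dTilde₂, hdi, hdj, max_eq_right one_le_two] at this
  have h2 : ∀ s, raise i ⁅T.xPlus (j, s), T.xPlus (i, 1)⁆ = 0 := fun s =>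
    two (xPlus_double_two h hk hT s 0 0)
  have h3 : ∀ {s}, 2 ∣ s → ⁅⁅T.xPlus (j, s), T.xPlus (i, 1)⁆, T.xPlus (i, 1)⁆ =
      -(raise i ^ 2) (T.xPlus (j, s + 2)) := fun {s} hs => by
    have := xPlus_double_two h hk hT s 0 1
    rw [show 1 + 1 = 0 + 1 * 2 by rfl, h1 hs] at this
    exact eq_neg_of_add_eq_zero_left this
  refine leftBracketPlus_mem_stringPiece_of_not_special hi
    (B := fun β u => ∃ s, 2 ∣ s ∧ (β = loopWt (j, s) ∧ u = T.xPlus (j, s) ∨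
      β = loopWt (j, s) + loopWt (i, 1) ∧ u = ⁅T.xPlus (j, s), T.xPlus (i, 1)⁆) ∨
      -- the last case only serves to include `x_{j,s} = 0` for odd `s`
      (β = loopWt (j, s) ∧ u = T.xPlus (j, s) ∧ u = 0)) ?_ ?_ ?_ t
  · rintro _ _ ⟨s, ⟨hs, ⟨rfl, rfl⟩ | ⟨rfl, rfl⟩⟩ | ⟨rfl, rfl, _⟩⟩
    · exact ⟨_, isStringBase_xPlus hij s⟩
    · refine ⟨0, lie_mem_piece (xPlus_mem_piece _) (xPlus_mem_piece _), ?_, ?_⟩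
      · rw [map_add, loopCoroot_loopWt, loopCoroot_self, h]; rfl
      · rw [zero_add, pow_one, h2]
    · exact ⟨_, isStringBase_xPlus hij s⟩
  · rintro _ _ ⟨s, ⟨hs, ⟨rfl, rfl⟩ | ⟨rfl, rfl⟩⟩ | ⟨rfl, rfl, h0⟩⟩ c
    · obtain ⟨k, rfl | rfl⟩ := Nat.even_or_odd' c
      · have := h1 hs 0 k
        rw [zero_add, mul_comm] at this
        rw [this, loopWt_add_one_smul]
        exact mem_chainSpan (i := i) (u := T.xPlus (j, s + 2 * k))
          ⟨_, .inl ⟨by lia, .inl ⟨rfl, rfl⟩⟩⟩ 1 rfl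
      · have := h1 hs 1 k
        rw [add_comm, mul_comm] at this
        rw [this]
        refine mem_chainSpan (i := i) (u := ⁅T.xPlus (j, s + 2 * k), T.xPlus (i, 1)⁆)
          ⟨s + 2 * k, .inl ⟨by lia, .inr ⟨rfl, rfl⟩⟩⟩ 0 ?_
        simp [loopWt]
        ring
    · have hcomm : ⁅⁅T.xPlus (j, s), T.xPlus (i, 1)⁆, T.xPlus (i, c)⁆ =
          ⁅⁅T.xPlus (j, s), T.xPlus (i, c)⁆, T.xPlus (i, 1)⁆ :=
        LinearMap.congr_fun
          (bracketRight_commute (xPlus_lie_self_of_not_special hi c 1)).eq (T.xPlus (j, s))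
      obtain ⟨k, rfl | rfl⟩ := Nat.even_or_odd' c
      · have := h1 hs 0 k
        rw [zero_add, mul_comm] at this
        rw [hcomm, this, ← raise_apply, ← pow_one (raise i), lie_raise_pow hi, pow_one, h2]
        exact zero_mem _
      · have := h1 hs 1 k
        rw [add_comm, mul_comm] at this
        rw [hcomm, this, h3 (by lia)]
        refine neg_mem (mem_chainSpan (i := i) ⟨s + 2 * k + 2, .inl ⟨by lia, .inl ⟨rfl, rfl⟩⟩⟩ 2 ?_)
        simp [loopWt]
        constructor
        · ring
        · ring
    · rw [h0, zero_lie]; exact zero_mem _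
  · by_cases hs : 2 ∣ s
    · exact ⟨s, .inl ⟨hs, .inl ⟨rfl, rfl⟩⟩⟩
    · exact ⟨s, .inr ⟨rfl, rfl, xPlus_eq_zero (by rwa [hdj])⟩⟩

end AffineType

namespace AffineType

variable {T : AffineType} {i j : T.Vertex₀}

/-- For `k = 3` and `a_ij = -3`, the strings start at the `x_{j,s}` (four elements) and at the
`[x_{j,s}, x_{i,1}]` and `[x_{j,s}, x_{i,2}]` (two elements each), with `3 ∣ s`. -/
theorem leftBracketPlus_mem_of_order_three (hij : i ≠ j) (hi : ¬ T.IsSpecial i)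
    (h : T.cartan₀ i j = -3) (hk : T.order = 3) (hdi : T.dTilde i = 1)
    (hdj : T.dTilde j = 3) (s : ℕ) (t : List ℕ) :
    leftBracketPlus i j s t ∈
      stringPiece i (loopWt (j, s) + (t.map fun r => loopWt (i, r)).sum) := by
  have hneg : T.cartan₀ i j < 0 := by lia
  have h1 : ∀ {s}, 3 ∣ s → ∀ r k, ⁅T.xPlus (j, s), T.xPlus (i, r + k * 3)⁆ =
      ⁅T.xPlus (j, s + k * 3), T.xPlus (i, r)⁆ := fun {s} hs r k => by
    have := xPlus_shift_mul hij hneg (r := r) (s := s) (by simp [hdi]) (by rwa [hdj]) k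
    rwa [dTilde₂, hdi, hdj, max_eq_right (by norm_num)] at this
  have comm : ∀ (u : T.LPlus) a b, ⁅⁅u, T.xPlus (i, a)⁆, T.xPlus (i, b)⁆ =
      ⁅⁅u, T.xPlus (i, b)⁆, T.xPlus (i, a)⁆ := fun u a b =>
    LinearMap.congr_fun (bracketRight_commute (xPlus_lie_self_of_not_special hi b a)).eq u
  have q11 : ∀ s, ⁅⁅T.xPlus (j, s), T.xPlus (i, 1)⁆, T.xPlus (i, 1)⁆ =
      (-2 : ℂ) • raise i ⁅T.xPlus (j, s), T.xPlus (i, 2)⁆ := fun s => by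
    have := xPlus_double_three h hk s 0 0
    simp only [zero_add] at this
    rw [raise_apply]
    linear_combination (norm := module) (1 / 2 : ℂ) • this
  have q21 : ∀ {s}, 3 ∣ s → ⁅⁅T.xPlus (j, s), T.xPlus (i, 2)⁆, T.xPlus (i, 1)⁆ =
      (-1 / 2 : ℂ) • (raise i ^ 2) (T.xPlus (j, s + 3)) := fun {s} hs => by
    have := xPlus_double_three h hk s 0 1
    simp only [zero_add] at this
    rw [show 1 + 2 = 0 + 1 * 3 by rfl, h1 hs, show 1 + 1 = 2 by rfl, comm _ 1 2] at this
    rw [pow_two, Module.End.mul_apply, raise_apply, raise_apply]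
    linear_combination (norm := module) (1 / 4 : ℂ) • this
  have q22 : ∀ {s}, 3 ∣ s → ⁅⁅T.xPlus (j, s), T.xPlus (i, 2)⁆, T.xPlus (i, 2)⁆ =
      (-2 : ℂ) • raise i ⁅T.xPlus (j, s + 3), T.xPlus (i, 1)⁆ := fun {s} hs => by
    have := xPlus_double_three h hk s 1 1
    rw [show 1 + 2 = 0 + 1 * 3 by rfl, h1 hs, show 1 + 1 = 2 by rfl, comm _ 0 1] at this
    rw [raise_apply]
    linear_combination (norm := module) (1 / 2 : ℂ) • this
  have e1 : ∀ s, (raise i ^ 2) ⁅T.xPlus (j, s), T.xPlus (i, 1)⁆ = 0 := fun s => by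
    have := xPlus_triple_three h hk s 0 0 0
    simp only [zero_add] at this
    rw [pow_two, Module.End.mul_apply, raise_apply, raise_apply]
    linear_combination (norm := module) (1 / 6 : ℂ) • this
  have e2 : ∀ s, (raise i ^ 2) ⁅T.xPlus (j, s), T.xPlus (i, 2)⁆ = 0 := fun s => by
    have := xPlus_triple_three h hk s 1 0 0
    simp only [zero_add, show 1 + 1 = 2 by rfl] at this
    rw [comm _ 0 1, q11, raise_apply, smul_lie] at this
    rw [pow_two, Module.End.mul_apply, raise_apply, raise_apply]
    linear_combination (norm := module) (-1 / 6 : ℂ) • this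
  refine leftBracketPlus_mem_stringPiece_of_not_special hi
    (B := fun β u => ∃ s, 3 ∣ s ∧ (β = loopWt (j, s) ∧ u = T.xPlus (j, s) ∨
      (∃ a, (a = 1 ∨ a = 2) ∧
        β = loopWt (j, s) + loopWt (i, a) ∧ u = ⁅T.xPlus (j, s), T.xPlus (i, a)⁆)) ∨
      (β = loopWt (j, s) ∧ u = T.xPlus (j, s) ∧ u = 0)) ?_ ?_ ?_ t
  · rintro _ _ ⟨s, ⟨hs, ⟨rfl, rfl⟩ | ⟨a, ha, rfl, rfl⟩⟩ | ⟨rfl, rfl, _⟩⟩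
    · exact ⟨_, isStringBase_xPlus hij s⟩
    · refine ⟨1, lie_mem_piece (xPlus_mem_piece _) (xPlus_mem_piece _), ?_, ?_⟩
      · rw [map_add, loopCoroot_loopWt, loopCoroot_self, h]; rfl
      · rcases ha with rfl | rfl
        · exact e1 s
        · exact e2 s
    · exact ⟨_, isStringBase_xPlus hij s⟩
  · rintro _ _ ⟨s, ⟨hs, ⟨rfl, rfl⟩ | ⟨a, ha, rfl, rfl⟩⟩ | ⟨rfl, rfl, h0⟩⟩ c
    · obtain ⟨k, a, ha, rfl⟩ : ∃ k a, a < 3 ∧ c = a + k * 3 :=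
        ⟨c / 3, c % 3, Nat.mod_lt _ (by norm_num), by lia⟩
      rw [h1 hs]
      rcases Nat.eq_zero_or_pos a with rfl | ha0
      · refine mem_chainSpan (i := i) (u := T.xPlus (j, s + k * 3))
          ⟨_, .inl ⟨by lia, .inl ⟨rfl, rfl⟩⟩⟩ 1 ?_
        rw [zero_add, loopWt_add_one_smul]
      · refine mem_chainSpan (i := i) (u := ⁅T.xPlus (j, s + k * 3), T.xPlus (i, a)⁆)
          ⟨s + k * 3, .inl ⟨by lia, .inr ⟨a, by lia, rfl, rfl⟩⟩⟩ 0 ?_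
        simp [loopWt]
        ring
    · obtain ⟨k, b, hb, rfl⟩ : ∃ k a, a < 3 ∧ c = a + k * 3 :=
        ⟨c / 3, c % 3, Nat.mod_lt _ (by norm_num), by lia⟩
      rw [comm, h1 hs]
      have hs' : 3 ∣ s + k * 3 := by lia
      have hw : (loopWt (j, s) + loopWt (i, a) + loopWt (i, b + k * 3) : T.LoopWeight) =
          loopWt (j, s + k * 3) + loopWt (i, b) + loopWt (i, a) := by
        simp [loopWt]
        ring
      rw [hw]
      generalize s + k * 3 = s at *
      have mem2 : ∀ s, 3 ∣ s → (raise i ^ 2) (T.xPlus (j, s + 3)) ∈ chainSpan i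
          (fun β u => ∃ s, 3 ∣ s ∧ (β = loopWt (j, s) ∧ u = T.xPlus (j, s) ∨
            (∃ a, (a = 1 ∨ a = 2) ∧
              β = loopWt (j, s) + loopWt (i, a) ∧ u = ⁅T.xPlus (j, s), T.xPlus (i, a)⁆)) ∨
            (β = loopWt (j, s) ∧ u = T.xPlus (j, s) ∧ u = 0))
          (loopWt (j, s) + loopWt (i, 2) + loopWt (i, 1)) := fun s hs => by
        refine mem_chainSpan (i := i) (u := T.xPlus (j, s + 3))
          ⟨s + 3, .inl ⟨by lia, .inl ⟨rfl, rfl⟩⟩⟩ 2 ?_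
        simp [loopWt]
        constructor
        · ring
        · ring
      interval_cases b
      · rw [comm, add_right_comm]
        exact mem_chainSpan (i := i) (u := ⁅T.xPlus (j, s), T.xPlus (i, a)⁆)
          ⟨s, .inl ⟨hs', .inr ⟨a, ha, rfl, rfl⟩⟩⟩ 1 (by rw [one_nsmul])
      · rcases ha with rfl | rfl
        · rw [q11]
          refine Submodule.smul_mem _ _ (mem_chainSpan (i := i)
            (u := ⁅T.xPlus (j, s), T.xPlus (i, 2)⁆)
            ⟨s, .inl ⟨hs', .inr ⟨2, .inr rfl, rfl, rfl⟩⟩⟩ 1 ?_)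
          simp [loopWt]; ring
        · rw [comm, q21 hs', add_right_comm]
          exact Submodule.smul_mem _ _ (mem2 s hs')
      · rcases ha with rfl | rfl
        · rw [q21 hs']
          exact Submodule.smul_mem _ _ (mem2 s hs')
        · rw [q22 hs']
          refine Submodule.smul_mem _ _ (mem_chainSpan (i := i)
            (u := ⁅T.xPlus (j, s + 3), T.xPlus (i, 1)⁆)
            ⟨s + 3, .inl ⟨by lia, .inr ⟨1, .inl rfl, rfl, rfl⟩⟩⟩ 1 ?_)
          simp [loopWt]; ring
    · rw [h0, zero_lie]; exact zero_mem _
  · by_cases hs : 3 ∣ s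
    · exact ⟨s, .inl ⟨hs, .inl ⟨rfl, rfl⟩⟩⟩
    · exact ⟨s, .inr ⟨rfl, rfl, xPlus_eq_zero (by rwa [hdj])⟩⟩

/-- All brackets `[…[x_{j,s}, x_{i,t₁}], …, x_{i,t_m}]` lie in the span of the `i`-strings. -/
theorem leftBracketPlus_mem (hij : i ≠ j) (s : ℕ) (t : List ℕ) :
    leftBracketPlus i j s t ∈
      stringPiece i (loopWt (j, s) + (t.map fun r => loopWt (i, r)).sum) := by
  rcases (cartan₀_nonpos hij).eq_or_lt with h | h
  · exact leftBracketPlus_mem_of_cartan₀_eq_zero hij h s t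
  · rcases adjacent_cases hij h with h' | h' | h' | h'
    · exact leftBracketPlus_mem_of_dvd hij h h'.1 h'.2 s t
    · exact leftBracketPlus_mem_of_special hij h'.1 h'.2.1 h'.2.2.1 h'.2.2.2 s t
    · exact leftBracketPlus_mem_of_order_two hij h'.1 h'.2.2.2.1 h'.2.1 h'.2.2.1 h'.2.2.2.2.1
        h'.2.2.2.2.2 s t
    · exact leftBracketPlus_mem_of_order_three hij h'.1 h'.2.2.1 h'.2.1 h'.2.2.2.1 h'.2.2.2.2 s t

/-! ### The reflection principle -/

/-- The components of the subalgebra generated by all `[…[x_{j,s}, x_{i,t₁}], …, x_{i,t_m}]` with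
`j ≠ i`. -/
def offPiece (i : T.Vertex₀) (γ : T.LoopWeight) : Submodule ℂ T.LPlus :=
  gradedPiece (fun q : {j // i ≠ j} × ℕ × List ℕ => leftBracketPlus i q.1 q.2.1 q.2.2)
    (fun q => loopWt (q.1.1, q.2.1) + (q.2.2.map fun r => loopWt (i, r)).sum) γ

theorem leftBracketPlus_mem_offPiece (hij : i ≠ j) (s : ℕ) (t : List ℕ) :
    leftBracketPlus i j s t ∈
      offPiece i (loopWt (j, s) + (t.map fun r => loopWt (i, r)).sum) :=
  mem_gradedPiece_gen
    (fun q : {j // i ≠ j} × ℕ × List ℕ => leftBracketPlus i q.1 q.2.1 q.2.2)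
    (fun q => loopWt (q.1.1, q.2.1) + (q.2.2.map fun r => loopWt (i, r)).sum) (⟨j, hij⟩, s, t)

theorem offPiece_le_stringPiece (i : T.Vertex₀) (γ : T.LoopWeight) :
    offPiece i γ ≤ stringPiece i γ := by
  unfold offPiece stringPiece
  refine gradedPiece_le (fun q => ?_) γ
  have := leftBracketPlus_mem q.1.2 q.2.1 q.2.2
  unfold stringPiece at this
  exact this

theorem lie_xPlus_mem_offPiece (i : T.Vertex₀) (r : ℕ) {γ : T.LoopWeight} {u : T.LPlus}
    (hu : u ∈ offPiece i γ) : ⁅u, T.xPlus (i, r)⁆ ∈ offPiece i (γ + loopWt (i, r)) := by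
  induction hu using Submodule.span_induction with
  | zero => simp
  | add a b _ _ ha hb => rw [add_lie]; exact add_mem ha hb
  | smul c a _ ha => rw [smul_lie]; exact Submodule.smul_mem _ _ ha
  | mem u hu =>
    induction hu with
    | gen q =>
      rw [← leftBracketPlus_append]
      have := leftBracketPlus_mem_offPiece q.1.2 q.2.1 (q.2.2 ++ [r])
      simpa [← add_assoc] using this
    | lie hu hv h₁ h₂ =>
      rw [← bracketRight_apply, bracketRight_lie]
      refine add_mem ?_ ?_
      · rw [add_right_comm]
        exact lie_mem_gradedPiece h₁ (Submodule.subset_span hv)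
      · rw [add_assoc]
        exact lie_mem_gradedPiece (Submodule.subset_span hu) h₂

/-- A monomial in the generators that involves some `x_{j,s}` with `j ≠ i` lies in `offPiece i`; the
others normalize it. -/
theorem IsMonomial.mem_offPiece_or (i : T.Vertex₀) {γ : T.LoopWeight} {u : T.LPlus}
    (hu : IsMonomial T.xPlus loopWt γ u) :
    u ∈ offPiece i γ ∨ (∀ j ≠ i, γ.1 j = 0) ∧
      ∀ γ', ∀ v ∈ offPiece i γ', ⁅v, u⁆ ∈ offPiece i (γ' + γ) := by
  induction hu with
  | gen p =>
    obtain ⟨k, r⟩ := p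
    by_cases h : i = k
    · subst h
      exact .inr ⟨fun j hj => by simp [loopWt, hj], fun γ' v hv => lie_xPlus_mem_offPiece i r hv⟩
    · left
      have := leftBracketPlus_mem_offPiece h r []
      simpa [leftBracketPlus] using this
  | @lie γ₁ γ₂ u v _ _ h₁ h₂ =>
    rcases h₁ with h₁ | ⟨h₁, h₁'⟩ <;> rcases h₂ with h₂ | ⟨h₂, h₂'⟩
    · exact .inl (lie_mem_gradedPiece h₁ h₂)
    · exact .inl (h₂' _ _ h₁)
    · left
      rw [← lie_skew, add_comm]
      exact neg_mem (h₁' _ _ h₂)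
    · refine .inr ⟨fun j hj => by simp [h₁ j hj, h₂ j hj], fun γ' w hw => ?_⟩
      have e : ⁅w, ⁅u, v⁆⁆ = ⁅⁅w, u⁆, v⁆ - ⁅⁅w, v⁆, u⁆ := by
        have := bracketRight_lie v w u
        simp only [bracketRight_apply] at this
        rw [this]
        abel
      rw [e]
      refine sub_mem ?_ ?_
      · rw [← add_assoc]; exact h₂' _ _ (h₁' _ _ hw)
      · rw [add_comm γ₁, ← add_assoc]; exact h₁' _ _ (h₂' _ _ hw)

/-- The reflection principle: away from the multiples of `α_i`, the component of a degree `γ` with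
`⟨γ, α_i^∨⟩ = p ≥ 0` is the image of the component of the reflected degree. -/
theorem piece_le_map_raise {γ : T.LoopWeight} (hj : ∃ j ≠ i, γ.1 j ≠ 0) {p : ℕ}
    (hp : loopCoroot i γ = p) :
    piece γ ≤ (piece (γ - p • loopWt (i, 0))).map (raise i ^ p) := by
  -- the monomials that only involve the `x_{i,r}` have degree in `ℤ α_i + ℤ δ`
  have h1 : piece γ ≤ stringPiece i γ := by
    refine Submodule.span_le.2 fun u hu => ?_
    rcases IsMonomial.mem_offPiece_or i hu with h | h
    · exact offPiece_le_stringPiece i γ h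
    · obtain ⟨j, hj, hj'⟩ := hj
      exact absurd (h.1 j hj) hj'
  exact h1.trans ((stringPiece_le_map i hp).trans (Submodule.map_mono (stringPiece_le_piece i _)))

end AffineType

/-! ### Degrees which are multiples of a simple root -/

theorem jacobi_cyclic {L : Type} [LieRing L] (x y z : L) :
    ⁅⁅x, y⁆, z⁆ = -⁅⁅y, z⁆, x⁆ - ⁅⁅z, x⁆, y⁆ := by
  have := lie_jacobi z x y
  rw [← lie_skew ⁅x, y⁆ z, ← lie_skew ⁅y, z⁆ x, ← lie_skew ⁅z, x⁆ y, ← sub_eq_zero]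
  rw [← neg_eq_zero, ← this]
  abel

namespace AffineType

variable {T : AffineType} {i : T.Vertex₀}

theorem IsMonomial.loopWeight_nonneg {γ : T.LoopWeight} {u : T.LPlus}
    (hu : IsMonomial T.xPlus loopWt γ u) : ∀ j, 0 ≤ γ.1 j := by
  induction hu with
  | gen p =>
    intro j
    simp only [loopWt, Pi.single_apply]
    split_ifs <;> simp
  | lie _ _ h₁ h₂ => exact fun j => add_nonneg (h₁ j) (h₂ j)

theorem IsMonomial.eq_xPlus_or_eq_zero (hi : ¬ T.IsSpecial i) {γ : T.LoopWeight} {u : T.LPlus}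
    (hu : IsMonomial T.xPlus loopWt γ u) (h : ∀ j ≠ i, γ.1 j = 0) :
    (∃ r, γ = loopWt (i, r) ∧ u = T.xPlus (i, r)) ∨ u = 0 := by
  induction hu with
  | gen p =>
    obtain ⟨k, r⟩ := p
    have : k = i := by
      by_contra hk
      simpa [loopWt] using h k hk
    subst this
    exact .inl ⟨r, rfl, rfl⟩
  | lie hu hv h₁ h₂ =>
    have hnu := IsMonomial.loopWeight_nonneg hu
    have hnv := IsMonomial.loopWeight_nonneg hv
    simp only [Prod.fst_add, Pi.add_apply] at h
    right
    rcases h₁ (fun j hj => by linarith [h j hj, hnu j, hnv j]) with ⟨a, _, rfl⟩ | rfl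
    · rcases h₂ (fun j hj => by linarith [h j hj, hnu j, hnv j]) with ⟨b, _, rfl⟩ | rfl
      · exact xPlus_lie_self_of_not_special hi a b
      · exact lie_zero _
    · exact zero_lie _

theorem xPlus_special_shift (hi : T.IsSpecial i) (a b k : ℕ) :
    ⁅T.xPlus (i, a), T.xPlus (i, b + 2 * k)⁆ = ⁅T.xPlus (i, a + 2 * k), T.xPlus (i, b)⁆ := by
  induction k generalizing a with
  | zero => rfl
  | succ k ih =>
    have := xPlus_special_swap hi a (b + 2 * k)
    rw [show a + 2 * (k + 1) = a + 2 + 2 * k by ring, ← ih (a + 2),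
      show b + 2 * (k + 1) = b + 2 * k + 2 by ring, ← lie_skew, eq_comm]
    exact eq_neg_of_add_eq_zero_left this

theorem xPlus_special_lie_eq_zero (hi : T.IsSpecial i) {a b : ℕ} (h : Even (a + b)) :
    ⁅T.xPlus (i, a), T.xPlus (i, b)⁆ = 0 := by
  have two {v w : T.LPlus} (hv : v = w) (hv' : w = -v) : v = 0 := by
    have : (2 : ℂ) • v = 0 := by rw [two_smul]; nth_rewrite 2 [hv]; rw [hv']; abel
    exact (smul_eq_zero.1 this).resolve_left two_ne_zero
  -- the bracket depends on `a + b` and on the parity of `b` only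
  obtain ⟨k, e, rfl, he⟩ : ∃ k e, b = e + 2 * k ∧ e < 2 := ⟨b / 2, b % 2, by lia, by lia⟩
  obtain ⟨l, rfl⟩ : ∃ l, a = e + 2 * l := by
    obtain ⟨c, hc⟩ := h
    exact ⟨a / 2, by lia⟩
  refine two (w := ⁅T.xPlus (i, e + 2 * k), T.xPlus (i, e + 2 * l)⁆) ?_ (lie_skew _ _).symm
  rw [xPlus_special_shift hi, xPlus_special_shift hi, add_right_comm]

theorem xPlus_special_lie_even (hi : T.IsSpecial i) {a b : ℕ} (hb : Even b) :
    ⁅T.xPlus (i, a), T.xPlus (i, b)⁆ = ⁅T.xPlus (i, a + b), T.xPlus (i, 0)⁆ := by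
  obtain ⟨k, rfl⟩ := hb
  rw [← two_mul, ← zero_add (2 * k), xPlus_special_shift hi, zero_add]

/-- For special `i` all threefold brackets of the `x_{i,r}` vanish. -/
theorem xPlus_special_lie_lie_eq_zero (hi : T.IsSpecial i) {N : ℕ} (hN : Odd N) (r : ℕ) :
    ⁅⁅T.xPlus (i, N), T.xPlus (i, 0)⁆, T.xPlus (i, r)⁆ = 0 := by
  have six {v : T.LPlus} {t : ℂ} (ht : t ≠ 0) (hv : t • v = 0) : v = 0 :=
    (smul_eq_zero.1 hv).resolve_left ht
  -- the Jacobi identity moves all of `r` to the first entry if `r` is even, and all but `1` of the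
  -- first entry to `r` if `r` is odd; then the cubic relation applies
  have even : ∀ {N r}, Odd N → Even r → ⁅⁅T.xPlus (i, N), T.xPlus (i, 0)⁆, T.xPlus (i, r)⁆ =
      ⁅⁅T.xPlus (i, N + r), T.xPlus (i, 0)⁆, T.xPlus (i, 0)⁆ := fun {N r} hN hr => by
    rw [jacobi_cyclic, xPlus_special_lie_eq_zero hi (a := 0) (b := r) (by simpa using hr),
      ← lie_skew (T.xPlus (i, r)), xPlus_special_lie_even hi hr, zero_lie, neg_lie]
    abel
  have odd : ∀ {k r}, Odd r → ⁅⁅T.xPlus (i, 2 * k + 1), T.xPlus (i, 0)⁆, T.xPlus (i, r)⁆ =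
      ⁅⁅T.xPlus (i, r + 2 * k), T.xPlus (i, 0)⁆, T.xPlus (i, 1)⁆ := fun {k r} hr => by
    have h1 : Odd 1 := odd_one
    rw [add_comm, ← xPlus_special_lie_even hi (even_two_mul k), jacobi_cyclic,
      xPlus_special_lie_eq_zero hi (a := r) (b := 1) (hr.add_odd h1),
      ← lie_skew (T.xPlus (i, 2 * k)), xPlus_special_lie_even hi (even_two_mul k), zero_lie,
      neg_lie]
    abel
  rcases Nat.even_or_odd r with hr | hr
  · rw [even hN hr]
    obtain ⟨c, hc⟩ : ∃ c, N + r = c + 1 := ⟨N + r - 1, by have := hN.pos; lia⟩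
    have hc' : Even c := by
      have : Odd (c + 1) := hc ▸ hN.add_even hr
      simpa [parity_simps] using this
    have h := xPlus_special_triple hi 0 0 c
    simp only [zero_add] at h
    rw [xPlus_special_lie_even hi hc', even odd_one hc', add_comm 1 c] at h
    rw [hc]
    refine six (t := 6) (by norm_num) ?_
    rw [← h]
    module
  · have base : ∀ {r}, Odd r → ⁅⁅T.xPlus (i, 1), T.xPlus (i, 0)⁆, T.xPlus (i, r)⁆ = 0 :=
        fun {r} hr => by
      have h := xPlus_special_triple hi 0 0 r
      simp only [zero_add] at h
      rw [xPlus_special_lie_eq_zero hi (a := 1) (b := r) (odd_one.add_odd hr),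
        xPlus_special_lie_eq_zero hi (a := r + 1) (b := 0) (hr.add_odd odd_one)] at h
      refine six (t := 2) two_ne_zero ?_
      simp only [zero_lie, add_zero] at h
      rw [← h]
      module
    obtain ⟨k, rfl⟩ := hN
    rw [odd hr]
    have := odd (k := 0) (hr.add_even (even_two_mul k))
    simp only [mul_zero, zero_add, add_zero] at this
    rw [← this, base (hr.add_even (even_two_mul k))]

theorem IsMonomial.special_cases (hi : T.IsSpecial i) {γ : T.LoopWeight} {u : T.LPlus}
    (hu : IsMonomial T.xPlus loopWt γ u) (h : ∀ j ≠ i, γ.1 j = 0) :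
    (∃ r, γ = loopWt (i, r) ∧ u = T.xPlus (i, r)) ∨
      (∃ N : ℕ, Odd N ∧ γ = (Pi.single i 2, (N : ℤ)) ∧
        ∃ t : ℂ, u = t • ⁅T.xPlus (i, N), T.xPlus (i, 0)⁆) ∨ u = 0 := by
  have lie_y : ∀ {N r}, Odd N →
      ⁅T.xPlus (i, r), ⁅T.xPlus (i, N), T.xPlus (i, 0)⁆⁆ = 0 := fun {N r} hN => by
    rw [← lie_skew, xPlus_special_lie_lie_eq_zero hi hN, neg_zero]
  induction hu with
  | gen p =>
    obtain ⟨k, r⟩ := p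
    have : k = i := by
      by_contra hk
      simpa [loopWt] using h k hk
    subst this
    exact .inl ⟨r, rfl, rfl⟩
  | lie hu hv h₁ h₂ =>
    have hnu := IsMonomial.loopWeight_nonneg hu
    have hnv := IsMonomial.loopWeight_nonneg hv
    simp only [Prod.fst_add, Pi.add_apply] at h
    right
    rcases h₁ (fun j hj => by linarith [h j hj, hnu j, hnv j]) with
      ⟨a, rfl, rfl⟩ | ⟨N, hN, rfl, t, rfl⟩ | rfl
    · rcases h₂ (fun j hj => by linarith [h j hj, hnu j, hnv j]) with
        ⟨b, rfl, rfl⟩ | ⟨N, hN, rfl, t, rfl⟩ | rfl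
      · rcases Nat.even_or_odd (a + b) with hab | hab
        · exact .inr (xPlus_special_lie_eq_zero hi hab)
        · left
          refine ⟨a + b, hab, ?_, ?_⟩
          · simp [loopWt, ← Pi.single_add]
          · rcases Nat.even_or_odd a with ha | ha
            · have hb : Odd b := by
                by_contra hb
                exact (Nat.not_even_iff_odd.2 hab) (ha.add (Nat.not_odd_iff_even.1 hb))
              refine ⟨-1, ?_⟩
              rw [← lie_skew, xPlus_special_lie_even hi ha, add_comm, neg_one_smul]
            · have hb : Even b := by
                by_contra hb
                exact (Nat.not_even_iff_odd.2 hab) (ha.add_odd (Nat.not_even_iff_odd.1 hb))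
              exact ⟨1, by rw [xPlus_special_lie_even hi hb, one_smul]⟩
      · right; rw [lie_smul, lie_y hN, smul_zero]
      · exact .inr (lie_zero _)
    · right
      rcases h₂ (fun j hj => by linarith [h j hj, hnu j, hnv j]) with
        ⟨b, rfl, rfl⟩ | ⟨M, hM, rfl, t', rfl⟩ | rfl
      · rw [smul_lie, xPlus_special_lie_lie_eq_zero hi hN, smul_zero]
      · rw [smul_lie, lie_smul, ← lie_skew, lie_lie, lie_y hN, lie_y hN]
        simp
      · exact lie_zero _
    · exact .inr (zero_lie _)

/-- The components of degree `m α_i + r δ` are at most one-dimensional, and nonzero only if `m = 1`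
and `d̃_i ∣ r`, or `i` is special, `m = 2` and `r` is odd. -/
theorem piece_of_multiple {γ : T.LoopWeight} (h : ∀ j ≠ i, γ.1 j = 0) :
    (∃ v, piece γ ≤ Submodule.span ℂ {v}) ∧ (piece γ = ⊥ ∨
      (∃ r, T.dTilde i ∣ r ∧ γ = loopWt (i, r)) ∨
      (T.IsSpecial i ∧ ∃ N : ℕ, Odd N ∧ γ = (Pi.single i 2, (N : ℤ)))) := by
  have inj : ∀ {r r'}, (loopWt (i, r) : T.LoopWeight) = loopWt (i, r') → r = r' := fun h => by
    simpa [loopWt] using h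
  by_cases h1 : ∃ r, γ = loopWt (i, r)
  · obtain ⟨r, rfl⟩ := h1
    have hle : piece (loopWt (i, r)) ≤ Submodule.span ℂ {T.xPlus (i, r)} := by
      refine Submodule.span_le.2 fun u hu => ?_
      by_cases hi : T.IsSpecial i
      · rcases IsMonomial.special_cases hi hu h with ⟨r', h', rfl⟩ | ⟨N, _, h', _⟩ | rfl
        · rw [inj h']; exact Submodule.mem_span_singleton_self _
        · have := congr_fun (congrArg Prod.fst h') i
          simp [loopWt] at this
        · exact zero_mem _
      · rcases IsMonomial.eq_xPlus_or_eq_zero hi hu h with ⟨r', h', rfl⟩ | rfl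
        · rw [inj h']; exact Submodule.mem_span_singleton_self _
        · exact zero_mem _
    refine ⟨⟨_, hle⟩, ?_⟩
    by_cases hr : T.dTilde i ∣ r
    · exact .inr (.inl ⟨r, hr, rfl⟩)
    · left
      rw [xPlus_eq_zero hr, Submodule.span_zero_singleton] at hle
      exact le_bot_iff.1 hle
  by_cases h2 : T.IsSpecial i ∧ ∃ N : ℕ, Odd N ∧ γ = (Pi.single i 2, (N : ℤ))
  · refine ⟨?_, .inr (.inr h2)⟩
    obtain ⟨hi, N, hN, rfl⟩ := h2
    refine ⟨⁅T.xPlus (i, N), T.xPlus (i, 0)⁆, Submodule.span_le.2 fun u hu => ?_⟩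
    rcases IsMonomial.special_cases hi hu h with ⟨r', h', rfl⟩ | ⟨N', _, h', t, rfl⟩ | rfl
    · exact absurd ⟨r', h'⟩ h1
    · obtain rfl : N = N' := by simpa using h'
      exact Submodule.smul_mem _ _ (Submodule.mem_span_singleton_self _)
    · exact zero_mem _
  · have hbot : piece γ = ⊥ := by
      refine le_bot_iff.1 (Submodule.span_le.2 fun u hu => ?_)
      by_cases hi : T.IsSpecial i
      · rcases IsMonomial.special_cases hi hu h with ⟨r', h', rfl⟩ | ⟨N, hN, h', _⟩ | rfl
        · exact absurd ⟨r', h'⟩ h1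
        · exact absurd ⟨hi, N, hN, h'⟩ h2
        · exact zero_mem _
      · rcases IsMonomial.eq_xPlus_or_eq_zero hi hu h with ⟨r', h', rfl⟩ | rfl
        · exact absurd ⟨r', h'⟩ h1
        · exact zero_mem _
    exact ⟨⟨0, by rw [hbot]; exact bot_le⟩, .inl hbot⟩

theorem piece_eq_bot_of_neg {γ : T.LoopWeight} {j : T.Vertex₀} (h : γ.1 j < 0) : piece γ = ⊥ :=
  le_bot_iff.1 (Submodule.span_le.2 fun _ hu =>
    absurd (IsMonomial.loopWeight_nonneg hu j) (not_le.2 h))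

end AffineType

/-! ### The affine Dynkin diagrams -/

-- Sums over a neighbourhood of a vertex, which has at most three neighbours.

theorem sum_range_eq_two {M : Type} [AddCommMonoid M] {N i a : ℕ} (f : ℕ → M)
    (hi : i < N) (ha : a < N) (hia : i ≠ a)
    (h : ∀ j < N, j ≠ i → j ≠ a → f j = 0) :
    ∑ j ∈ Finset.range N, f j = f i + f a := by
  rw [← Finset.sum_subset (s₁ := {i, a}), Finset.sum_pair hia]
  · intro x; simp; lia
  · intro x hx hx'
    simp at hx hx'
    exact h x hx hx'.1 hx'.2

theorem sum_range_eq_three {M : Type} [AddCommMonoid M] {N i a b : ℕ} (f : ℕ → M)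
    (hi : i < N) (ha : a < N) (hb : b < N) (hia : i ≠ a) (hib : i ≠ b) (hab : a ≠ b)
    (h : ∀ j < N, j ≠ i → j ≠ a → j ≠ b → f j = 0) :
    ∑ j ∈ Finset.range N, f j = f i + f a + f b := by
  rw [← Finset.sum_subset (s₁ := {i, a, b}), Finset.sum_insert (by simp [hia, hib]),
    Finset.sum_pair hab, add_assoc]
  · intro x; simp; lia
  · intro x hx hx'
    simp at hx hx'
    exact h x hx hx'.1 hx'.2.1 hx'.2.2

theorem sum_range_eq_four {M : Type} [AddCommMonoid M] {N i a b c : ℕ} (f : ℕ → M)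
    (hi : i < N) (ha : a < N) (hb : b < N) (hc : c < N) (hia : i ≠ a) (hib : i ≠ b) (hic : i ≠ c)
    (hab : a ≠ b) (hac : a ≠ c) (hbc : b ≠ c)
    (h : ∀ j < N, j ≠ i → j ≠ a → j ≠ b → j ≠ c → f j = 0) :
    ∑ j ∈ Finset.range N, f j = f i + f a + f b + f c := by
  rw [← Finset.sum_subset (s₁ := {i, a, b, c}), Finset.sum_insert (by simp [hia, hib, hic]),
    Finset.sum_insert (by simp [hab, hac]), Finset.sum_pair hbc, ← add_assoc, ← add_assoc]
  · intro x; simp; lia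
  · intro x hx hx'
    simp at hx hx'
    exact h x hx hx'.1 hx'.2.1 hx'.2.2.1 hx'.2.2.2

namespace AffineType

variable (T : AffineType)

open Classical in
/-- The symmetrized Cartan matrix `(α_i | α_j) = d_i a_ij`, outside type `A_1^(1)`, with natural
numbers as indices. -/
def gramEntry (i j : ℕ) : ℤ :=
  if i = j then 2 * T.symmetrizer i
  else if T.Edge i j ∨ T.Edge j i then -(max (T.symmetrizer i) (T.symmetrizer j) : ℕ) else 0

set_option maxHeartbeats 1000000 in
/-- `δ` is in the radical of the form, by inspection of the neighbours of each vertex. -/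
theorem gram_row_sum (h1 : ¬ (T.order = 1 ∧ T.rank = 1)) (i : ℕ) (hi : i ≤ T.rank) :
    ∑ j ∈ Finset.range (T.rank + 1), T.gramEntry i j * T.mark j = 0 := by
  cases T with
  | A n hn =>
    simp only [rank] at *
    have hn' : 2 ≤ n := by simp [order] at h1; lia
    by_cases h : i = 0
    · rw [sum_range_eq_three (i := i) (a := 1) (b := n)] <;>
          grind [gramEntry, Edge, symmetrizer, mark]
    by_cases h : i = n
    · rw [sum_range_eq_three (i := i) (a := i - 1) (b := 0)] <;>
          grind [gramEntry, Edge, symmetrizer, mark]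
    rw [sum_range_eq_three (i := i) (a := i - 1) (b := i + 1)] <;>
          grind [gramEntry, Edge, symmetrizer, mark]
  | B n hn =>
    simp only [rank] at *
    by_cases h : i = 0
    · rw [sum_range_eq_two (i := i) (a := 2)] <;>
          grind [gramEntry, Edge, symmetrizer, mark]
    by_cases h : i = 1
    · rw [sum_range_eq_two (i := i) (a := 2)] <;>
          grind [gramEntry, Edge, symmetrizer, mark]
    by_cases h : i = n
    · rw [sum_range_eq_two (i := i) (a := i - 1)] <;>
          grind [gramEntry, Edge, symmetrizer, mark]
    by_cases h : i = 2
    · rw [sum_range_eq_four (i := i) (a := 0) (b := 1) (c := 3)] <;>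
          grind [gramEntry, Edge, symmetrizer, mark]
    rw [sum_range_eq_three (i := i) (a := i - 1) (b := i + 1)] <;>
          grind [gramEntry, Edge, symmetrizer, mark]
  | C n hn =>
    simp only [rank] at *
    by_cases h : i = 0
    · rw [sum_range_eq_two (i := i) (a := 1)] <;>
          grind [gramEntry, Edge, symmetrizer, mark]
    by_cases h : i = n
    · rw [sum_range_eq_two (i := i) (a := i - 1)] <;>
          grind [gramEntry, Edge, symmetrizer, mark]
    rw [sum_range_eq_three (i := i) (a := i - 1) (b := i + 1)] <;>
          grind [gramEntry, Edge, symmetrizer, mark]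
  | D n hn =>
    simp only [rank] at *
    by_cases h4 : n = 4
    · subst h4
      interval_cases i <;> simp [Finset.sum_range_succ, gramEntry, Edge, symmetrizer, mark]
    by_cases h : i = 0
    · rw [sum_range_eq_two (i := i) (a := 2)] <;>
          grind [gramEntry, Edge, symmetrizer, mark]
    by_cases h : i = 1
    · rw [sum_range_eq_two (i := i) (a := 2)] <;>
          grind [gramEntry, Edge, symmetrizer, mark]
    by_cases h : i = n
    · rw [sum_range_eq_two (i := i) (a := n - 2)] <;>
          grind [gramEntry, Edge, symmetrizer, mark]
    by_cases h : i + 1 = n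
    · rw [sum_range_eq_two (i := i) (a := n - 2)] <;>
          grind [gramEntry, Edge, symmetrizer, mark]
    by_cases h : i = 2
    · rw [sum_range_eq_four (i := i) (a := 0) (b := 1) (c := 3)] <;>
          grind [gramEntry, Edge, symmetrizer, mark]
    by_cases h : i + 2 = n
    · rw [sum_range_eq_four (i := i) (a := i - 1) (b := n - 1) (c := n)] <;>
          grind [gramEntry, Edge, symmetrizer, mark]
    rw [sum_range_eq_three (i := i) (a := i - 1) (b := i + 1)] <;>
          grind [gramEntry, Edge, symmetrizer, mark]
  | E6 =>
    simp only [rank] at *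
    interval_cases i <;> simp [Finset.sum_range_succ, gramEntry, Edge, symmetrizer, mark]
  | E7 =>
    simp only [rank] at *
    interval_cases i <;> simp [Finset.sum_range_succ, gramEntry, Edge, symmetrizer, mark]
  | E8 =>
    simp only [rank] at *
    interval_cases i <;> simp [Finset.sum_range_succ, gramEntry, Edge, symmetrizer, mark]
  | F4 =>
    simp only [rank] at *
    interval_cases i <;> simp [Finset.sum_range_succ, gramEntry, Edge, symmetrizer, mark]
  | G2 =>
    simp only [rank] at *
    interval_cases i <;> simp [Finset.sum_range_succ, gramEntry, Edge, symmetrizer, mark]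
  | twistedAEven n hn =>
    simp only [rank] at *
    by_cases h : i = 0
    · rw [sum_range_eq_two (i := i) (a := 1)] <;>
          grind [gramEntry, Edge, symmetrizer, mark]
    by_cases h : i = n
    · rw [sum_range_eq_two (i := i) (a := i - 1)] <;>
          grind [gramEntry, Edge, symmetrizer, mark]
    rw [sum_range_eq_three (i := i) (a := i - 1) (b := i + 1)] <;>
          grind [gramEntry, Edge, symmetrizer, mark]
  | twistedAOdd n hn =>
    simp only [rank] at *
    by_cases h : i = 0
    · rw [sum_range_eq_two (i := i) (a := 2)] <;>
          grind [gramEntry, Edge, symmetrizer, mark]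
    by_cases h : i = 1
    · rw [sum_range_eq_two (i := i) (a := 2)] <;>
          grind [gramEntry, Edge, symmetrizer, mark]
    by_cases h : i = n
    · rw [sum_range_eq_two (i := i) (a := i - 1)] <;>
          grind [gramEntry, Edge, symmetrizer, mark]
    by_cases h : i = 2
    · rw [sum_range_eq_four (i := i) (a := 0) (b := 1) (c := 3)] <;>
          grind [gramEntry, Edge, symmetrizer, mark]
    rw [sum_range_eq_three (i := i) (a := i - 1) (b := i + 1)] <;>
          grind [gramEntry, Edge, symmetrizer, mark]
  | twistedD n hn =>
    simp only [rank] at *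
    by_cases h : i = 0
    · rw [sum_range_eq_two (i := i) (a := 1)] <;>
          grind [gramEntry, Edge, symmetrizer, mark]
    by_cases h : i = n
    · rw [sum_range_eq_two (i := i) (a := i - 1)] <;>
          grind [gramEntry, Edge, symmetrizer, mark]
    rw [sum_range_eq_three (i := i) (a := i - 1) (b := i + 1)] <;>
          grind [gramEntry, Edge, symmetrizer, mark]
  | twistedE6 =>
    simp only [rank] at *
    interval_cases i <;> simp [Finset.sum_range_succ, gramEntry, Edge, symmetrizer, mark]
  | twistedD4 =>
    simp only [rank] at *
    interval_cases i <;> simp [Finset.sum_range_succ, gramEntry, Edge, symmetrizer, mark]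

/-- The affine Dynkin diagram is connected. -/
theorem edge_connected (P : ℕ → Prop) (h0 : P 0)
    (h : ∀ i j, i ≤ T.rank → j ≤ T.rank → T.Edge i j → (P i ↔ P j)) : ∀ i ≤ T.rank, P i := by
  cases T with
  | A n hn | C n hn | F4 | G2 | twistedAEven n hn | twistedD n hn | twistedE6 | twistedD4 =>
    simp only [rank] at *
    intro i
    induction i with
    | zero => exact fun _ => h0
    | succ i ih => exact fun hi => (h i (i + 1) (by lia) hi (by simp [Edge])).1 (ih (by lia))
  | B n hn | twistedAOdd n hn =>
    simp only [rank] at *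
    have h2 : P 2 := (h 0 2 (by lia) (by lia) (by simp [Edge])).1 h0
    have h1 : P 1 := (h 1 2 (by lia) (by lia) (by simp [Edge])).2 h2
    intro i
    induction i with
    | zero => exact fun _ => h0
    | succ i ih =>
      intro hi
      rcases Nat.eq_zero_or_pos i with rfl | hi0
      · exact h1
      · exact (h i (i + 1) (by lia) hi (.inl ⟨hi0, rfl⟩)).1 (ih (by lia))
  | D n hn =>
    simp only [rank] at *
    have h2 : P 2 := (h 0 2 (by lia) (by lia) (by simp [Edge])).1 h0
    have h1 : P 1 := (h 1 2 (by lia) (by lia) (by simp [Edge]; lia)).2 h2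
    have key : ∀ i < n, P i := by
      intro i
      induction i with
      | zero => exact fun _ => h0
      | succ i ih =>
        intro hi
        rcases Nat.eq_zero_or_pos i with rfl | hi0
        · exact h1
        · exact (h i (i + 1) (by lia) (by lia) (.inl ⟨hi0, rfl, hi⟩)).1 (ih (by lia))
    intro i hi
    rcases hi.eq_or_lt with rfl | hi
    · exact (h (i - 2) i (by lia) le_rfl (.inr (.inr ⟨by lia, rfl⟩))).1 (key _ (by lia))
    · exact key i hi
  | E6 =>
    simp only [rank] at *
    have h2 := (h 0 2 (by lia) (by lia) (by simp [Edge])).1 h0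
    have h4 := (h 2 4 (by lia) (by lia) (by simp [Edge])).1 h2
    have h3 := (h 3 4 (by lia) (by lia) (by simp [Edge])).2 h4
    have h1 := (h 1 3 (by lia) (by lia) (by simp [Edge])).2 h3
    have h5 := (h 4 5 (by lia) (by lia) (by simp [Edge])).1 h4
    have h6 := (h 5 6 (by lia) (by lia) (by simp [Edge])).1 h5
    intro i hi
    interval_cases i <;> assumption
  | E7 =>
    simp only [rank] at *
    have h1 := (h 0 1 (by lia) (by lia) (by simp [Edge])).1 h0
    have h3 := (h 1 3 (by lia) (by lia) (by simp [Edge])).1 h1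
    have h4 := (h 3 4 (by lia) (by lia) (by simp [Edge])).1 h3
    have h5 := (h 4 5 (by lia) (by lia) (by simp [Edge])).1 h4
    have h6 := (h 5 6 (by lia) (by lia) (by simp [Edge])).1 h5
    have h7 := (h 6 7 (by lia) (by lia) (by simp [Edge])).1 h6
    have h2 := (h 2 4 (by lia) (by lia) (by simp [Edge])).2 h4
    intro i hi
    interval_cases i <;> assumption
  | E8 =>
    simp only [rank] at *
    have h8 := (h 0 8 (by lia) (by lia) (by simp [Edge])).1 h0
    have h7 := (h 7 8 (by lia) (by lia) (by simp [Edge])).2 h8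
    have h6 := (h 6 7 (by lia) (by lia) (by simp [Edge])).2 h7
    have h5 := (h 5 6 (by lia) (by lia) (by simp [Edge])).2 h6
    have h4 := (h 4 5 (by lia) (by lia) (by simp [Edge])).2 h5
    have h3 := (h 3 4 (by lia) (by lia) (by simp [Edge])).2 h4
    have h1 := (h 1 3 (by lia) (by lia) (by simp [Edge])).2 h3
    have h2 := (h 2 4 (by lia) (by lia) (by simp [Edge])).2 h4
    intro i hi
    interval_cases i <;> assumption

end AffineType

/-! ### Propagation along the edges of the diagram -/

theorem nat_chain_up {P : ℕ → Prop} {a b : ℕ} (h : ∀ i, a ≤ i → i < b → P i → P (i + 1)) {i₀ : ℕ}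
    (h₀ : P i₀) (ha : a ≤ i₀) {i : ℕ} (hi : i₀ ≤ i) (hb : i ≤ b) : P i := by
  induction i, hi using Nat.le_induction with
  | base => exact h₀
  | succ i hi ih => exact h i (by lia) (by lia) (ih (by lia))

theorem nat_chain_down {P : ℕ → Prop} {a b : ℕ} (h : ∀ i, a ≤ i → i < b → P (i + 1) → P i)
    {i₀ : ℕ} (h₀ : P i₀) (hb : i₀ ≤ b) {i : ℕ} (hi : i ≤ i₀) (ha : a ≤ i) : P i := by
  induction hi using Nat.decreasingInduction with
  | of_succ k hk ih => exact h k ha (by lia) (ih (by lia))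
  | self => exact h₀

namespace AffineType

variable (T : AffineType)

/-- The directed connectivity of the diagram on `I₀` along which the roots `α_i + r δ` are
propagated: from long to short roots in the untwisted types, from short to long ones otherwise. The
starting point has the length of `α_0`, or half of it in type `A_{2n}^(2)`. -/
theorem edge_propagate (P : ℕ → Prop)
    (h : ∀ i j, 1 ≤ i → i ≤ T.rank → 1 ≤ j → j ≤ T.rank → T.Edge i j ∨ T.Edge j i →
      (T.order = 1 → T.symmetrizer j ≤ T.symmetrizer i) →
      (T.order ≠ 1 → T.symmetrizer i ≤ T.symmetrizer j) → P i → P j)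
    {i₀ : ℕ} (h1 : 1 ≤ i₀) (hn : i₀ ≤ T.rank) (h₀ : P i₀)
    (hd : T.symmetrizer i₀ = T.symmetrizer 0 ∨ T.IsTwistedAEven ∧ T.symmetrizer i₀ = 1) :
    ∀ i, 1 ≤ i → i ≤ T.rank → P i := by
  cases T with
  | A n hn' | B n hn' | twistedAOdd n hn' =>
    simp only [rank] at *
    simp only [IsTwistedAEven, false_and, or_false, symmetrizer] at hd
    intro i hi hi'
    have up : ∀ i, 1 ≤ i → i < n → P i → P (i + 1) := fun i hi hi' hp =>
      h i (i + 1) hi (by lia) (by lia) (by lia) (by simp [Edge, hi])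
        (by clear h; grind [order, symmetrizer]) (by clear h; grind [order, symmetrizer]) hp
    have down : ∀ i, 1 ≤ i → i < i₀ → P (i + 1) → P i := fun i hi hi' hp =>
      h (i + 1) i (by lia) (by lia) hi (by lia) (by simp [Edge, hi])
        (by clear h; grind [order, symmetrizer]) (by clear h; grind [order, symmetrizer]) hp
    rcases le_total i₀ i with h' | h'
    · exact nat_chain_up up h₀ h1 h' hi'
    · exact nat_chain_down down h₀ le_rfl h' hi
  | C n hn' | twistedAEven n hn' | twistedD n hn' =>
    simp only [rank] at *
    intro i hi hi'
    have hi₀ : i₀ = n := by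
      simp [symmetrizer, IsTwistedAEven] at hd
      clear h
      grind
    subst hi₀
    have down : ∀ i, 1 ≤ i → i < i₀ → P (i + 1) → P i := fun i hi hi' hp =>
      h (i + 1) i (by lia) (by lia) hi (by lia) (by simp [Edge])
        (by clear h; grind [order, symmetrizer]) (by clear h; grind [order, symmetrizer]) hp
    exact nat_chain_down down h₀ le_rfl hi' hi
  | D n hn' =>
    simp only [rank] at *
    have step : ∀ i j, 1 ≤ i → i ≤ n → 1 ≤ j → j ≤ n → (D n hn').Edge i j → (P i ↔ P j) :=
      fun i j hi hi' hj hj' he =>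
        ⟨h i j hi hi' hj hj' (.inl he) (fun _ => le_rfl) (fun _ => le_rfl),
          h j i hj hj' hi hi' (.inr he) (fun _ => le_rfl) (fun _ => le_rfl)⟩
    have key : ∀ i, 1 ≤ i → i < n → (P i ↔ P 1) := by
      intro i hi
      induction i, hi using Nat.le_induction with
      | base => simp
      | succ i hi ih =>
        intro hi'
        rw [← ih (by lia)]
        exact (step i (i + 1) hi (by lia) (by lia) (by lia) (.inl ⟨hi, rfl, hi'⟩)).symm
    have key' : ∀ i, 1 ≤ i → i ≤ n → (P i ↔ P 1) := by
      intro i hi hi'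
      rcases hi'.eq_or_lt with rfl | hi'
      · rw [← step (i - 2) i (by lia) (by lia) hi le_rfl (.inr (.inr ⟨by lia, rfl⟩))]
        exact key _ (by lia) (by lia)
      · exact key i hi hi'
    exact fun i hi hi' => (key' i hi hi').2 ((key' i₀ h1 hn).1 h₀)
  | E6 =>
    simp only [rank] at *
    have step : ∀ i j, 1 ≤ i → i ≤ 6 → 1 ≤ j → j ≤ 6 → E6.Edge i j → (P i ↔ P j) :=
      fun i j hi hi' hj hj' he =>
        ⟨h i j hi hi' hj hj' (.inl he) (fun _ => le_rfl) (fun _ => le_rfl),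
          h j i hj hj' hi hi' (.inr he) (fun _ => le_rfl) (fun _ => le_rfl)⟩
    have e3 := step 3 4 (by lia) (by lia) (by lia) (by lia) (by simp [Edge])
    have e1 := (step 1 3 (by lia) (by lia) (by lia) (by lia) (by simp [Edge])).trans e3
    have e2 := step 2 4 (by lia) (by lia) (by lia) (by lia) (by simp [Edge])
    have e5 := (step 4 5 (by lia) (by lia) (by lia) (by lia) (by simp [Edge])).symm
    have e6 := (step 5 6 (by lia) (by lia) (by lia) (by lia) (by simp [Edge])).symm.trans e5
    have key : ∀ i, 1 ≤ i → i ≤ 6 → (P i ↔ P 4) := by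
      intro i hi hi'
      interval_cases i <;> first | assumption | rfl
    exact fun i hi hi' => (key i hi hi').2 ((key i₀ h1 hn).1 h₀)
  | E7 =>
    simp only [rank] at *
    have step : ∀ i j, 1 ≤ i → i ≤ 7 → 1 ≤ j → j ≤ 7 → E7.Edge i j → (P i ↔ P j) :=
      fun i j hi hi' hj hj' he =>
        ⟨h i j hi hi' hj hj' (.inl he) (fun _ => le_rfl) (fun _ => le_rfl),
          h j i hj hj' hi hi' (.inr he) (fun _ => le_rfl) (fun _ => le_rfl)⟩
    have e3 := step 3 4 (by lia) (by lia) (by lia) (by lia) (by simp [Edge])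
    have e1 := (step 1 3 (by lia) (by lia) (by lia) (by lia) (by simp [Edge])).trans e3
    have e2 := step 2 4 (by lia) (by lia) (by lia) (by lia) (by simp [Edge])
    have e5 := (step 4 5 (by lia) (by lia) (by lia) (by lia) (by simp [Edge])).symm
    have e6 := (step 5 6 (by lia) (by lia) (by lia) (by lia) (by simp [Edge])).symm.trans e5
    have e7 := (step 6 7 (by lia) (by lia) (by lia) (by lia) (by simp [Edge])).symm.trans e6
    have key : ∀ i, 1 ≤ i → i ≤ 7 → (P i ↔ P 4) := by
      intro i hi hi'
      interval_cases i <;> first | assumption | rfl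
    exact fun i hi hi' => (key i hi hi').2 ((key i₀ h1 hn).1 h₀)
  | E8 =>
    simp only [rank] at *
    have step : ∀ i j, 1 ≤ i → i ≤ 8 → 1 ≤ j → j ≤ 8 → E8.Edge i j → (P i ↔ P j) :=
      fun i j hi hi' hj hj' he =>
        ⟨h i j hi hi' hj hj' (.inl he) (fun _ => le_rfl) (fun _ => le_rfl),
          h j i hj hj' hi hi' (.inr he) (fun _ => le_rfl) (fun _ => le_rfl)⟩
    have e3 := step 3 4 (by lia) (by lia) (by lia) (by lia) (by simp [Edge])
    have e1 := (step 1 3 (by lia) (by lia) (by lia) (by lia) (by simp [Edge])).trans e3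
    have e2 := step 2 4 (by lia) (by lia) (by lia) (by lia) (by simp [Edge])
    have e5 := (step 4 5 (by lia) (by lia) (by lia) (by lia) (by simp [Edge])).symm
    have e6 := (step 5 6 (by lia) (by lia) (by lia) (by lia) (by simp [Edge])).symm.trans e5
    have e7 := (step 6 7 (by lia) (by lia) (by lia) (by lia) (by simp [Edge])).symm.trans e6
    have e8 := (step 7 8 (by lia) (by lia) (by lia) (by lia) (by simp [Edge])).symm.trans e7
    have key : ∀ i, 1 ≤ i → i ≤ 8 → (P i ↔ P 4) := by
      intro i hi hi'
      interval_cases i <;> first | assumption | rfl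
    exact fun i hi hi' => (key i hi hi').2 ((key i₀ h1 hn).1 h₀)
  | F4 | twistedE6 =>
    simp only [rank] at *
    have up : ∀ i, 1 ≤ i → i < 4 → P i → P (i + 1) := fun i hi hi' hp =>
      h i (i + 1) hi (by lia) (by lia) hi' (by simp [Edge])
        (by clear h; grind [order, symmetrizer]) (by clear h; grind [order, symmetrizer]) hp
    have one : P 1 := by
      have : i₀ = 1 ∨ i₀ = 2 := by
        simp [symmetrizer, IsTwistedAEven] at hd
        clear h
        grind
      rcases this with rfl | rfl
      · exact h₀
      · refine h 2 1 (by lia) (by lia) (by lia) (by lia) (by simp [Edge]) ?_ ?_ h₀ <;>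
          simp [symmetrizer, IsTwistedAEven, order] at hd ⊢
    intro i hi hi'
    exact nat_chain_up up one le_rfl hi hi'
  | G2 | twistedD4 =>
    simp only [rank] at *
    have up : ∀ i, 1 ≤ i → i < 2 → P i → P (i + 1) := fun i hi hi' hp =>
      h i (i + 1) hi (by lia) (by lia) hi' (by simp [Edge])
        (by clear h; grind [order, symmetrizer]) (by clear h; grind [order, symmetrizer]) hp
    have one : P 1 := by
      have : i₀ = 1 ∨ i₀ = 2 := by
        simp [symmetrizer, IsTwistedAEven] at hd
        clear h
        grind
      rcases this with rfl | rfl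
      · exact h₀
      · refine h 2 1 (by lia) (by lia) (by lia) (by lia) (by simp [Edge]) ?_ ?_ h₀ <;>
          simp [symmetrizer, IsTwistedAEven] at hd ⊢
    intro i hi hi'
    exact nat_chain_up up one le_rfl hi hi'

/-- The numbers `d_i m_i / d_0`, for `m_i` the coefficients of `δ`, are integers outside type
`A_{2n}^(2)`. -/
theorem symmetrizer_zero_dvd (h : ¬ T.IsTwistedAEven) (i : ℕ) (hi : i ≤ T.rank) :
    T.symmetrizer 0 ∣ T.symmetrizer i * T.mark i := by
  cases T with
  | A n hn | B n hn | C n hn | D n hn | twistedAOdd n hn | twistedD n hn =>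
    simp only [symmetrizer, mark]
    (try split_ifs) <;> first | (norm_num; done) | lia
  | twistedAEven n hn => simp [IsTwistedAEven] at h
  | E6 | E7 | E8 | F4 | G2 | twistedE6 | twistedD4 =>
    simp only [rank] at hi
    interval_cases i <;> simp [symmetrizer, mark]

theorem mark_zero : T.mark 0 = 1 := by
  cases T <;> simp [mark]

theorem mark_pos (i : ℕ) (hi : i ≤ T.rank) : 0 < T.mark i := by
  cases T with
  | A n hn | B n hn | C n hn | D n hn | twistedAEven n hn | twistedAOdd n hn | twistedD n hn =>
    simp only [mark]; (try split_ifs) <;> norm_num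
  | E6 | E7 | E8 | F4 | G2 | twistedE6 | twistedD4 =>
    simp only [rank] at hi
    interval_cases i <;> simp [mark]

theorem mark_of_isTwistedAEven (h : T.IsTwistedAEven) {i : ℕ} (hi : i ≠ 0) : T.mark i = 2 := by
  cases T <;> simp [IsTwistedAEven] at h
  simp [mark, hi]

theorem symmetrizer_zero_of_isTwistedAEven (h : T.IsTwistedAEven) : T.symmetrizer 0 = 4 := by
  cases T <;> simp [IsTwistedAEven] at h
  rfl

theorem symmetrizer_of_rank_one (h : T.order = 1 ∧ T.rank = 1) (i : ℕ) : T.symmetrizer i = 1 := by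
  cases T <;> simp [order, rank, symmetrizer] at h ⊢ <;> lia

theorem mark_of_rank_one (h : T.order = 1 ∧ T.rank = 1) (i : ℕ) : T.mark i = 1 := by
  cases T <;> simp [order, rank, mark] at h ⊢ <;> grind

theorem edge_of_rank_one (h : T.order = 1 ∧ T.rank = 1) : T.Edge 0 1 := by
  cases T <;> simp [order, rank, Edge] at h ⊢ <;> lia

end AffineType

/-! ### The invariant form on the root lattice -/

namespace AffineType

variable (T : AffineType)

theorem symmetrizer_mul_cartan (h1 : ¬ (T.order = 1 ∧ T.rank = 1)) (i j : T.Vertex) :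
    T.symmetrizer i * T.cartan i j = T.gramEntry i j := by
  rw [cartan, gramEntry]
  by_cases hij : i = j
  · simp [hij, mul_comm]
  · rw [if_neg hij, if_neg (fun h => hij (Fin.ext h))]
    split_ifs
    · have hd : T.symmetrizer i ∣ max (T.symmetrizer i) (T.symmetrizer j) := by
        rcases T.symmetrizer_dvd i j with h | h
        · rwa [max_eq_right (Nat.le_of_dvd (T.symmetrizer_pos _) h)]
        · rw [max_eq_left (Nat.le_of_dvd (T.symmetrizer_pos _) h)]
      rw [mul_neg, ← Nat.cast_mul, Nat.mul_div_cancel' hd]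
    · simp

theorem symmetrizer_mul_cartan_comm (i j : T.Vertex) :
    T.symmetrizer i * T.cartan i j = T.symmetrizer j * T.cartan j i := by
  by_cases h1 : T.order = 1 ∧ T.rank = 1
  · rw [symmetrizer_of_rank_one T h1, symmetrizer_of_rank_one T h1, cartan, cartan]
    by_cases hij : i = j
    · rw [hij]
    · rw [if_neg hij, if_neg (Ne.symm hij)]
      by_cases he : T.Edge i j ∨ T.Edge j i
      · rw [if_pos he, if_pos he.symm, if_pos h1, if_pos h1]
      · rw [if_neg he, if_neg fun h => he h.symm]
  · rw [symmetrizer_mul_cartan T h1, symmetrizer_mul_cartan T h1, gramEntry, gramEntry]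
    by_cases hij : i = j
    · rw [hij]
    · rw [if_neg (fun h => hij (Fin.ext h)), if_neg (fun h => hij (Fin.ext h).symm), max_comm]
      by_cases he : T.Edge i j ∨ T.Edge j i
      · rw [if_pos he, if_pos he.symm]
      · rw [if_neg he, if_neg fun h => he h.symm]

theorem cartan_neg_of_edge {i j : T.Vertex} (hij : i ≠ j) (h : T.Edge i j ∨ T.Edge j i) :
    T.cartan i j < 0 := by
  rw [cartan, if_neg hij, if_pos h]
  split_ifs
  · norm_num
  · have : 0 < max (T.symmetrizer i) (T.symmetrizer j) / T.symmetrizer i :=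
      Nat.div_pos (le_max_left _ _) (T.symmetrizer_pos _)
    lia

theorem edge_ne {i j : ℕ} (h : T.Edge i j) : i ≠ j := by
  cases T <;> simp [Edge] at h <;> lia

/-- The coefficients of `δ` are in the kernel of the Cartan matrix. -/
theorem cartan_row_sum (i : T.Vertex) : ∑ j : T.Vertex, T.cartan i j * T.mark j = 0 := by
  by_cases h1 : T.order = 1 ∧ T.rank = 1
  · have hm := mark_of_rank_one T h1
    have key : ∀ j : T.Vertex, j ≠ i → T.cartan i j = -2 := fun j hj => by
      rw [cartan, if_neg hj.symm, if_pos, if_pos h1]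
      have hE := edge_of_rank_one T h1
      have hi := i.2
      have hj' := j.2
      have : (j : ℕ) ≠ i := fun h => hj (Fin.ext h)
      have hr := h1.2
      rcases Nat.eq_zero_or_pos (i : ℕ) with h0 | h0
      · left; rw [h0, show (j : ℕ) = 1 by lia]; exact hE
      · right; rw [show (i : ℕ) = 1 by lia, show (j : ℕ) = 0 by lia]; exact hE
    rw [← Finset.add_sum_erase _ _ (Finset.mem_univ i),
      Finset.sum_congr rfl (g := fun _ => (-2 : ℤ)) (fun j hj => by
        rw [key j (Finset.ne_of_mem_erase hj), hm]; rfl)]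
    simp [hm, cartan_self, Finset.card_erase_of_mem, h1.2]
  · have hpos : (T.symmetrizer i : ℤ) ≠ 0 := by exact_mod_cast (T.symmetrizer_pos i).ne'
    apply (mul_eq_zero.1 _).resolve_left hpos
    rw [Finset.mul_sum]
    simp only [← mul_assoc, symmetrizer_mul_cartan T h1]
    rw [Fin.sum_univ_eq_sum_range (fun j => T.gramEntry i j * (T.mark j : ℤ))]
    exact T.gram_row_sum h1 i (by have := i.2; lia)

theorem simpleCoroot_apply (i : T.Vertex) (x : T.RootLattice) :
    T.simpleCoroot i x = ∑ j, T.cartan i j * x j := by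
  simp [simpleCoroot, Fintype.linearCombination_apply, mul_comm]

theorem simpleCoroot_δ (i : T.Vertex) : T.simpleCoroot i T.δ = 0 := by
  rw [simpleCoroot_apply]
  exact T.cartan_row_sum i

theorem simpleReflection_apply (i : T.Vertex) (x : T.RootLattice) :
    T.simpleReflection i x = x - T.simpleCoroot i x • T.simpleRoot i := by
  simp [simpleReflection, Module.reflection_apply]

/-- The Weyl-invariant form on the root lattice, `(α_i | α_j) = d_i a_ij`. -/
def form (x y : T.RootLattice) : ℤ := ∑ i : T.Vertex, T.symmetrizer i * x i * T.simpleCoroot i y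

theorem form_eq (x y : T.RootLattice) :
    T.form x y = ∑ i : T.Vertex, ∑ j : T.Vertex, (T.symmetrizer i * T.cartan i j) * x i * y j := by
  simp only [form, simpleCoroot_apply, Finset.mul_sum]
  refine Finset.sum_congr rfl fun i _ => Finset.sum_congr rfl fun j _ => ?_
  ring

theorem form_comm (x y : T.RootLattice) : T.form x y = T.form y x := by
  rw [form_eq, form_eq, Finset.sum_comm]
  refine Finset.sum_congr rfl fun i _ => Finset.sum_congr rfl fun j _ => ?_
  rw [T.symmetrizer_mul_cartan_comm j i]
  ring

theorem form_add_right (x y z : T.RootLattice) : T.form x (y + z) = T.form x y + T.form x z := by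
  simp [form, mul_add, Finset.sum_add_distrib]

theorem form_smul_right (x : T.RootLattice) (n : ℤ) (y : T.RootLattice) :
    T.form x (n • y) = n * T.form x y := by
  simp only [form, map_smul, smul_eq_mul, Finset.mul_sum]
  refine Finset.sum_congr rfl fun i _ => ?_
  ring

theorem form_add_left (x y z : T.RootLattice) : T.form (x + y) z = T.form x z + T.form y z := by
  rw [form_comm, form_add_right, form_comm T z x, form_comm T z y]

theorem form_smul_left (n : ℤ) (x y : T.RootLattice) : T.form (n • x) y = n * T.form x y := by
  rw [form_comm, form_smul_right, form_comm T y x]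

theorem form_simpleRoot_left (i : T.Vertex) (x : T.RootLattice) :
    T.form (T.simpleRoot i) x = T.symmetrizer i * T.simpleCoroot i x := by
  simp [form, simpleRoot, Pi.single_apply]

theorem form_simpleRoot_self (i : T.Vertex) :
    T.form (T.simpleRoot i) (T.simpleRoot i) = 2 * T.symmetrizer i := by
  rw [form_simpleRoot_left, simpleCoroot_simpleRoot_self, mul_comm]

theorem form_δ_right (x : T.RootLattice) : T.form x T.δ = 0 := by
  simp [form, simpleCoroot_δ]

theorem form_simpleReflection (i : T.Vertex) (x y : T.RootLattice) :
    T.form (T.simpleReflection i x) (T.simpleReflection i y) = T.form x y := by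
  simp only [simpleReflection_apply, sub_eq_add_neg, ← neg_smul, form_add_left, form_add_right,
    form_smul_left, form_smul_right, form_simpleRoot_left, simpleCoroot_simpleRoot_self,
    form_comm T x (T.simpleRoot i)]
  ring

/-- The form is positive definite on the sublattice `Q₀`. -/
theorem form_self_pos {x : T.RootLattice} (h0 : x 0 = 0) (hx : x ≠ 0) : 0 < T.form x x := by
  -- in the coordinates `y_i = x_i / m_i`, where `δ = ∑ m_i α_i`, the matrix `C` of the form has
  -- vanishing row sums
  set C : T.Vertex → T.Vertex → ℚ := fun i j =>
    (T.symmetrizer i * T.cartan i j : ℤ) * T.mark i * T.mark j with hC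
  have hm : ∀ i : T.Vertex, (T.mark i : ℚ) ≠ 0 := fun i => by
    exact_mod_cast (T.mark_pos i (by have := i.2; lia)).ne'
  set y : T.Vertex → ℚ := fun i => x i / T.mark i with hy
  have hCsymm : ∀ i j, C i j = C j i := fun i j => by
    simp only [hC, T.symmetrizer_mul_cartan_comm i j]
    ring
  have hCrow : ∀ i, ∑ j, C i j = 0 := fun i => by
    have := congrArg (fun z : ℤ => (T.symmetrizer i * T.mark i : ℚ) * z) (T.cartan_row_sum i)
    simp only [Int.cast_zero, mul_zero] at this
    rw [← this]
    push_cast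
    rw [Finset.mul_sum]
    refine Finset.sum_congr rfl fun j _ => ?_
    simp only [hC]
    push_cast
    ring
  have hform : (T.form x x : ℚ) = ∑ i, ∑ j, C i j * y i * y j := by
    rw [form_eq]
    push_cast
    refine Finset.sum_congr rfl fun i _ => Finset.sum_congr rfl fun j _ => ?_
    simp only [hC, hy]
    push_cast
    field_simp [hm i, hm j]
  -- hence the form is a sum of squares
  have hsq : (2 * T.form x x : ℚ) = ∑ i, ∑ j, -C i j * (y i - y j) ^ 2 := by
    have e1 : ∑ i, ∑ j, C i j * y i ^ 2 = 0 := by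
      refine Finset.sum_eq_zero fun i _ => ?_
      rw [← Finset.sum_mul, hCrow, zero_mul]
    have e2 : ∑ i, ∑ j, C i j * y j ^ 2 = 0 := by
      rw [Finset.sum_comm]
      refine Finset.sum_eq_zero fun j _ => ?_
      rw [← Finset.sum_mul, Finset.sum_congr rfl fun i _ => hCsymm i j, hCrow, zero_mul]
    have e3 : ∑ i, ∑ j, -C i j * (y i - y j) ^ 2 = 2 * (∑ i, ∑ j, C i j * y i * y j) -
        ∑ i, ∑ j, C i j * y i ^ 2 - ∑ i, ∑ j, C i j * y j ^ 2 := by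
      simp only [Finset.mul_sum, ← Finset.sum_sub_distrib]
      refine Finset.sum_congr rfl fun i _ => Finset.sum_congr rfl fun j _ => ?_
      ring
    rw [e3, e1, e2, hform]
    ring
  have hnonneg : ∀ i j, 0 ≤ -C i j * (y i - y j) ^ 2 := fun i j => by
    by_cases hij : i = j
    · simp [hij]
    · refine mul_nonneg ?_ (sq_nonneg _)
      have := mul_nonneg (mul_nonneg (Nat.cast_nonneg (α := ℤ) (T.symmetrizer i))
        (neg_nonneg.2 (T.cartan_nonpos hij)))
        (mul_nonneg (Nat.cast_nonneg (α := ℤ) (T.mark i)) (Nat.cast_nonneg (α := ℤ) (T.mark j)))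
      simp only [hC]
      have h' : (0 : ℚ) ≤ ((T.symmetrizer i : ℤ) * -T.cartan i j * (T.mark i * T.mark j) : ℤ) := by
        exact_mod_cast this
      refine h'.trans_eq ?_
      push_cast
      ring
  by_contra hle
  have hzero : ∑ i, ∑ j, -C i j * (y i - y j) ^ 2 = 0 := by
    apply le_antisymm
    · rw [← hsq]
      have : (T.form x x : ℚ) ≤ 0 := by exact_mod_cast not_lt.1 hle
      linarith
    · exact Finset.sum_nonneg fun i _ => Finset.sum_nonneg fun j _ => hnonneg i j
  have hall : ∀ i j, -C i j * (y i - y j) ^ 2 = 0 := fun i j =>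
    (Finset.sum_eq_zero_iff_of_nonneg fun j _ => hnonneg i j).1
      ((Finset.sum_eq_zero_iff_of_nonneg fun i _ =>
        Finset.sum_nonneg fun j _ => hnonneg i j).1 hzero i (Finset.mem_univ i)) j
        (Finset.mem_univ j)
  have hedge : ∀ i j : T.Vertex, T.Edge i j → y i = y j := fun i j he => by
    have hne : i ≠ j := fun h => T.edge_ne he (by rw [h])
    have hCij : C i j ≠ 0 := by
      simp only [hC]
      refine mul_ne_zero (mul_ne_zero ?_ (hm i)) (hm j)
      have h1 := T.cartan_neg_of_edge hne (.inl he)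
      have h2 := T.symmetrizer_pos i
      exact_mod_cast (mul_neg_of_pos_of_neg (by exact_mod_cast h2) h1).ne
    have := (mul_eq_zero.1 (hall i j)).resolve_left (neg_ne_zero.2 hCij)
    exact sub_eq_zero.1 (pow_eq_zero_iff two_ne_zero |>.1 this)
  -- if the form vanishes, `y` is constant along edges, and `y_0 = 0`
  have hconn := T.edge_connected (fun k => ∀ hk : k < T.rank + 1, y ⟨k, hk⟩ = 0)
    (fun _ => by simp [hy, h0]) (fun i j hi hj he => by
      have := hedge ⟨i, by lia⟩ ⟨j, by lia⟩ he
      constructor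
      · intro h hk; rw [← h (by lia), this]
      · intro h hk; rw [← h (by lia), this])
  apply hx
  ext i
  have h1 := hconn i (by have := i.2; lia) i.2
  have h2 := hm i
  simp only [hy, div_eq_zero_iff, Fin.eta] at h1
  exact_mod_cast h1.resolve_right h2

/-- A nonzero element of `Q₀` with nonnegative coefficients pairs positively with some coroot. -/
theorem exists_simpleCoroot_pos {x : T.RootLattice} (h0 : x 0 = 0) (hx : x ≠ 0)
    (hnn : ∀ i, 0 ≤ x i) : ∃ i, i ≠ 0 ∧ 0 < x i ∧ 0 < T.simpleCoroot i x := by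
  obtain ⟨i, _, hi⟩ := Finset.exists_lt_of_sum_lt (s := Finset.univ) (f := fun _ => (0 : ℤ))
    (g := fun i : T.Vertex => T.symmetrizer i * x i * T.simpleCoroot i x)
    (by simpa [form] using T.form_self_pos h0 hx)
  have hxi : 0 < x i := by
    refine lt_of_le_of_ne (hnn i) fun h => ?_
    simp [← h] at hi
  refine ⟨i, fun h => by rw [h, h0] at hxi; exact lt_irrefl _ hxi, hxi, ?_⟩
  have := T.symmetrizer_pos i
  exact pos_of_mul_pos_right hi (by positivity)

end AffineType

/-! ### Real roots -/

namespace AffineType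

variable {T : AffineType}

theorem simpleReflection_mem_weylGroup (i : T.Vertex) : T.simpleReflection i ∈ T.weylGroup :=
  Subgroup.subset_closure ⟨i, rfl⟩

theorem simpleReflection_δ (i : T.Vertex) : T.simpleReflection i T.δ = T.δ := by
  rw [simpleReflection_apply, simpleCoroot_δ, zero_smul, sub_zero]

theorem form_weylGroup {w : T.RootLattice ≃ₗ[ℤ] T.RootLattice} (hw : w ∈ T.weylGroup) :
    ∀ x y, T.form (w x) (w y) = T.form x y := by
  induction hw using Subgroup.closure_induction with
  | mem w hw =>
    obtain ⟨i, rfl⟩ := hw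
    exact T.form_simpleReflection i
  | one => exact fun _ _ => rfl
  | mul w w' _ _ h h' =>
    intro x y
    rw [LinearEquiv.mul_apply, LinearEquiv.mul_apply, h, h']
  | inv w _ h =>
    intro x y
    rw [← h]
    simp

theorem weylGroup_apply_mem_realRoots {w : T.RootLattice ≃ₗ[ℤ] T.RootLattice}
    (hw : w ∈ T.weylGroup) {β : T.RootLattice} (hβ : β ∈ T.realRoots) : w β ∈ T.realRoots := by
  obtain ⟨w', hw', i, rfl⟩ := hβ
  exact ⟨w * w', mul_mem hw hw', i, rfl⟩

theorem simpleReflection_mem_realRoots (i : T.Vertex) {β : T.RootLattice} (hβ : β ∈ T.realRoots) :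
    T.simpleReflection i β ∈ T.realRoots :=
  weylGroup_apply_mem_realRoots (simpleReflection_mem_weylGroup i) hβ

theorem simpleReflection_mem_realRoots_iff (i : T.Vertex) {β : T.RootLattice} :
    T.simpleReflection i β ∈ T.realRoots ↔ β ∈ T.realRoots := by
  refine ⟨fun h => ?_, simpleReflection_mem_realRoots i⟩
  have := simpleReflection_mem_realRoots i h
  rwa [simpleReflection, Module.involutive_reflection] at this

theorem simpleRoot_mem_realRoots (i : T.Vertex) : T.simpleRoot i ∈ T.realRoots :=
  ⟨1, one_mem _, i, rfl⟩

/-- The reflection in a real root `β` belongs to the Weyl group. -/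
theorem exists_reflection {β : T.RootLattice} (hβ : β ∈ T.realRoots) :
    ∃ w ∈ T.weylGroup, ∀ x, ∃ n : ℤ, n * T.form β β = 2 * T.form x β ∧ w x = x - n • β := by
  obtain ⟨w, hw, i, rfl⟩ := hβ
  refine ⟨w * T.simpleReflection i * w⁻¹,
    mul_mem (mul_mem hw (simpleReflection_mem_weylGroup i)) (inv_mem hw), fun x => ?_⟩
  obtain ⟨x, rfl⟩ := w.surjective x
  refine ⟨T.simpleCoroot i x, ?_, ?_⟩
  · rw [form_weylGroup hw, form_weylGroup hw, form_simpleRoot_self, form_comm,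
      form_simpleRoot_left]
    ring
  · have e : w⁻¹ (w x) = x := w.symm_apply_apply x
    rw [LinearEquiv.mul_apply, LinearEquiv.mul_apply, e, simpleReflection_apply, map_sub, map_smul]

/-- If `k α_i + c δ` is a real root, the product of its reflection with `s_i` is a translation
`x ↦ x + ⟨x, α_i^∨⟩ (c / k) δ`; hence real roots are stable under its powers. -/
theorem add_smul_δ_mem_realRoots {i : T.Vertex} {k c : ℤ} (hk : k ≠ 0)
    (h : k • T.simpleRoot i + c • T.δ ∈ T.realRoots) {x : T.RootLattice} (hx : x ∈ T.realRoots)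
    {n : ℤ} (hn : k * n = T.simpleCoroot i x) (m : ℤ) :
    x + (m * (n * c)) • T.δ ∈ T.realRoots := by
  obtain ⟨w, hw, hwx⟩ := exists_reflection h
  have hd : (T.symmetrizer i : ℤ) ≠ 0 := by exact_mod_cast (T.symmetrizer_pos i).ne'
  have htrans : ∀ y : T.RootLattice, k * n = T.simpleCoroot i y →
      w (T.simpleReflection i y) = y + (n * c) • T.δ := by
    intro y hy
    obtain ⟨q, hq, e⟩ := hwx (T.simpleReflection i y)
    have hq' : q = -n := by
      have e1 : T.simpleCoroot i (T.simpleReflection i y) = -(k * n) := by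
        rw [simpleReflection_apply, map_sub, map_smul, simpleCoroot_simpleRoot_self, hy,
          smul_eq_mul]
        ring
      simp only [form_add_right, form_smul_right, form_δ_right, form_comm T _ (T.simpleRoot i),
        form_simpleRoot_left, e1, simpleCoroot_simpleRoot_self] at hq
      have hkd : 2 * (k * k * T.symmetrizer i : ℤ) ≠ 0 :=
        mul_ne_zero two_ne_zero (mul_ne_zero (mul_ne_zero hk hk) hd)
      apply mul_right_cancel₀ hkd
      linarith
    rw [e, hq', simpleReflection_apply, ← hy]
    module
  have hcor : ∀ (y : T.RootLattice) (z : ℤ), T.simpleCoroot i (y + z • T.δ) = T.simpleCoroot i y :=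
    fun y z => by rw [map_add, map_smul, simpleCoroot_δ, smul_zero, add_zero]
  have hiff : ∀ y : T.RootLattice, k * n = T.simpleCoroot i y →
      (y ∈ T.realRoots ↔ y + (n * c) • T.δ ∈ T.realRoots) := fun y hy => by
    rw [← htrans y hy]
    constructor
    · exact fun h => weylGroup_apply_mem_realRoots hw (simpleReflection_mem_realRoots i h)
    · intro h
      have := weylGroup_apply_mem_realRoots (inv_mem hw) h
      rw [show w⁻¹ (w (T.simpleReflection i y)) = _ from w.symm_apply_apply _] at this
      exact (simpleReflection_mem_realRoots_iff i).1 this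
  induction m using Int.induction_on with
  | zero => simpa using hx
  | succ m ih =>
    have := (hiff _ (by rw [hcor]; exact hn)).1 ih
    rwa [add_assoc, ← add_smul, show (m : ℤ) * (n * c) + n * c = (m + 1) * (n * c) by ring] at this
  | pred m ih =>
    apply (hiff _ (by rw [hcor]; exact hn)).2
    rwa [add_assoc, ← add_smul, show (-(m : ℤ) - 1) * (n * c) + n * c = -m * (n * c) by ring]

/-! ### Real roots `α_i + rδ` -/

/-- Let `β ≥ 0` be a vector of `Q₀` of square length `2 D` with all `d_j β_j` divisible by `D`. By
positive definiteness, reflections which lower its height never leave the positive cone until a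
simple root is reached. Starting from a root `δ - k β`, they lead to a root `δ + k α_i`. -/
theorem exists_simpleRoot_of_form_eq {k : ℤ} {D : ℕ} (N : ℕ) :
    ∀ β : T.RootLattice, β 0 = 0 → (∀ i, 0 ≤ β i) → T.form β β = 2 * D → 0 < D →
      (∀ j : T.Vertex, (D : ℤ) ∣ T.symmetrizer j * β j) → (∑ i, β i) ≤ N →
      T.δ - k • β ∈ T.realRoots →
      ∃ i : T.Vertex, i ≠ 0 ∧ T.symmetrizer i = D ∧ T.δ + k • T.simpleRoot i ∈ T.realRoots := by
  induction N with
  | zero =>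
    intro β _ hnn hform hD _ hN _
    have : β = 0 := by
      ext i
      have := Finset.sum_eq_zero_iff_of_nonneg (fun i _ => hnn i) |>.1
        (le_antisymm (by simpa using hN) (Finset.sum_nonneg fun i _ => hnn i)) i (Finset.mem_univ i)
      exact this
    rw [this] at hform
    simp [form] at hform
    lia
  | succ N ih =>
    intro β h0 hnn hform hD hdvd hN hroot
    have hβ : β ≠ 0 := by
      rintro rfl
      simp [form] at hform
      lia
    obtain ⟨i, hi0, hβi, hpos⟩ := T.exists_simpleCoroot_pos h0 hβ hnn
    have hrefl : T.δ - k • T.simpleReflection i β ∈ T.realRoots := by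
      have := simpleReflection_mem_realRoots i hroot
      rwa [map_sub, map_smul, simpleReflection_δ] at this
    have hdpos : (0 : ℤ) < T.symmetrizer i := by exact_mod_cast T.symmetrizer_pos i
    have happ : ∀ j, j ≠ i → T.simpleReflection i β j = β j := fun j hj => by
      simp [simpleReflection_apply, simpleRoot, hj]
    have happ_i : T.simpleReflection i β i = β i - T.simpleCoroot i β := by
      simp [simpleReflection_apply, simpleRoot]
    by_cases hmult : ∀ j, j ≠ i → β j = 0
    · -- `β` is a multiple of `α_i`, hence equal to it
      have hβe : β = β i • T.simpleRoot i := by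
        ext j
        by_cases hj : j = i
        · subst hj; simp [simpleRoot]
        · simp [hmult j hj, simpleRoot, hj]
      have hf : β i * β i * (2 * T.symmetrizer i) = 2 * (D : ℤ) := by
        rw [← hform, hβe, form_smul_left, form_smul_right, form_simpleRoot_self]
        simp [simpleRoot]
        ring
      obtain ⟨q, hq⟩ := hdvd i
      have hqm : q * β i = 1 := by
        have hD' : (D : ℤ) ≠ 0 := by exact_mod_cast hD.ne'
        apply mul_left_cancel₀ hD'
        linarith [congrArg (fun z => z * β i) hq]
      have hβ1 : β i = 1 := by
        rcases Int.eq_one_or_neg_one_of_mul_eq_one (by rwa [mul_comm] at hqm) with h | h <;> lia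
      refine ⟨i, hi0, ?_, ?_⟩
      · rw [hβ1] at hf; lia
      · rw [hβe, hβ1, one_smul, simpleReflection_apply, simpleCoroot_simpleRoot_self] at hrefl
        convert hrefl using 1
        module
    · push Not at hmult
      obtain ⟨j, hji, hβj⟩ := hmult
      have hdvd' : ∀ l : T.Vertex, (D : ℤ) ∣ T.symmetrizer l * T.simpleReflection i β l := by
        intro l
        by_cases hl : l = i
        · subst hl
          rw [happ_i, mul_sub]
          refine dvd_sub (hdvd l) ?_
          rw [simpleCoroot_apply, Finset.mul_sum]
          refine Finset.dvd_sum fun p _ => ?_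
          rw [← mul_assoc, T.symmetrizer_mul_cartan_comm, mul_right_comm]
          exact (hdvd p).mul_right _
        · rw [happ l hl]; exact hdvd l
      have hform' : T.form (T.simpleReflection i β) (T.simpleReflection i β) = 2 * D := by
        rw [form_simpleReflection, hform]
      refine ih (T.simpleReflection i β) ?_ ?_ hform' hD hdvd' ?_ hrefl
      · rw [happ 0 (Ne.symm hi0), h0]
      · intro l
        by_cases hl : l = i
        swap
        · rw [happ l hl]; exact hnn l
        subst hl
        -- otherwise the square length of the reflected vector would exceed `2 D`
        by_contra hneg
        push Not at hneg
        set n : ℤ := -T.simpleReflection l β l with hn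
        have hnpos : 0 < n := by lia
        set γ : T.RootLattice := T.simpleReflection l β + n • T.simpleRoot l with hγ
        have hγl : γ l = 0 := by simp [hγ, hn, simpleRoot]
        have hγo : ∀ p, p ≠ l → γ p = β p := fun p hp => by
          simp [hγ, happ p hp, simpleRoot, hp]
        have hγpos : 0 < T.form γ γ := by
          refine T.form_self_pos ?_ fun h => hβj ?_
          · rw [hγo 0 (Ne.symm hi0), h0]
          · rw [← hγo j hji, h]; rfl
        have hcor : T.simpleCoroot l γ ≤ 0 := by
          rw [simpleCoroot_apply]
          refine Finset.sum_nonpos fun p _ => ?_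
          by_cases hp : p = l
          · rw [hp, hγl, mul_zero]
          · rw [hγo p hp]
            exact mul_nonpos_of_nonpos_of_nonneg (T.cartan_nonpos (Ne.symm hp)) (hnn p)
        have hexp : T.form (T.simpleReflection l β) (T.simpleReflection l β) =
            T.form γ γ + 2 * n * (n * T.symmetrizer l) -
              2 * n * (T.symmetrizer l * T.simpleCoroot l γ) := by
          have : T.simpleReflection l β = γ + (-n) • T.simpleRoot l := by
            rw [hγ, add_assoc, ← add_smul, add_neg_cancel, zero_smul, add_zero]
          rw [this]
          simp only [form_add_left, form_add_right, form_smul_left, form_smul_right,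
            form_comm T γ (T.simpleRoot l), form_simpleRoot_self]
          simp only [form_simpleRoot_left]
          ring
        have hge : (D : ℤ) ≤ n * T.symmetrizer l := by
          refine Int.le_of_dvd (mul_pos hnpos hdpos) ?_
          have := hdvd' l
          rw [hn, neg_mul, dvd_neg, mul_comm]
          exact this
        have h1 : 0 ≤ -(2 * n * (T.symmetrizer l * T.simpleCoroot l γ)) := by
          have : T.symmetrizer l * T.simpleCoroot l γ ≤ 0 :=
            mul_nonpos_of_nonneg_of_nonpos hdpos.le hcor
          have := mul_nonpos_of_nonneg_of_nonpos (show 0 ≤ 2 * n by lia) this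
          lia
        have h2 : 2 * (D : ℤ) ≤ 2 * n * (n * T.symmetrizer l) := by
          have hp : 0 < n * (T.symmetrizer l : ℤ) := mul_pos hnpos hdpos
          nlinarith
        rw [hform'] at hexp
        lia
      · have hsum : ∑ l, T.simpleReflection i β l = ∑ l, β l - T.simpleCoroot i β := by
          simp [simpleReflection_apply, simpleRoot, Finset.sum_sub_distrib, ← Finset.mul_sum]
        rw [hsum]
        push_cast at hN
        lia

theorem form_δ_sub_simpleRoot_zero : T.form (T.δ - T.simpleRoot 0) (T.δ - T.simpleRoot 0) =
    2 * T.symmetrizer 0 := by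
  rw [sub_eq_add_neg, ← neg_one_smul ℤ]
  simp only [form_add_left, form_add_right, form_smul_left, form_smul_right, form_δ_right,
    form_comm T T.δ, form_simpleRoot_self]
  simp

/-- Some `α_i + δ`, or `2 α_i + δ` in type `A_{2n}^(2)`, is a real root. -/
theorem exists_simpleRoot_add_δ : ∃ i : T.Vertex, i ≠ 0 ∧
    (¬ T.IsTwistedAEven ∧ T.symmetrizer i = T.symmetrizer 0 ∧
      T.δ + (1 : ℤ) • T.simpleRoot i ∈ T.realRoots ∨
    T.IsTwistedAEven ∧ T.symmetrizer i = 1 ∧ T.δ + (2 : ℤ) • T.simpleRoot i ∈ T.realRoots) := by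
  have hθ : ∀ i, (T.δ - T.simpleRoot 0) i = if i = 0 then 0 else (T.mark i : ℤ) := fun i => by
    by_cases hi : i = 0
    · subst hi; simp [δ, simpleRoot, mark_zero]
    · simp [δ, simpleRoot, hi]
  by_cases hT : T.IsTwistedAEven
  · -- `δ - α_0 = 2 (α_1 + … + α_n)`
    set β : T.RootLattice := fun i => if i = 0 then 0 else 1 with hβ
    have h2 : (2 : ℤ) • β = T.δ - T.simpleRoot 0 := by
      ext i
      rw [hθ]
      by_cases hi : i = 0
      · simp [hβ, hi]
      · have hi' : (i : ℕ) ≠ 0 := fun h => hi (Fin.ext h)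
        simp [hβ, hi, T.mark_of_isTwistedAEven hT hi']
    have hform := form_δ_sub_simpleRoot_zero (T := T)
    rw [← h2, form_smul_left, form_smul_right, T.symmetrizer_zero_of_isTwistedAEven hT] at hform
    obtain ⟨i, hi, hd, hr⟩ := exists_simpleRoot_of_form_eq (k := 2) (D := 1)
      (∑ i, β i).toNat β (by simp [hβ]) (fun i => by simp only [hβ]; split_ifs <;> norm_num)
      (by push_cast at hform ⊢; lia) one_pos (fun j => by simp) (Int.self_le_toNat _)
      (by rw [h2, sub_sub_cancel]; exact simpleRoot_mem_realRoots 0)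
    exact ⟨i, hi, .inr ⟨hT, hd, hr⟩⟩
  · obtain ⟨i, hi, hd, hr⟩ := exists_simpleRoot_of_form_eq (k := 1) (D := T.symmetrizer 0)
      (∑ i, (T.δ - T.simpleRoot 0) i).toNat (T.δ - T.simpleRoot 0) (by rw [hθ]; simp)
      (fun i => by rw [hθ]; split_ifs <;> simp) form_δ_sub_simpleRoot_zero (T.symmetrizer_pos 0)
      (fun j => by
        rw [hθ]
        split_ifs
        · simp
        · exact_mod_cast T.symmetrizer_zero_dvd hT j (by have := j.2; lia))
      (Int.self_le_toNat _)
      (by rw [one_smul, sub_sub_cancel]; exact simpleRoot_mem_realRoots 0)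
    exact ⟨i, hi, .inl ⟨hT, hd, hr⟩⟩

end AffineType

namespace AffineType

variable {T : AffineType}

/-- For special `i`, all `α_i + rδ` and all `2 α_i + Nδ` with odd `N` are real roots. -/
theorem special_mem_realRoots {i : T.Vertex₀} (hi : T.IsSpecial i) :
    (∀ r : ℤ, T.simpleRoot i.succ + r • T.δ ∈ T.realRoots) ∧
      ∀ N : ℤ, Odd N → (2 : ℤ) • T.simpleRoot i.succ + N • T.δ ∈ T.realRoots := by
  obtain ⟨j, hj, hj'⟩ := T.exists_simpleRoot_add_δ
  obtain ⟨-, hd, hr⟩ := hj'.resolve_left fun h => h.1 hi.1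
  obtain ⟨j, rfl⟩ := Fin.exists_succ_eq.2 hj
  have hji : j = i := by
    have h1 := hi.2
    have h2 : T.d j = 1 := hd
    rw [d_of_isTwistedAEven hi.1] at h1 h2
    ext
    split_ifs at h1 h2 <;> lia
  subst hji
  have hroot : (2 : ℤ) • T.simpleRoot j.succ + (1 : ℤ) • T.δ ∈ T.realRoots := by
    rwa [one_smul, add_comm]
  refine ⟨fun r => ?_, fun N hN => ?_⟩
  · have := add_smul_δ_mem_realRoots two_ne_zero hroot (simpleRoot_mem_realRoots j.succ) (n := 1)
      (by rw [simpleCoroot_simpleRoot_self, mul_one]) r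
    simpa using this
  · obtain ⟨m, rfl⟩ := hN
    have := add_smul_δ_mem_realRoots two_ne_zero hroot hroot (n := 2)
      (by
      rw [map_add, map_smul, map_smul, simpleCoroot_simpleRoot_self, simpleCoroot_δ]; rfl) m
    rwa [add_assoc, ← add_smul, show 1 + m * (2 * 1) = 2 * m + 1 by ring] at this

/-- For `i ∈ I₀` and `d̃_i ∣ r`, the degree `α_i + rδ` of `x_{i,r}⁺` is a real root. It suffices to
know this for one vertex, since `d̃_i a_ij ∣ d̃_j` along the edges `i, j` used. -/
theorem simpleRoot_add_smul_δ_mem_realRoots (i : T.Vertex₀) {r : ℤ} (hr : (T.dTilde i : ℤ) ∣ r) :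
    T.simpleRoot i.succ + r • T.δ ∈ T.realRoots := by
  let P : ℕ → Prop := fun m => ∀ j : T.Vertex₀, (j : ℕ) + 1 = m → ∀ r : ℤ, (T.dTilde j : ℤ) ∣ r →
    T.simpleRoot j.succ + r • T.δ ∈ T.realRoots
  obtain ⟨i₀, hi₀, hroot⟩ := T.exists_simpleRoot_add_δ
  obtain ⟨i₀, rfl⟩ := Fin.exists_succ_eq.2 hi₀
  suffices h : ∀ m, 1 ≤ m → m ≤ T.rank → P m from h (i + 1) (by lia) i.2 i rfl r hr
  refine T.edge_propagate P ?_ (i₀ := i₀ + 1) (by lia) i₀.2 ?_ ?_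
  · rintro m m' hm hm' hn hn' hedge h1 h2 hP j rfl r hr
    obtain ⟨i, rfl⟩ : ∃ i : T.Vertex₀, (i : ℕ) + 1 = m := ⟨⟨m - 1, by lia⟩, by simp; lia⟩
    have hij : i ≠ j := by
      rintro rfl
      exact hedge.elim (fun h => T.edge_ne h rfl) fun h => T.edge_ne h rfl
    have ha : T.cartan₀ i j < 0 := T.cartan_neg_of_edge (by simpa using hij) (by simpa using hedge)
    have hx : T.simpleCoroot i.succ (T.simpleRoot j.succ) = T.cartan₀ i j :=
      T.simpleCoroot_simpleRoot _ _
    have hdi : 0 < T.d i := T.symmetrizer_pos _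
    have hdj : 0 < T.d j := T.symmetrizer_pos _
    by_cases hs : T.IsSpecial i
    · by_cases hsj : T.IsSpecial j
      · exact (special_mem_realRoots hsj).1 r
      have hdj2 : T.d j = 2 := by
        have := d_of_isTwistedAEven hs.1 j
        have := fun h => hsj ⟨hs.1, h⟩
        split_ifs at * <;> lia
      have ha2 : T.cartan₀ i j = -2 := by rw [cartan₀_eq_of_neg hij ha, hs.2, hdj2]; rfl
      have := add_smul_δ_mem_realRoots two_ne_zero ((special_mem_realRoots hs).2 1 odd_one)
        (simpleRoot_mem_realRoots j.succ) (n := -1) (by rw [hx, ha2]; rfl) (-r)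
      simpa using this
    have hstep : T.cartan₀ i j * T.dTilde i ∣ (T.dTilde j : ℤ) := by
      by_cases hT : T.order = 1 ∨ T.IsTwistedAEven
      · rw [dTilde_eq_one hT, dTilde_eq_one hT]
        have hle : T.d j ≤ T.d i := by
          by_cases hA : T.IsTwistedAEven
          · have hi2 := d_of_isTwistedAEven hA i
            have hj2 := d_of_isTwistedAEven hA j
            have := fun h => hs ⟨hA, h⟩
            split_ifs at hi2 hj2 <;> lia
          · exact h1 (hT.resolve_right hA)
        rw [cartan₀_eq_of_neg hij ha, max_eq_left hle, Nat.div_self hdi]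
        simp
      · have hle : T.d i ≤ T.d j := h2 fun h => hT (.inl h)
        rw [dTilde_eq_d hT, dTilde_eq_d hT, cartan₀_eq_of_neg hij ha, max_eq_right hle, neg_mul,
          neg_dvd]
        have hdvd : T.d i ∣ T.d j := by
          rcases d_eq_one_or_order hT i with h | h
          · rw [h]; exact one_dvd _
          · rcases d_eq_one_or_order hT j with h' | h'
            · rw [show T.d i = 1 by lia]; exact one_dvd _
            · rw [h, h']
        exact_mod_cast (Nat.div_mul_cancel hdvd).dvd
    obtain ⟨q, rfl⟩ := hstep.trans hr
    have := add_smul_δ_mem_realRoots (k := 1) one_ne_zero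
      (by rw [one_smul]; exact hP i rfl (T.dTilde i) dvd_rfl)
      (simpleRoot_mem_realRoots j.succ) (n := T.cartan₀ i j) (by rw [hx, one_mul]) q
    rwa [mul_comm q] at this
  · rintro j hj r -
    obtain rfl : j = i₀ := by ext; lia
    rcases hroot with ⟨-, -, h⟩ | ⟨hA, hd, -⟩
    · have h' : (1 : ℤ) • T.simpleRoot j.succ + (1 : ℤ) • T.δ ∈ T.realRoots := by
        rwa [one_smul ℤ T.δ, add_comm]
      have key := fun {x} hx hn => add_smul_δ_mem_realRoots (x := x) one_ne_zero h' hx (n := 2) hn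
      have h₀ := key (simpleRoot_mem_realRoots j.succ) (by rw [simpleCoroot_simpleRoot_self]; rfl)
      have h₁ := key h' (by
      rw [map_add, map_smul, map_smul, simpleCoroot_simpleRoot_self, simpleCoroot_δ]; rfl)
      obtain ⟨m, rfl | rfl⟩ := Int.even_or_odd' r
      · simpa [mul_comm] using h₀ m
      · have := h₁ m
        rwa [one_smul ℤ (T.simpleRoot _), add_assoc, ← add_smul,
          show 1 + m * (2 * 1) = 2 * m + 1 by ring] at this
    · exact (special_mem_realRoots ⟨hA, hd⟩).1 r
  · rcases hroot with ⟨-, h, -⟩ | ⟨hA, h, -⟩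
    · exact .inl h
    · exact .inr ⟨hA, h⟩

end AffineType

/-! ### Weights of the loop algebra as elements of the root lattice -/

namespace AffineType

variable {T : AffineType}

/-- The embedding `(α, r) ↦ α + rδ` of degrees into the root lattice. -/
def toRootLattice : T.LoopWeight →+ T.RootLattice where
  toFun γ := (Fin.cons 0 γ.1 : T.RootLattice) + γ.2 • T.δ
  map_zero' := by
    ext i
    refine Fin.cases ?_ (fun j => ?_) i <;> simp
  map_add' γ γ' := by
    ext i
    refine Fin.cases ?_ (fun j => ?_) i <;> simp <;> ring

theorem toRootLattice_apply (γ : T.LoopWeight) :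
    toRootLattice γ = (Fin.cons 0 γ.1 : T.RootLattice) + γ.2 • T.δ := rfl

theorem toRootLattice_injective : Function.Injective (toRootLattice (T := T)) := by
  refine (injective_iff_map_eq_zero _).2 fun γ h => ?_
  have h2 : γ.2 = 0 := by simpa [toRootLattice_apply, δ, T.mark_zero] using congrFun h 0
  refine Prod.ext (funext fun j => ?_) h2
  simpa [toRootLattice_apply, h2] using congrFun h j.succ

theorem cons_single (i : T.Vertex₀) (k : ℤ) :
    (Fin.cons 0 (Pi.single i k : T.Vertex₀ → ℤ) : T.RootLattice) = k • T.simpleRoot i.succ := by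
  ext j
  refine Fin.cases ?_ (fun j => ?_) j
  · simp [simpleRoot, (Fin.succ_ne_zero _).symm]
  · simp [simpleRoot, Pi.single_apply]

theorem toRootLattice_loopWt (p : T.Vertex₀ × ℕ) :
    toRootLattice (loopWt p) = T.simpleRoot p.1.succ + p.2 • T.δ := by
  rw [toRootLattice_apply, loopWt, cons_single, one_smul, natCast_zsmul]

theorem simpleCoroot_cons (i : T.Vertex₀) (x : T.Vertex₀ → ℤ) (r : ℤ) :
    T.simpleCoroot i.succ (Fin.cons 0 x) = loopCoroot i (x, r) := by
  rw [simpleCoroot_apply, Fin.sum_univ_succ]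
  simp [loopCoroot, cartan₀]

theorem simpleReflection_toRootLattice (i : T.Vertex₀) (γ : T.LoopWeight) :
    T.simpleReflection i.succ (toRootLattice γ) =
      toRootLattice (γ - loopCoroot i γ • loopWt (i, 0)) := by
  rw [simpleReflection_apply, map_sub, map_zsmul, toRootLattice_loopWt, zero_smul, add_zero,
    toRootLattice_apply, map_add, map_smul, simpleCoroot_δ, smul_zero, add_zero,
    simpleCoroot_cons i γ.1 γ.2]

/-- Both `α + rδ` and `-α + rδ` are real roots, for `γ = (α, r)`: the first is the degree of the
piece `γ` of `L₊`, the second the degree of the same space seen in `L₋`. -/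
def IsRealPair (γ : T.LoopWeight) : Prop :=
  toRootLattice γ ∈ T.realRoots ∧ toRootLattice (-γ.1, γ.2) ∈ T.realRoots

theorem isRealPair_of_sub (i : T.Vertex₀) {γ : T.LoopWeight}
    (h : IsRealPair (γ - loopCoroot i γ • loopWt (i, 0))) : IsRealPair γ := by
  refine ⟨?_, ?_⟩
  · rw [← simpleReflection_mem_realRoots_iff i.succ, simpleReflection_toRootLattice]
    exact h.1
  · rw [← simpleReflection_mem_realRoots_iff i.succ, simpleReflection_toRootLattice]
    convert h.2 using 2
    have : loopCoroot i (-γ.1, γ.2) = -loopCoroot i γ := by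
      simp [loopCoroot]
    rw [this]
    refine Prod.ext ?_ ?_
    · simp [add_comm, sub_eq_add_neg]
    · simp [loopWt]

theorem isRealPair_of_single {i : T.Vertex₀} {k r : ℤ}
    (h : k • T.simpleRoot i.succ + r • T.δ ∈ T.realRoots) :
    IsRealPair (T := T) (Pi.single i k, r) := by
  have h1 : toRootLattice (T := T) (Pi.single i k, r) ∈ T.realRoots := by
    rwa [toRootLattice_apply, cons_single]
  refine ⟨h1, ?_⟩
  have h2 := simpleReflection_mem_realRoots i.succ h1
  rw [toRootLattice_apply, cons_single, map_add, map_smul, map_smul, simpleReflection_δ,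
    simpleReflection_apply, simpleCoroot_simpleRoot_self] at h2
  rw [toRootLattice_apply]
  simp only [← Pi.single_neg, cons_single]
  convert h2 using 2
  module

/-! ### Dimension and support of `L₊` -/

/-- The components of `L₊` are at most one-dimensional, and live in degrees `α + rδ` which are
real roots. If `⟨α, α_i^∨⟩ = p > 0`, the `p`-th power of the raising operator maps the component
of degree `s_i α + rδ` onto that of degree `α + rδ`; this reduces to multiples of simple roots. -/
theorem piece_le_span_and_isRealPair (N : ℕ) : ∀ γ : T.LoopWeight, γ.1 ≠ 0 → ∑ j, γ.1 j ≤ N →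
    (∃ v, piece γ ≤ Submodule.span ℂ {v}) ∧ (piece γ ≠ ⊥ → IsRealPair γ) := by
  induction N with
  | zero =>
    intro γ hγ hN
    suffices h : piece γ = ⊥ from ⟨⟨0, by simp [h]⟩, fun h' => absurd h h'⟩
    by_contra hne
    have hnn : ∀ j, 0 ≤ γ.1 j := fun j => not_lt.1 fun h => hne (piece_eq_bot_of_neg h)
    refine hγ (funext fun j => ?_)
    exact (Finset.sum_eq_zero_iff_of_nonneg fun j _ => hnn j).1
      (le_antisymm (by exact_mod_cast hN) (Finset.sum_nonneg fun j _ => hnn j)) j (Finset.mem_univ j)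
  | succ N ih =>
    intro γ hγ hN
    by_cases hnn : ∀ j, 0 ≤ γ.1 j
    swap
    · push Not at hnn
      obtain ⟨j, hj⟩ := hnn
      have h := piece_eq_bot_of_neg hj
      exact ⟨⟨0, by simp [h]⟩, fun h' => absurd h h'⟩
    by_cases hmult : ∃ i, ∀ j ≠ i, γ.1 j = 0
    · obtain ⟨i, hi⟩ := hmult
      obtain ⟨h1, h2⟩ := piece_of_multiple hi
      refine ⟨h1, fun hne => ?_⟩
      rcases h2 with h2 | ⟨r, hr, rfl⟩ | ⟨hs, M, hM, rfl⟩
      · exact absurd h2 hne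
      · refine isRealPair_of_single ?_
        rw [one_smul]
        exact simpleRoot_add_smul_δ_mem_realRoots i (by exact_mod_cast hr)
      · exact isRealPair_of_single ((special_mem_realRoots hs).2 M (by exact_mod_cast hM))
    · push Not at hmult
      obtain ⟨i, hi0, -, hpos⟩ := T.exists_simpleCoroot_pos (x := Fin.cons 0 γ.1) rfl
        (fun h => hγ (funext fun j => by simpa using congrFun h j.succ))
        (fun i => by refine Fin.cases ?_ (fun j => ?_) i <;> simp [hnn])
      obtain ⟨i, rfl⟩ := Fin.exists_succ_eq.2 hi0
      rw [simpleCoroot_cons i γ.1 γ.2] at hpos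
      obtain ⟨p, hp⟩ := Int.eq_ofNat_of_zero_le hpos.le
      have hle := piece_le_map_raise (hmult i) hp
      obtain ⟨j, hji, hj⟩ := hmult i
      obtain ⟨⟨v, hv⟩, hreal⟩ := ih (γ - p • loopWt (i, 0))
        (fun h => hj (by simpa [loopWt, hji] using congrFun h j)) (by
          have : ∑ j, (γ - p • loopWt (i, 0)).1 j = ∑ j, γ.1 j - p := by
            simp [loopWt, Finset.sum_sub_distrib, ← Finset.mul_sum]
          rw [this]
          have : (0 : ℤ) < p := by rw [← hp]; exact hpos
          push_cast at hN
          lia)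
      refine ⟨⟨(raise i ^ p) v, ?_⟩, fun hne => ?_⟩
      · refine hle.trans ((Submodule.map_mono hv).trans ?_)
        rw [Submodule.map_span, Set.image_singleton]
      · refine isRealPair_of_sub i ?_
        rw [hp, natCast_zsmul]
        refine hreal fun h => hne ?_
        rwa [h, Submodule.map_bot, le_bot_iff] at hle

/-! ### The components of `L` -/

/-- The identity map `L^op → L`, as a linear map. -/
def unopLinear : T.LMinus →ₗ[ℂ] T.LPlus where
  toFun := LieOpposite.unop
  map_add' _ _ := rfl
  map_smul' _ _ := rfl

theorem comap_unopLinear_bot : (⊥ : Submodule ℂ T.LPlus).comap unopLinear = ⊥ :=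
  LinearMap.ker_eq_bot.2 fun _ _ h => h

/-- Monomials of degree `-α + rδ` in `L₋` are monomials of degree `α + rδ` in `L₊`, up to sign. -/
theorem IsMonomial.unop {γ : T.RootLattice} {u : T.LMinus}
    (hu : IsMonomial T.xMinus (fun p => -T.simpleRoot p.1.succ + p.2 • T.δ) γ u) :
    ∃ γ' : T.LoopWeight, toRootLattice (-γ'.1, γ'.2) = γ ∧ LieOpposite.unop u ∈ piece γ' := by
  induction hu with
  | gen p =>
    refine ⟨loopWt p, ?_, neg_mem (xPlus_mem_piece p)⟩
    rw [toRootLattice_apply]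
    simp only [loopWt, ← Pi.single_neg, cons_single, neg_smul, one_smul, natCast_zsmul]
  | lie _ _ h h' =>
    obtain ⟨γ₁, rfl, h₁⟩ := h
    obtain ⟨γ₂, rfl, h₂⟩ := h'
    refine ⟨γ₂ + γ₁, ?_, lie_mem_piece h₂ h₁⟩
    rw [← map_add]
    congr 1
    simp [add_comm]

theorem apply_zero_of_mem_Q₀ {α : T.RootLattice} (hα : α ∈ T.Q₀) : α 0 = 0 := by
  induction hα using Submodule.span_induction with
  | mem x hx =>
    obtain ⟨i, rfl⟩ := hx
    simp [simpleRoot, (Fin.succ_ne_zero _).symm]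
  | zero => rfl
  | add x y _ _ hx hy => simp [hx, hy]
  | smul t x _ hx => simp [hx]

theorem gradedPiece_xMinus_le (γ : T.LoopWeight) :
    gradedPiece T.xMinus (fun p => -T.simpleRoot p.1.succ + p.2 • T.δ) (toRootLattice γ) ≤
      (piece (-γ.1, γ.2)).comap unopLinear := by
  refine Submodule.span_le.2 fun u hu => ?_
  obtain ⟨γ', h, hu'⟩ := IsMonomial.unop hu
  rw [← toRootLattice_injective h]
  change LieOpposite.unop u ∈ piece _
  simpa using hu'

theorem gradedPiece_xPlus_le (γ : T.LoopWeight) :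
    gradedPiece T.xPlus (fun p => T.simpleRoot p.1.succ + p.2 • T.δ) (toRootLattice γ) ≤
      piece γ := by
  have := gradedPiece_comp_le T.xPlus loopWt toRootLattice toRootLattice_injective γ
  simp only [toRootLattice_loopWt] at this
  exact this

theorem gradedPiece_hZero_eq_bot {γ : T.LoopWeight} (hγ : γ.1 ≠ 0) :
    gradedPiece T.hZero (fun p => p.2 • T.δ) (toRootLattice γ) = ⊥ := by
  have key : ∀ {β u}, IsMonomial T.hZero (fun p => p.2 • T.δ) β u → ∃ n : ℤ, β = n • T.δ := by
    intro β u hu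
    induction hu with
    | gen p => exact ⟨p.2, (natCast_zsmul _ _).symm⟩
    | lie _ _ h h' =>
      obtain ⟨n, rfl⟩ := h
      obtain ⟨n', rfl⟩ := h'
      exact ⟨n + n', (add_smul _ _ _).symm⟩
  refine le_bot_iff.1 (Submodule.span_le.2 fun u hu => absurd (key hu) ?_)
  rintro ⟨n, hn⟩
  refine hγ ?_
  have : toRootLattice γ = toRootLattice ((0, n) : T.LoopWeight) := by
    rw [hn, toRootLattice_apply]
    ext i
    refine Fin.cases ?_ (fun j => ?_) i <;> simp
  rw [toRootLattice_injective this]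

/-- The component of degree `α + rδ`, `α ≠ 0`, is at most one-dimensional, and vanishes unless
`α + rδ` is a real root. Only one of `L₊` and `L₋` contributes, according to the sign of `α`. -/
theorem component_le_span {γ : T.LoopWeight} (hγ : γ.1 ≠ 0) :
    (∃ v, T.component (toRootLattice γ) ≤ Submodule.span ℂ {v}) ∧
      (T.component (toRootLattice γ) ≠ ⊥ → toRootLattice γ ∈ T.realRoots) := by
  have hzero := gradedPiece_hZero_eq_bot hγ
  have hplus := gradedPiece_xPlus_le γ
  have hminus := gradedPiece_xMinus_le γ
  have hγ' : (-γ.1, γ.2).1 ≠ 0 := neg_ne_zero.2 hγ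
  obtain ⟨⟨v, hv⟩, hr⟩ := piece_le_span_and_isRealPair _ γ hγ (Int.self_le_toNat _)
  obtain ⟨⟨w, hw⟩, hr'⟩ :=
    piece_le_span_and_isRealPair _ ((-γ.1, γ.2) : T.LoopWeight) hγ' (Int.self_le_toNat _)
  rw [component, hzero]
  by_cases hneg : ∃ j, γ.1 j < 0
  · obtain ⟨j, hj⟩ := hneg
    rw [piece_eq_bot_of_neg hj, le_bot_iff] at hplus
    rw [hplus]
    refine ⟨⟨(LieOpposite.op w, 0, 0), ?_⟩, fun hne => ?_⟩
    · rintro ⟨x, y, z⟩ ⟨hx, hy, hz⟩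
      obtain ⟨t, ht⟩ := Submodule.mem_span_singleton.1 (hw (hminus hx))
      obtain rfl : y = 0 := hy
      obtain rfl : z = 0 := hz
      exact Submodule.mem_span_singleton.2 ⟨t, Prod.ext ht (by simp)⟩
    · have h : (piece (-γ.1, γ.2) : Submodule ℂ T.LPlus) ≠ ⊥ := by
        intro h
        rw [h, comap_unopLinear_bot, le_bot_iff] at hminus
        rw [hminus] at hne
        simp at hne
      simpa using (hr' h).2
  · push Not at hneg
    obtain ⟨j, hj⟩ := Function.ne_iff.1 hγ
    have hj : ((-γ.1, γ.2) : T.LoopWeight).1 j < 0 := neg_lt_zero.2 (lt_of_le_of_ne (hneg j) hj.symm)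
    rw [piece_eq_bot_of_neg hj, comap_unopLinear_bot, le_bot_iff] at hminus
    rw [hminus]
    refine ⟨⟨(0, 0, v), ?_⟩, fun hne => ?_⟩
    · rintro ⟨x, y, z⟩ ⟨hx, hy, hz⟩
      obtain ⟨t, ht⟩ := Submodule.mem_span_singleton.1 (hv (hplus hz))
      obtain rfl : x = 0 := hx
      obtain rfl : y = 0 := hy
      exact Submodule.mem_span_singleton.2 ⟨t, Prod.ext (by simp) (Prod.ext (by simp) ht)⟩
    · refine (hr fun h => hne ?_).1
      rw [h, le_bot_iff] at hplus
      rw [hplus]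
      simp

end AffineType

theorem proposition8p20 (T : AffineType) (α : T.RootLattice) (hα : α ∈ T.Q₀) (hα0 : α ≠ 0)
    (r : ℕ) :
    (α + r • T.δ ∈ T.roots → Module.rank ℂ (T.component (α + r • T.δ)) ≤ 1) ∧
      (α + r • T.δ ∉ T.roots → Module.rank ℂ (T.component (α + r • T.δ)) = 0) := by
  have h0 := AffineType.apply_zero_of_mem_Q₀ hα
  have hcons : (Fin.cons 0 (fun j => α j.succ) : T.RootLattice) = α := by
    rw [← h0]; exact Fin.cons_self_tail α
  have e : α + r • T.δ = AffineType.toRootLattice (fun j => α j.succ, (r : ℤ)) := by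
    rw [AffineType.toRootLattice_apply, hcons, natCast_zsmul]
  have hne : (fun j : T.Vertex₀ => α j.succ) ≠ 0 := by
    intro h
    rw [h] at hcons
    exact hα0 (hcons ▸ funext fun i => Fin.cases rfl (fun _ => rfl) i)
  obtain ⟨⟨v, hv⟩, hr⟩ := AffineType.component_le_span (γ := (fun j => α j.succ, (r : ℤ))) hne
  rw [e]
  refine ⟨fun _ => (rank_submodule_le_one_iff' _).2 ⟨v, hv⟩, fun hroot => ?_⟩
  have : T.component (AffineType.toRootLattice (fun j => α j.succ, (r : ℤ))) = ⊥ :=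
    not_not.1 fun h => hroot (.inl (hr h))
  rw [this]
  exact rank_bot ℂ _

end
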